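/- Let $K_1,K_3>0$, $c(\psi)=\sqrt{K_1\sin^2\psi+K_3\cos^2\psi}$ and $W_0\in C^4\big((-\tfrac12,1)\big)$. Consider for $\psi=\psi(t,x)\in\mathbb R$ and $s=s(t,x)\in(-\tfrac12,1)$ the two-component nonlinear variational wave system $$s^2\big(\psi_{tt}-c(\psi)(c(\psi)\psi_x)_x\big)+2s\big(\psi_ts_t-c(\psi)^2\psi_xs_x\big)+c(\psi)c'(\psi)s_x^2=0,$$ $$s_{tt}-c(\psi)(c(\psi)s_x)_x-c(\psi)c'(\psi)\psi_xs_x-s\big(\psi_t^2-c(\psi)^2\psi_x^2\big)+W_0'(s)=0,$$ with energy density $$\mathcal E=\tfrac12\Big(s^2\big(\psi_t^2+c(\psi)^2\psi_x^2\big)+s_t^2+c(\psi)^2s_x^2\Big)+W_0(s).$$ **Theorem.** Let $\psi_0,s_0\in C^2(\mathbb R)$ have bounded first and second derivatives and Lipschitz continuous second derivatives, and let $\psi_{t0},s_{t0}\in C^1(\mathbb R)$ be bounded with bounded and Lipschitz continuous first derivatives. Suppose that $s_0$ takes values in $(-\tfrac12,1)$ and that $\inf_{\mathbb R}|s_0|>0$;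 let $J$ be that one of the intervals $(-\tfrac12,0)$ and $(0,1)$ which contains the values of $s_0$. Assume that $W_0\ge0$ on $J$, that $W_0(\sigma)\to+\infty$ as $\sigma\in J$ tends to the endpoint of $J$ different from $0$, and that the energy $E_0=\int_{\mathbb R}\mathcal E\,dx$ of the initial data $(\psi_0,\psi_{t0},s_0,s_{t0})$ is finite. Then there are $T>0$ and $\psi,s\in C^2([0,T]\times\mathbb R)$, with $s$ taking values in $(-\tfrac12,1)$, that satisfy the system at every point of $[0,T]\times\mathbb R$ and $$(\psi,\psi_t,s,s_t)|_{t=0}=(\psi_0,\psi_{t0},s_0,s_{t0}),$$ such that: 1. $\inf_{[0,T]\times\mathbb R}|s|>0$, and each of the six functions $\psi-\psi_0,\ s,\ \psi_t,\ s_t,\ c(\psi)\psi_x,\ c(\psi)s_x$ belongs to $C([0,T],W^{1,\infty}(\mathbb R))\cap C^1([0,T],L^\infty(\mathbb R))$; 2. for every $t\in[0,T]$ the function $\mathcal E(t,\cdot)$ is integrable and $\int_{\mathbb R}\mathcal E(t,x)\,dx=E_0$; 3. if $T'>0$ and $(\tilde\psi,\tilde s)$, with $\tilde\psi,\tilde s\in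 C^2([0,T']\times\mathbb R)$ and $\tilde s$ taking values in $(-\tfrac12,1)$, satisfies the system on $[0,T']\times\mathbb R$ with the same initial data, then $(\tilde\psi,\tilde s)=(\psi,s)$ on $[0,\min(T,T')]\times\mathbb R$. -/

import Mathlib

open Set Filter Topology MeasureTheory

namespace NVW

/-- The wave speed `c(ψ) = √(K₁ sin² ψ + K₃ cos² ψ)`. -/
noncomputable def waveSpeed (K1 K3 : ℝ) (p : ℝ) : ℝ :=
  Real.sqrt (K1 * Real.sin p ^ 2 + K3 * Real.cos p ^ 2)

/-- Time derivative of `f : (t, x) ↦ f t x` on `[0, T] × ℝ`, one-sided at the endpoints of `[0, T]`. -/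
noncomputable def dt (T : ℝ) (f : ℝ → ℝ → ℝ) (t x : ℝ) : ℝ :=
  derivWithin (fun τ => f τ x) (Icc 0 T) t

/-- Space derivative of `f : (t, x) ↦ f t x`. -/
noncomputable def dx (f : ℝ → ℝ → ℝ) (t x : ℝ) : ℝ :=
  deriv (fun y => f t y) x

/-- A classical solution on `[0, T] × ℝ` of the two-component nonlinear variational wave system:
`ψ` and `s` are twice continuously differentiable up to the boundary, the order parameter has values
in `(-1/2, 1)`, and both equations hold at every point. -/
structure IsClassicalSolution (K1 K3 : ℝ) (W : ℝ → ℝ) (T : ℝ) (ψ s : ℝ → ℝ → ℝ) : Prop where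
  contDiff_psi : ContDiffOn ℝ 2 (fun z : ℝ × ℝ => ψ z.1 z.2) (Icc 0 T ×ˢ univ)
  contDiff_s : ContDiffOn ℝ 2 (fun z : ℝ × ℝ => s z.1 z.2) (Icc 0 T ×ˢ univ)
  range_s : ∀ t ∈ Icc 0 T, ∀ x, s t x ∈ Ioo (-1 / 2 : ℝ) 1
  eq_psi : ∀ t ∈ Icc 0 T, ∀ x,
    (s t x) ^ 2 * (dt T (dt T ψ) t x
        - waveSpeed K1 K3 (ψ t x) * dx (fun t' y => waveSpeed K1 K3 (ψ t' y) * dx ψ t' y) t x)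
      + 2 * s t x * (dt T ψ t x * dt T s t x
        - waveSpeed K1 K3 (ψ t x) ^ 2 * dx ψ t x * dx s t x)
      + waveSpeed K1 K3 (ψ t x) * deriv (waveSpeed K1 K3) (ψ t x) * dx s t x ^ 2 = 0
  eq_s : ∀ t ∈ Icc 0 T, ∀ x,
    dt T (dt T s) t x
      - waveSpeed K1 K3 (ψ t x) * dx (fun t' y => waveSpeed K1 K3 (ψ t' y) * dx s t' y) t x
      - waveSpeed K1 K3 (ψ t x) * deriv (waveSpeed K1 K3) (ψ t x) * dx ψ t x * dx s t x
      - s t x * (dt T ψ t x ^ 2 - waveSpeed K1 K3 (ψ t x) ^ 2 * dx ψ t x ^ 2)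
      + deriv W (s t x) = 0

/-- The pair `(ψ, s)` on `[0, T] × ℝ` attains the initial data `(ψ₀, ψ_{t0}, s₀, s_{t0})`. -/
structure HasInitialData (T : ℝ) (ψ0 ψt0 s0 st0 : ℝ → ℝ) (ψ s : ℝ → ℝ → ℝ) : Prop where
  init_psi : ∀ x, ψ 0 x = ψ0 x
  init_psi_t : ∀ x, dt T ψ 0 x = ψt0 x
  init_s : ∀ x, s 0 x = s0 x
  init_s_t : ∀ x, dt T s 0 x = st0 x

/-- The energy density
`½ (s² (ψ_t² + c(ψ)² ψ_x²) + (s_t² + c(ψ)² s_x²)) + W₀(s)` as a function of the values of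
`ψ, ψ_t, ψ_x, s, s_t, s_x`. -/
noncomputable def energyDensity (K1 K3 : ℝ) (W : ℝ → ℝ) (p pt px s st sx : ℝ) : ℝ :=
  (s ^ 2 * (pt ^ 2 + waveSpeed K1 K3 p ^ 2 * px ^ 2)
    + (st ^ 2 + waveSpeed K1 K3 p ^ 2 * sx ^ 2)) / 2 + W s

/-- The energy density of the initial data. -/
noncomputable def initialEnergyDensity (K1 K3 : ℝ) (W ψ0 ψt0 s0 st0 : ℝ → ℝ) (x : ℝ) : ℝ :=
  energyDensity K1 K3 W (ψ0 x) (ψt0 x) (deriv ψ0 x) (s0 x) (st0 x) (deriv s0 x)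

/-- The energy density of a pair `(ψ, s)` on `[0, T] × ℝ`. -/
noncomputable def solutionEnergyDensity (K1 K3 : ℝ) (W : ℝ → ℝ) (T : ℝ) (ψ s : ℝ → ℝ → ℝ)
    (t x : ℝ) : ℝ :=
  energyDensity K1 K3 W (ψ t x) (dt T ψ t x) (dx ψ t x) (s t x) (dt T s t x) (dx s t x)

/-- `f` is `n` times continuously differentiable, its derivatives of orders `m, …, n` are bounded,
and the `n`-th one is Lipschitz continuous. For `m = 0` this is `f ∈ W^{n+1,∞}(ℝ)`. -/
def BoundedDerivs (m n : ℕ) (f : ℝ → ℝ) : Prop :=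
  ContDiff ℝ n f ∧ ∃ L : ℝ,
    (∀ k, m ≤ k → k ≤ n → ∀ x, |iteratedDeriv k f x| ≤ L) ∧
    ∀ x y, |iteratedDeriv n f x - iteratedDeriv n f y| ≤ L * |x - y|

/-- `t ↦ f t` is a continuous curve on `[0, T]` in the space of bounded functions on `ℝ` with the
supremum norm. -/
def ContinuousInSup (T : ℝ) (f : ℝ → ℝ → ℝ) : Prop :=
  (∀ t ∈ Icc 0 T, ∃ M : ℝ, ∀ x, |f t x| ≤ M) ∧
  ∀ t ∈ Icc 0 T, ∀ ε > 0, ∃ δ > 0, ∀ t' ∈ Icc 0 T, |t' - t| < δ → ∀ x, |f t' x - f t x| ≤ ε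

/-- For continuously differentiable `f` this is
`f ∈ C([0, T], W^{1,∞}(ℝ)) ∩ C¹([0, T], L^∞(ℝ))`. -/
def InSolutionSpace (T : ℝ) (f : ℝ → ℝ → ℝ) : Prop :=
  ContinuousInSup T f ∧ ContinuousInSup T (dx f) ∧ ContinuousInSup T (dt T f)

end NVW

/-! Together with `ψ` and `s`, the Riemann variables `ψₜ ± c ψₓ` and `sₜ ± c sₓ` turn the wave
system into a diagonal system `∂ₜUᵢ + lamᵢ(U) ∂ₓUᵢ = Fᵢ(U)` for six unknowns with speeds `0` and
`∓c`. Its right-hand sides contain a division by `s²` and the function `W'`, so they are controlled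
only while `s` stays away from `0` and from the outer endpoint. The first gap is assumed. The second
follows from finite energy (`exists_gap`): a Lipschitz function that comes close to the endpoint
stays close on an interval of fixed length, and this can happen far out only at the cost of energy
that is not there.

Existence (`exists_quasilinear_solution`) uses Euler's method along characteristics. A step of
length `τ` enlarges the bound of the spatial derivative and its Lipschitz constant by `O(τ)` only,
so both stay bounded for a short time. On the resulting set of states a step is stable with factor
`1 + C τ`, and two steps differ from one combined step by `O(τ σ)`. Hence dyadic refinements
converge uniformly (`EulerScheme.exists_limit`), and the derivative bounds survive in the limit.

In the way back to the wave system, the relations `c ψₓ = (U₂ - U₃) / 2` and `c sₓ = (U₄ - U₅) / 2`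
hold initially and their defects solve a linear homogeneous ODE in time (`constraint_propagates`).
The first derivatives of `ψ` and `s` are then smooth functions of `C¹` quantities, which makes `ψ`
and `s` of class `C²`.

Uniqueness (`quasilinear_unique`) is a maximum principle on backward cones, `eq_zero_on_cone`. The
competing solution may have zeros of `s`, so the equations are kept multiplied by `s²` and divided
only along the constructed solution.

The energy density `e` satisfies `∂ₜe = ∂ₓf` with `|f| ≤ M e`. A potential of this conservation law
is monotone along lines of slope `±M`, which compares the energies of nested intervals at different
times and gives conservation without any decay assumption (`integral_conserved`). -/

namespace NVW

/-! ### Convergence of abstract Euler schemes in the supremum norm. -/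

/-- A one-step approximation `Φ τ` of an evolution on functions `α → E`, consistent to first order
and stable in the supremum norm along an increasing family `G` of sets closed under pointwise
convergence. -/
structure EulerScheme {α E : Type*} [NormedAddCommGroup E] (Φ : ℝ → (α → E) → α → E)
    (G : ℝ → Set (α → E)) (T C : ℝ) : Prop where
  T_pos : 0 < T
  C_nonneg : 0 ≤ C
  mono : ∀ ρ ρ', ρ ≤ ρ' → G ρ ⊆ G ρ'
  closed : ∀ ρ (u : ℕ → α → E) (v : α → E), ρ ≤ T → (∀ n, u n ∈ G ρ) →
    (∀ x, Tendsto (fun n => u n x) atTop (𝓝 (v x))) → v ∈ G ρ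
  mapsTo : ∀ ρ τ u, 0 ≤ ρ → 0 ≤ τ → ρ + τ ≤ T → u ∈ G ρ → Φ τ u ∈ G (ρ + τ)
  stable : ∀ τ u v δ, 0 ≤ τ → τ ≤ T → u ∈ G T → v ∈ G T → (∀ x, ‖u x - v x‖ ≤ δ) →
    ∀ x, ‖Φ τ u x - Φ τ v x‖ ≤ (1 + C * τ) * δ
  consistent : ∀ ρ τ σ u, 0 ≤ ρ → 0 ≤ τ → 0 ≤ σ → ρ + τ + σ ≤ T → u ∈ G ρ →
    ∀ x, ‖Φ τ (Φ σ u) x - Φ (τ + σ) u x‖ ≤ C * τ * σ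
  lipschitz_time : ∀ τ σ u, 0 ≤ τ → τ ≤ T → 0 ≤ σ → σ ≤ T → u ∈ G T →
    ∀ x, ‖Φ τ u x - Φ σ u x‖ ≤ C * |τ - σ|
  zero : ∀ u, Φ 0 u = u

namespace EulerScheme

variable {α E : Type*} [NormedAddCommGroup E] {Φ : ℝ → (α → E) → α → E}
  {G : ℝ → Set (α → E)} {T C : ℝ}

lemma iterate_mem (S : EulerScheme Φ G T C) {ρ τ : ℝ} {u : α → E} (hρ : 0 ≤ ρ) (hτ : 0 ≤ τ)
    (hu : u ∈ G ρ) (m : ℕ) (h : ρ + m * τ ≤ T) : (Φ τ)^[m] u ∈ G (ρ + m * τ) := by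
  induction m with
  | zero => simpa using hu
  | succ m ih =>
    push_cast at h
    have h1 : ρ + m * τ ≤ T := by nlinarith
    rw [Function.iterate_succ_apply']
    have := S.mapsTo (ρ + m * τ) τ _ (by positivity) hτ (by linarith) (ih h1)
    convert this using 2
    push_cast; ring

lemma one_add_le_exp (_S : EulerScheme Φ G T C) {τ : ℝ} (m : ℕ) :
    (1 + C * τ) * Real.exp (C * (m * τ)) ≤ Real.exp (C * ((m + 1) * τ)) := by
  have : C * ((m + 1) * τ) = C * τ + C * (m * τ) := by ring
  rw [this, Real.exp_add]
  have := Real.add_one_le_exp (C * τ)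
  gcongr
  linarith

/-- Each further step amplifies the old error by `1 + C τ` and adds the consistency defect `C τ (m
τ)`. The growth of `(m τ)²` to `((m + 1) τ)²` leaves room for that defect, so many small steps agree
with one long step up to second order in its length. -/
lemma iterate_sub_step (S : EulerScheme Φ G T C) {ρ τ : ℝ} {u : α → E} (hρ : 0 ≤ ρ) (hτ : 0 ≤ τ)
    (hu : u ∈ G ρ) (m : ℕ) (h : ρ + m * τ ≤ T) (x : α) :
    ‖(Φ τ)^[m] u x - Φ (m * τ) u x‖ ≤ Real.exp (C * (m * τ)) * (C * (m * τ) ^ 2) := by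
  induction m generalizing x with
  | zero => simp [S.zero]
  | succ m ih =>
    have hC := S.C_nonneg
    push_cast at h ⊢
    have h1 : ρ + m * τ ≤ T := by nlinarith
    have hm : 0 ≤ m * τ := by positivity
    rw [Function.iterate_succ_apply']
    have e1 := S.stable τ _ _ _ hτ (by linarith)
      (S.mono _ _ h1 (S.iterate_mem hρ hτ hu m h1))
      (S.mono _ _ h1 (S.mapsTo ρ (m * τ) u hρ hm h1 hu)) (ih h1) x
    have e2 := S.consistent ρ τ (m * τ) u hρ hτ hm (by linarith) hu x
    have e3 : τ + m * τ = (m + 1) * τ := by ring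
    rw [e3] at e2
    have e4 := norm_sub_le_norm_sub_add_norm_sub (Φ τ ((Φ τ)^[m] u) x) (Φ τ (Φ (m * τ) u) x)
      (Φ ((m + 1) * τ) u x)
    have e5 := S.one_add_le_exp (τ := τ) m
    have e6 : (1:ℝ) ≤ Real.exp (C * ((m + 1) * τ)) := by
      rw [← Real.exp_zero]; apply Real.exp_le_exp.2; positivity
    set X := Real.exp (C * ((m + 1) * τ))
    calc _ ≤ (1 + C * τ) * (Real.exp (C * (m * τ)) * (C * (m * τ) ^ 2)) + C * τ * (m * τ) := by
          linarith
      _ = ((1 + C * τ) * Real.exp (C * (m * τ))) * (C * (m * τ) ^ 2) + 1 * (C * τ * (m * τ)) := by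
          ring
      _ ≤ X * (C * (m * τ) ^ 2) + X * (C * τ * (m * τ)) := by gcongr
      _ ≤ X * (C * ((m + 1) * τ) ^ 2) := by
          have : 0 ≤ C * τ * (m * τ) := by positivity
          have h2 : 0 ≤ C * τ ^ 2 := by positivity
          rw [← mul_add]
          apply mul_le_mul_of_nonneg_left _ (by positivity)
          nlinarith

/-- Every pair of half steps costs one defect `C σ²`. There are `m` pairs and `m σ` is bounded, so
halving the time step changes the result by `O(σ)`, which is summable over dyadic refinements. -/
lemma iterate_two_mul_sub (S : EulerScheme Φ G T C) {ρ σ : ℝ} {u : α → E} (hρ : 0 ≤ ρ)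
    (hσ : 0 ≤ σ) (hu : u ∈ G ρ) (m : ℕ) (h : ρ + m * (2 * σ) ≤ T) (x : α) :
    ‖(Φ σ)^[2 * m] u x - (Φ (2 * σ))^[m] u x‖
      ≤ Real.exp (C * (m * (2 * σ))) * (m * (C * σ ^ 2)) := by
  induction m generalizing x with
  | zero => simp
  | succ m ih =>
    have hC := S.C_nonneg
    push_cast at h ⊢
    have h1 : ρ + m * (2 * σ) ≤ T := by nlinarith
    have h2 : ρ + (2 * m : ℕ) * σ ≤ T := by push_cast; linarith
    have hm : 0 ≤ m * σ := by positivity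
    rw [show 2 * (m + 1) = (2 * m + 1) + 1 by ring, Function.iterate_succ_apply',
      Function.iterate_succ_apply', Function.iterate_succ_apply']
    have hmem := S.iterate_mem hρ hσ hu (2 * m) h2
    have e1 := S.stable (2 * σ) _ _ _ (by positivity) (by linarith)
      (S.mono _ _ h2 hmem)
      (S.mono _ _ h1 (S.iterate_mem hρ (by positivity) hu m h1)) (ih h1) x
    have e2 := S.consistent _ σ σ _ (by positivity) hσ hσ (by push_cast; linarith) hmem x
    rw [← two_mul] at e2
    have e4 := norm_sub_le_norm_sub_add_norm_sub (Φ σ (Φ σ ((Φ σ)^[2 * m] u)) x)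
      (Φ (2 * σ) ((Φ σ)^[2 * m] u) x) (Φ (2 * σ) ((Φ (2 * σ))^[m] u) x)
    have e5 := S.one_add_le_exp (τ := 2 * σ) m
    have e6 : (1:ℝ) ≤ Real.exp (C * ((m + 1) * (2 * σ))) := by
      rw [← Real.exp_zero]; apply Real.exp_le_exp.2; positivity
    set X := Real.exp (C * ((m + 1) * (2 * σ)))
    calc _ ≤ 1 * (C * σ * σ) + ((1 + C * (2 * σ)) * Real.exp (C * (m * (2 * σ)))) *
            (m * (C * σ ^ 2)) := by linarith
      _ ≤ X * (C * σ * σ) + X * (m * (C * σ ^ 2)) := by gcongr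
      _ = X * ((m + 1) * (C * σ ^ 2)) := by ring

/-- The Euler approximation with time step `T / 2 ^ n`, piecewise constant in time. -/
noncomputable def approx (Φ : ℝ → (α → E) → α → E) (T : ℝ) (u₀ : α → E) (n : ℕ) (t : ℝ) : α → E :=
  (Φ (T / 2 ^ n))^[⌊t / (T / 2 ^ n)⌋₊] u₀

lemma floor_mul_le {τ t : ℝ} (hτ : 0 < τ) (ht : 0 ≤ t) : ⌊t / τ⌋₊ * τ ≤ t := by
  have := Nat.floor_le (div_nonneg ht hτ.le)
  rwa [le_div_iff₀ hτ] at this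

lemma lt_floor_mul {τ t : ℝ} (hτ : 0 < τ) : t < ⌊t / τ⌋₊ * τ + τ := by
  have := Nat.lt_floor_add_one (t / τ)
  rw [div_lt_iff₀ hτ] at this
  linarith

lemma approx_mem (S : EulerScheme Φ G T C) {u₀ : α → E} (h₀ : u₀ ∈ G 0) {t : ℝ}
    (ht : t ∈ Icc 0 T) (n : ℕ) : approx Φ T u₀ n t ∈ G t := by
  have hτ : 0 < T / 2 ^ n := div_pos S.T_pos (by positivity)
  have h := floor_mul_le hτ ht.1
  refine S.mono _ _ ?_ (S.iterate_mem le_rfl hτ.le h₀ _ ?_)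
  · linarith
  · linarith [ht.2]

lemma approx_succ_sub (S : EulerScheme Φ G T C) {u₀ : α → E} (h₀ : u₀ ∈ G 0) {t : ℝ}
    (ht : t ∈ Icc 0 T) (n : ℕ) (x : α) :
    ‖approx Φ T u₀ (n + 1) t x - approx Φ T u₀ n t x‖
      ≤ (Real.exp (C * T) * (C * T) + C) * T / 2 / 2 ^ n := by
  have hT := S.T_pos
  have hC := S.C_nonneg
  set σ := T / 2 ^ (n + 1) with hσdef
  have hσ : 0 < σ := by positivity
  have hτ : T / 2 ^ n = 2 * σ := by rw [hσdef, pow_succ]; field_simp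
  set m := ⌊t / (2 * σ)⌋₊ with hm
  have hm1 : m * (2 * σ) ≤ t := floor_mul_le (by positivity) ht.1
  have hm2 : t < m * (2 * σ) + 2 * σ := lt_floor_mul (by positivity)
  have hk1 : ⌊t / σ⌋₊ * σ ≤ t := floor_mul_le (by positivity) ht.1
  have hk2 : t < ⌊t / σ⌋₊ * σ + σ := lt_floor_mul (by positivity)
  -- Halving the step doubles the number of completed steps, or doubles it and adds one; the odd
  -- extra step moves the state by at most `C σ`.
  have hcases : ⌊t / σ⌋₊ = 2 * m ∨ ⌊t / σ⌋₊ = 2 * m + 1 := by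
    have a1 : (2 * m : ℝ) < ⌊t / σ⌋₊ + 1 := by
      have : (2 * m : ℝ) * σ < (⌊t / σ⌋₊ + 1) * σ := by linarith
      exact lt_of_mul_lt_mul_right this hσ.le
    have a2 : (⌊t / σ⌋₊ : ℝ) < 2 * m + 2 := by
      have : (⌊t / σ⌋₊ : ℝ) * σ < (2 * m + 2) * σ := by linarith
      exact lt_of_mul_lt_mul_right this hσ.le
    norm_cast at a1 a2
    omega
  have key : ‖(Φ σ)^[2 * m] u₀ x - (Φ (2 * σ))^[m] u₀ x‖ ≤ Real.exp (C * T) * (C * T) * σ := by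
    refine (S.iterate_two_mul_sub le_rfl hσ.le h₀ m (by linarith [ht.2]) x).trans ?_
    have : m * (2 * σ) ≤ T := by linarith [ht.2]
    have h2 : (m : ℝ) * σ ≤ T := by
      have : 0 ≤ m * σ := by positivity
      linarith
    calc Real.exp (C * (m * (2 * σ))) * (m * (C * σ ^ 2))
        = Real.exp (C * (m * (2 * σ))) * (C * (m * σ) * σ) := by ring
      _ ≤ Real.exp (C * T) * (C * T * σ) := by gcongr
      _ = _ := by ring
  have hrhs : (Real.exp (C * T) * (C * T) + C) * T / 2 / 2 ^ n
      = Real.exp (C * T) * (C * T) * σ + C * σ := by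
    rw [hσdef, pow_succ]; field_simp
  rw [hrhs]
  unfold approx
  rw [hτ, ← hσdef, ← hm]
  rcases hcases with h | h <;> rw [h]
  · have : 0 ≤ C * σ := by positivity
    linarith
  · rw [Function.iterate_succ_apply']
    have hle : 0 + (2 * m : ℕ) * σ ≤ T := by push_cast; linarith [ht.2]
    have hσT : σ ≤ T := by
      rw [hσdef]; exact div_le_self hT.le (one_le_pow₀ (by norm_num))
    have e1 := S.lipschitz_time σ 0 _ hσ.le hσT le_rfl hT.le
      (S.mono _ _ hle (S.iterate_mem le_rfl hσ.le h₀ (2 * m) hle)) x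
    rw [S.zero, sub_zero, abs_of_pos hσ] at e1
    have e2 := norm_sub_le_norm_sub_add_norm_sub (Φ σ ((Φ σ)^[2 * m] u₀) x)
      ((Φ σ)^[2 * m] u₀ x) ((Φ (2 * σ))^[m] u₀ x)
    linarith

/-- Between `t` and `t + h` the approximation makes `m` steps with `|m τ - h| ≤ τ`. By
`iterate_sub_step` they amount to one step of length `m τ`, which is then replaced by one of length
`h`; only the quadratic error in `h` survives as `τ → 0`. -/
lemma approx_add_sub (S : EulerScheme Φ G T C) {u₀ : α → E} (h₀ : u₀ ∈ G 0) {t h : ℝ}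
    (ht : 0 ≤ t) (hh : 0 ≤ h) (hth : t + h ≤ T) (n : ℕ) (x : α) :
    ‖approx Φ T u₀ n (t + h) x - Φ h (approx Φ T u₀ n t) x‖
      ≤ Real.exp (C * T) * (C * (h + T / 2 ^ n) ^ 2) + C * (T / 2 ^ n) := by
  have hT := S.T_pos
  have hC := S.C_nonneg
  set τ := T / 2 ^ n with hτdef
  have hτ : 0 < τ := by positivity
  have hj1 : ⌊t / τ⌋₊ * τ ≤ t := floor_mul_le hτ ht
  have hj2 : t < ⌊t / τ⌋₊ * τ + τ := lt_floor_mul hτ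
  have hk1 : ⌊(t + h) / τ⌋₊ * τ ≤ t + h := floor_mul_le hτ (by linarith)
  have hk2 : t + h < ⌊(t + h) / τ⌋₊ * τ + τ := lt_floor_mul hτ
  obtain ⟨m, hm⟩ : ∃ m, ⌊(t + h) / τ⌋₊ = m + ⌊t / τ⌋₊ := by
    have : ⌊t / τ⌋₊ ≤ ⌊(t + h) / τ⌋₊ := Nat.floor_le_floor (by gcongr; linarith)
    exact ⟨_, (Nat.sub_add_cancel this).symm⟩
  have hmem := S.approx_mem h₀ ⟨ht, by linarith⟩ n
  have hmem' := S.iterate_mem le_rfl hτ.le h₀ ⌊t / τ⌋₊ (by linarith)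
  have e0 : approx Φ T u₀ n (t + h) = (Φ τ)^[m] (approx Φ T u₀ n t) := by
    unfold approx
    rw [← hτdef, hm, Function.iterate_add_apply]
  rw [hm] at hk1 hk2
  push_cast at hk1 hk2
  have hm1 : m * τ ≤ h + τ := by linarith
  have hm2 : h - τ ≤ m * τ := by linarith
  have hm0 : 0 ≤ m * τ := by positivity
  rw [e0]
  have e1 := S.iterate_sub_step (by positivity) hτ.le hmem' m (by linarith) x
  have e2 := S.lipschitz_time (m * τ) h _ hm0
    (by have : 0 ≤ ⌊t / τ⌋₊ * τ := by positivity
        linarith) hh (by linarith) (S.mono _ _ (by linarith) hmem) x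
  have e3 : |m * τ - h| ≤ τ := abs_le.2 ⟨by linarith, by linarith⟩
  have e4 := norm_sub_le_norm_sub_add_norm_sub ((Φ τ)^[m] (approx Φ T u₀ n t) x)
    (Φ (m * τ) (approx Φ T u₀ n t) x) (Φ h (approx Φ T u₀ n t) x)
  refine e4.trans (add_le_add ?_ (e2.trans (by gcongr)))
  refine e1.trans ?_
  have : m * τ ≤ T := by
    have : 0 ≤ ⌊t / τ⌋₊ * τ := by positivity
    linarith
  gcongr

/-- The Euler approximations converge to an evolution which is tangent to the scheme. -/
theorem exists_limit [CompleteSpace E] (S : EulerScheme Φ G T C) {u₀ : α → E} (h₀ : u₀ ∈ G 0) :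
    ∃ u : ℝ → α → E, u 0 = u₀ ∧ (∀ t ∈ Icc 0 T, u t ∈ G t) ∧
      ∃ C' : ℝ, 0 ≤ C' ∧ ∀ t h, 0 ≤ t → 0 ≤ h → t + h ≤ T →
        ∀ x, ‖u (t + h) x - Φ h (u t) x‖ ≤ C' * h ^ 2 := by
  have hT := S.T_pos
  have hC := S.C_nonneg
  set D := (Real.exp (C * T) * (C * T) + C) * T with hD
  have hdist : ∀ t ∈ Icc 0 T, ∀ x n,
      dist (approx Φ T u₀ n t x) (approx Φ T u₀ (n + 1) t x) ≤ D / 2 / 2 ^ n := by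
    intro t ht x n
    rw [dist_comm, dist_eq_norm]
    exact S.approx_succ_sub h₀ ht n x
  have hex : ∀ t x, ∃ y, t ∈ Icc 0 T →
      Tendsto (fun n => approx Φ T u₀ n t x) atTop (𝓝 y) := by
    intro t x
    by_cases ht : t ∈ Icc 0 T
    · obtain ⟨y, hy⟩ := cauchySeq_tendsto_of_complete (cauchySeq_of_le_geometric_two (hdist t ht x))
      exact ⟨y, fun _ => hy⟩
    · exact ⟨0, fun h => absurd h ht⟩
  choose u hu using hex
  have hmem : ∀ t ∈ Icc 0 T, u t ∈ G t := fun t ht =>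
    S.closed t (fun n => approx Φ T u₀ n t) (u t) ht.2 (S.approx_mem h₀ ht) fun x => hu t x ht
  -- The constant is what `approx_add_sub` leaves when the time step tends to `0`.
  refine ⟨u, ?_, hmem, Real.exp (C * T) * C, by positivity, ?_⟩
  · funext x
    have h1 := hu 0 x ⟨le_rfl, hT.le⟩
    have h2 : (fun n => approx Φ T u₀ n 0 x) = fun _ => u₀ x := by
      funext n; simp [approx]
    rw [h2] at h1
    exact tendsto_nhds_unique h1 tendsto_const_nhds
  · intro t h ht hh hth x
    have ht' : t ∈ Icc 0 T := ⟨ht, by linarith⟩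
    have hp : Tendsto (fun n : ℕ => T / 2 ^ n) atTop (𝓝 0) :=
      tendsto_const_nhds.div_atTop (tendsto_pow_atTop_atTop_of_one_lt (by norm_num))
    have hpD : Tendsto (fun n : ℕ => D / 2 ^ n) atTop (𝓝 0) :=
      tendsto_const_nhds.div_atTop (tendsto_pow_atTop_atTop_of_one_lt (by norm_num))
    have hΦ : ∀ n, ‖approx Φ T u₀ n (t + h) x - Φ h (u t) x‖ ≤
        (Real.exp (C * T) * (C * (h + T / 2 ^ n) ^ 2) + C * (T / 2 ^ n))
          + (1 + C * h) * (D / 2 ^ n) := by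
      intro n
      have e1 := S.approx_add_sub h₀ ht hh hth n x
      have e2 := S.stable h (approx Φ T u₀ n t) (u t) (D / 2 ^ n) hh (by linarith)
        (S.mono _ _ ht'.2 (S.approx_mem h₀ ht' n)) (S.mono _ _ ht'.2 (hmem t ht'))
        (fun y => by
          rw [← dist_eq_norm]
          exact dist_le_of_le_geometric_two_of_tendsto (hdist t ht' y) (hu t y ht') n) x
      exact (norm_sub_le_norm_sub_add_norm_sub _ _ _).trans (add_le_add e1 e2)
    have hl : Tendsto (fun n => ‖approx Φ T u₀ n (t + h) x - Φ h (u t) x‖) atTop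
        (𝓝 ‖u (t + h) x - Φ h (u t) x‖) :=
      ((hu (t + h) x ⟨by linarith, hth⟩).sub_const _).norm
    have hr : Tendsto (fun n : ℕ => (Real.exp (C * T) * (C * (h + T / 2 ^ n) ^ 2) +
        C * (T / 2 ^ n)) + (1 + C * h) * (D / 2 ^ n)) atTop
        (𝓝 ((Real.exp (C * T) * (C * (h + 0) ^ 2) + C * 0) + (1 + C * h) * 0)) :=
      ((((hp.const_add h).pow 2).const_mul C).const_mul _ |>.add (hp.const_mul C)).add
        (hpD.const_mul _)
    have := le_of_tendsto_of_tendsto' hl hr hΦ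
    linarith

end EulerScheme

/-! ### Functions with bounded Lipschitz derivatives. -/

section C11

variable {V : Type*} [NormedAddCommGroup V] [NormedSpace ℝ V]

/-- `f` is differentiable, its derivative is bounded by `a` and `b`-Lipschitz. -/
structure IsC11 (a b : ℝ) (f : ℝ → V) : Prop where
  diff : Differentiable ℝ f
  deriv_le : ∀ x, ‖deriv f x‖ ≤ a
  deriv_lip : ∀ x y, ‖deriv f x - deriv f y‖ ≤ b * |x - y|

namespace IsC11

variable {a b : ℝ} {f g : ℝ → V}

lemma mono (h : IsC11 a b f) {a' b' : ℝ} (ha : a ≤ a') (hb : b ≤ b') : IsC11 a' b' f :=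
  ⟨h.diff, fun x => (h.deriv_le x).trans ha, fun x y => (h.deriv_lip x y).trans (by gcongr)⟩

lemma of_hasDerivAt {f' : ℝ → V} (h : ∀ x, HasDerivAt f (f' x) x) (ha : ∀ x, ‖f' x‖ ≤ a)
    (hb : ∀ x y, ‖f' x - f' y‖ ≤ b * |x - y|) : IsC11 a b f := by
  have : deriv f = f' := funext fun x => (h x).deriv
  exact ⟨fun x => (h x).differentiableAt, by simpa [this], by simpa [this]⟩

lemma norm_sub_le (h : IsC11 a b f) (x y : ℝ) : ‖f x - f y‖ ≤ a * |x - y| :=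
  Convex.norm_image_sub_le_of_norm_deriv_le (fun z _ => h.diff z) (fun z _ => h.deriv_le z)
    convex_univ (mem_univ y) (mem_univ x)

lemma taylor (h : IsC11 a b f) (x y : ℝ) :
    ‖f y - f x - (y - x) • deriv f x‖ ≤ b * |y - x| ^ 2 := by
  have hd : ∀ z, HasDerivAt (fun y => f y - (y - x) • deriv f x) (deriv f z - deriv f x) z := by
    intro z
    have := (((hasDerivAt_id z).sub_const x).smul_const (deriv f x))
    rw [one_smul] at this
    exact (h.diff z).hasDerivAt.sub this
  have hb : 0 ≤ b := by
    have := (norm_nonneg _).trans (h.deriv_lip 1 0)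
    simpa using this
  have := Convex.norm_image_sub_le_of_norm_hasDerivWithin_le (s := uIcc x y)
    (C := b * |y - x|) (fun z _ => (hd z).hasDerivWithinAt) (fun z hz => by
      refine (h.deriv_lip z x).trans ?_
      have : |z - x| ≤ |y - x| := by
        exact abs_sub_left_of_mem_uIcc hz
      gcongr) (convex_uIcc x y) left_mem_uIcc right_mem_uIcc
  simp only [sub_self, zero_smul, sub_zero] at this
  rw [sub_right_comm] at this
  refine this.trans (le_of_eq ?_)
  rw [Real.norm_eq_abs]; ring

lemma nonneg (h : IsC11 a b f) : 0 ≤ a ∧ 0 ≤ b := by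
  refine ⟨(norm_nonneg _).trans (h.deriv_le 0), ?_⟩
  simpa using (norm_nonneg _).trans (h.deriv_lip 1 0)

/-- Interpolation: functions which are close have close derivatives. -/
lemma norm_deriv_sub_le (hf : IsC11 a b f) (hg : IsC11 a b g) {x δ h : ℝ} (hh : 0 < h)
    (h1 : ‖f x - g x‖ ≤ δ) (h2 : ‖f (x + h) - g (x + h)‖ ≤ δ) :
    ‖deriv f x - deriv g x‖ ≤ 2 * δ / h + 2 * b * h := by
  have e1 := hf.taylor x (x + h)
  have e2 := hg.taylor x (x + h)
  simp only [add_sub_cancel_left, abs_of_pos hh] at e1 e2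
  have key : h • (deriv f x - deriv g x) = (f (x + h) - g (x + h)) - (f x - g x)
      - (f (x + h) - f x - h • deriv f x) + (g (x + h) - g x - h • deriv g x) := by
    rw [smul_sub]; abel
  have e3 : h * ‖deriv f x - deriv g x‖ ≤ δ + δ + b * h ^ 2 + b * h ^ 2 := by
    rw [← abs_of_pos hh, ← Real.norm_eq_abs, ← norm_smul, Real.norm_eq_abs, abs_of_pos hh, key]
    exact (norm_add_le _ _).trans (add_le_add ((_root_.norm_sub_le _ _).trans (add_le_add
      ((_root_.norm_sub_le _ _).trans (add_le_add h2 h1)) e1)) e2)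
  rw [div_add' _ _ _ hh.ne', le_div_iff₀ hh]
  nlinarith

/-- Uniform smallness of the derivatives of functions which are uniformly close. -/
lemma exists_deriv_close (b : ℝ) (hb : 0 ≤ b) {ε : ℝ} (hε : 0 < ε) :
    ∃ δ > 0, ∀ (a : ℝ) (f g : ℝ → V), IsC11 a b f → IsC11 a b g → (∀ x, ‖f x - g x‖ ≤ δ) →
      ∀ x, ‖deriv f x - deriv g x‖ ≤ ε := by
  -- In `norm_deriv_sub_le` this increment keeps the curvature term `2 b h` below `ε / 2`; the
  -- closeness `ε / 4 * h` makes the other term equal to `ε / 2`.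
  set h := ε / (4 * (b + 1))
  have hh : 0 < h := by positivity
  refine ⟨ε / 4 * h, by positivity, fun a f g hf hg H x => ?_⟩
  refine (hf.norm_deriv_sub_le hg hh (H x) (H (x + h))).trans ?_
  have e1 : 2 * (ε / 4 * h) / h = ε / 2 := by field_simp; norm_num
  have e2 : 2 * b * h ≤ ε / 2 := by
    have : (b + 1) * h = ε / 4 := by simp only [h]; field_simp
    nlinarith
  linarith

/-- Pointwise convergence is enough. Interpolation between `x` and `x + h` makes the derivatives at
`x` a Cauchy sequence, and the Taylor estimate, whose constant `b` is common to all `u n`, passes to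
the limit and identifies the limit of the derivatives as the derivative of the limit. -/
lemma of_tendsto [CompleteSpace V] {u : ℕ → ℝ → V} (hu : ∀ n, IsC11 a b (u n))
    (hf : ∀ x, Tendsto (fun n => u n x) atTop (𝓝 (f x))) : IsC11 a b f := by
  have hb := (hu 0).nonneg.2
  have hc : ∀ x, CauchySeq fun n => deriv (u n) x := by
    intro x
    rw [Metric.cauchySeq_iff]
    intro ε hε
    set h := ε / (8 * (b + 1))
    have hh : 0 < h := by positivity
    obtain ⟨N1, hN1⟩ := Metric.cauchySeq_iff.1 (hf x).cauchySeq (ε / 8 * h) (by positivity)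
    obtain ⟨N2, hN2⟩ := Metric.cauchySeq_iff.1 (hf (x + h)).cauchySeq (ε / 8 * h) (by positivity)
    refine ⟨max N1 N2, fun m hm n hn => ?_⟩
    have h1 := hN1 m (le_of_max_le_left hm) n (le_of_max_le_left hn)
    have h2 := hN2 m (le_of_max_le_right hm) n (le_of_max_le_right hn)
    rw [dist_eq_norm] at h1 h2 ⊢
    refine ((hu m).norm_deriv_sub_le (hu n) hh h1.le h2.le).trans_lt ?_
    have e1 : 2 * (ε / 8 * h) / h = ε / 4 := by field_simp; norm_num
    have e2 : 2 * b * h ≤ ε / 4 := by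
      have : (b + 1) * h = ε / 8 := by simp only [h]; field_simp
      nlinarith
    linarith
  choose f' hf' using fun x => cauchySeq_tendsto_of_complete (hc x)
  refine of_hasDerivAt (f' := f') (fun x => ?_) (fun x => ?_) (fun x y => ?_)
  · have ht : ∀ y, ‖f y - f x - (y - x) • f' x‖ ≤ b * |y - x| ^ 2 := fun y =>
      le_of_tendsto' (((hf y).sub (hf x)).sub ((hf' x).const_smul (y - x))).norm
        fun n => (hu n).taylor x y
    rw [hasDerivAt_iff_isLittleO]
    refine Asymptotics.IsBigO.trans_isLittleO (g := fun y => (y - x) ^ 2) ?_ ?_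
    · refine Asymptotics.IsBigO.of_bound b (Eventually.of_forall fun y => ?_)
      refine (ht y).trans (le_of_eq ?_)
      simp
    · have : (fun y => (y - x) ^ 2) = fun y => (y - x) * (y - x) := by funext y; ring
      rw [this]
      have h0 : Tendsto (fun y : ℝ => y - x) (𝓝 x) (𝓝 0) := by
        have : Continuous fun y : ℝ => y - x := by fun_prop
        simpa using this.tendsto x
      simpa using ((Asymptotics.isLittleO_one_iff ℝ).2 h0).mul_isBigO
        (Asymptotics.isBigO_refl (fun y => y - x) (𝓝 x))
  · exact le_of_tendsto' (hf' x).norm fun n => (hu n).deriv_le x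
  · exact le_of_tendsto' ((hf' x).sub (hf' y)).norm fun n => (hu n).deriv_lip x y

end IsC11

/-- `F` is bounded with bounded and Lipschitz derivative on `Ω`. -/
structure IsC11On (L : ℝ) (Ω : Set V) (F : V → ℝ) : Prop where
  diff : ∀ u ∈ Ω, DifferentiableAt ℝ F u
  le : ∀ u ∈ Ω, |F u| ≤ L
  fderiv_le : ∀ u ∈ Ω, ‖fderiv ℝ F u‖ ≤ L
  fderiv_lip : ∀ u ∈ Ω, ∀ v ∈ Ω, ‖fderiv ℝ F u - fderiv ℝ F v‖ ≤ L * ‖u - v‖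

namespace IsC11On

variable {L : ℝ} {Ω : Set V} {F : V → ℝ}

lemma mono (h : IsC11On L Ω F) {L' : ℝ} (hL : L ≤ L') : IsC11On L' Ω F :=
  ⟨h.diff, fun u hu => (h.le u hu).trans hL, fun u hu => (h.fderiv_le u hu).trans hL,
    fun u hu v hv => (h.fderiv_lip u hu v hv).trans (by gcongr)⟩

lemma abs_sub_le (h : IsC11On L Ω F) (hΩ : Convex ℝ Ω) {u v : V} (hu : u ∈ Ω) (hv : v ∈ Ω) :
    |F u - F v| ≤ L * ‖u - v‖ :=
  hΩ.norm_image_sub_le_of_norm_fderiv_le h.diff h.fderiv_le hv hu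

lemma comp (h : IsC11On L Ω F) {A B : ℝ} {U : ℝ → V} (hU : IsC11 A B U)
    (hUΩ : ∀ x, U x ∈ Ω) :
    IsC11 (L * A) (L * A * A + L * B) fun x => F (U x) := by
  have hA := hU.nonneg.1
  have hL : 0 ≤ L := (abs_nonneg _).trans (h.le _ (hUΩ 0))
  refine IsC11.of_hasDerivAt (f' := fun x => fderiv ℝ F (U x) (deriv U x)) (fun x => ?_)
    (fun x => ?_) (fun x y => ?_)
  · exact (h.diff _ (hUΩ x)).hasFDerivAt.comp_hasDerivAt x (hU.diff x).hasDerivAt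
  · refine (ContinuousLinearMap.le_opNorm _ _).trans ?_
    exact mul_le_mul (h.fderiv_le _ (hUΩ x)) (hU.deriv_le x) (norm_nonneg _) hL
  · have e : fderiv ℝ F (U x) (deriv U x) - fderiv ℝ F (U y) (deriv U y)
        = (fderiv ℝ F (U x) - fderiv ℝ F (U y)) (deriv U x)
          + fderiv ℝ F (U y) (deriv U x - deriv U y) := by simp
    rw [e]
    refine (norm_add_le _ _).trans ?_
    have e1 : ‖(fderiv ℝ F (U x) - fderiv ℝ F (U y)) (deriv U x)‖ ≤ L * (A * |x - y|) * A := by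
      refine (ContinuousLinearMap.le_opNorm _ _).trans ?_
      refine mul_le_mul ((h.fderiv_lip _ (hUΩ x) _ (hUΩ y)).trans ?_) (hU.deriv_le x)
        (norm_nonneg _) (by positivity)
      exact mul_le_mul_of_nonneg_left (hU.norm_sub_le x y) hL
    have e2 : ‖fderiv ℝ F (U y) (deriv U x - deriv U y)‖ ≤ L * (B * |x - y|) := by
      refine (ContinuousLinearMap.le_opNorm _ _).trans ?_
      exact mul_le_mul (h.fderiv_le _ (hUΩ y)) (hU.deriv_lip x y) (norm_nonneg _) hL
    linarith

end IsC11On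
end C11

/-! ### One Euler step along characteristics: regularity, stability, consistency. -/

section Quasilinear

variable {ι : Type*} [Fintype ι]

/-- One step of Euler's method along characteristics for `∂ₜUᵢ + lamᵢ(U) ∂ₓUᵢ = Fᵢ(U)`. -/
def charStep (lam F : ι → (ι → ℝ) → ℝ) (τ : ℝ) (U : ℝ → ι → ℝ) : ℝ → ι → ℝ :=
  fun x i => U (x - τ * lam i (U x)) i + τ * F i (U x)

/-- States within `K ρ` of the initial state, with correspondingly controlled derivatives. -/
def charSet (U₀ : ℝ → ι → ℝ) (a b K ρ : ℝ) : Set (ℝ → ι → ℝ) :=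
  {U | (∀ x, ‖U x - U₀ x‖ ≤ K * ρ) ∧ IsC11 (a + K * ρ) (b + K * ρ) U}

variable {lam F : ι → (ι → ℝ) → ℝ} {Ω : Set (ι → ℝ)} {L A B : ℝ}

lemma IsC11.abs_apply_sub_le {U : ℝ → ι → ℝ} (hU : IsC11 A B U) (x y : ℝ) (i : ι) :
    |U x i - U y i| ≤ A * |x - y| :=
  (norm_le_pi_norm (U x - U y) i).trans (hU.norm_sub_le x y)

/-- Here `a`, `b` are the current bounds and `A`, `B` fixed ceilings for them. The terms without a
factor `τ` are estimated by `a` and `b`, so these keep coefficient exactly `1`; the ceilings enter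
only in the terms carrying `τ`. Iterated steps therefore increase the bounds at most linearly in
time. The condition `τ ≤ 1` absorbs the term in `τ²`. -/
lemma charStep_isC11 (hlam : ∀ i, IsC11On L Ω (lam i)) (hF : ∀ i, IsC11On L Ω (F i)) {a b τ : ℝ}
    {U : ℝ → ι → ℝ} (hU : IsC11 a b U) (hUΩ : ∀ x, U x ∈ Ω) (haA : a ≤ A) (hbB : b ≤ B)
    (hL : 0 ≤ L) (hτ : 0 ≤ τ) (hτ1 : τ ≤ 1) :
    IsC11 (a + (A * L * A + L * A) * τ)
      (b + (B * (2 * (L * A) + (L * A) ^ 2) + (A + 1) * (L * A * A + L * B)) * τ)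
      (charStep lam F τ U) := by
  obtain ⟨ha, hb⟩ := hU.nonneg
  have hA := ha.trans haA
  have hB := hb.trans hbB
  have hUA : IsC11 A B U := hU.mono haA hbB
  have hl := fun i => (hlam i).comp hUA hUΩ
  have hg := fun i => (hF i).comp hUA hUΩ
  have hUi : ∀ i x, HasDerivAt (fun x => U x i) (deriv U x i) x := fun i x =>
    hasDerivAt_pi.1 (hU.diff x).hasDerivAt i
  set Q := L * A * A + L * B with hQ
  have hQ0 : 0 ≤ Q := by positivity
  refine IsC11.of_hasDerivAt (f' := fun x i => deriv U (x - τ * lam i (U x)) i *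
    (1 - τ * deriv (fun x => lam i (U x)) x) + τ * deriv (fun x => F i (U x)) x)
    (fun x => hasDerivAt_pi.2 fun i => ?_) (fun x => ?_) (fun x y => ?_)
  · have h1 : HasDerivAt (fun x => x - τ * lam i (U x))
        (1 - τ * deriv (fun x => lam i (U x)) x) x :=
      (hasDerivAt_id x).sub (((hl i).diff x).hasDerivAt.const_mul τ)
    exact ((hUi i _).comp x h1).add (((hg i).diff x).hasDerivAt.const_mul τ)
  · refine (pi_norm_le_iff_of_nonneg (by positivity)).2 fun i => ?_
    have e1 : |deriv U (x - τ * lam i (U x)) i| ≤ a :=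
      (norm_le_pi_norm _ i).trans (hU.deriv_le _)
    have e2 := (hl i).deriv_le x
    have e3 := (hg i).deriv_le x
    rw [Real.norm_eq_abs] at e2 e3 ⊢
    set p := deriv U (x - τ * lam i (U x)) i
    set l := deriv (fun x => lam i (U x)) x
    set g := deriv (fun x => F i (U x)) x
    have e4 : p * (1 - τ * l) + τ * g = p - τ * (p * l) + τ * g := by ring
    rw [e4]
    calc |p - τ * (p * l) + τ * g| ≤ |p| + |τ * (p * l)| + |τ * g| :=
          (abs_add_le _ _).trans (by gcongr; exact abs_sub _ _)
      _ = |p| + τ * (|p| * |l|) + τ * |g| := by rw [abs_mul, abs_mul, abs_mul, abs_of_nonneg hτ]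
      _ ≤ a + τ * (A * (L * A)) + τ * (L * A) := by gcongr; exact e1.trans haA
      _ = a + (A * L * A + L * A) * τ := by ring
  · refine (pi_norm_le_iff_of_nonneg (by positivity)).2 fun i => ?_
    have e2 := (hl i).deriv_le
    have e3 := (hl i).deriv_lip x y
    have e4 := (hg i).deriv_lip x y
    have e5 := (hl i).norm_sub_le x y
    simp only [Real.norm_eq_abs, Pi.sub_apply] at *
    have e1 : |deriv U (x - τ * lam i (U x)) i - deriv U (y - τ * lam i (U y)) i|
        ≤ b * ((1 + τ * (L * A)) * |x - y|) := by
      refine (norm_le_pi_norm (deriv U (x - τ * lam i (U x)) - deriv U (y - τ * lam i (U y)))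
        i).trans ((hU.deriv_lip _ _).trans ?_)
      refine mul_le_mul_of_nonneg_left ?_ hb
      have : x - τ * lam i (U x) - (y - τ * lam i (U y))
          = (x - y) - τ * (lam i (U x) - lam i (U y)) := by ring
      rw [this]
      calc _ ≤ |x - y| + |τ * (lam i (U x) - lam i (U y))| := abs_sub _ _
        _ = |x - y| + τ * |lam i (U x) - lam i (U y)| := by rw [abs_mul, abs_of_nonneg hτ]
        _ ≤ |x - y| + τ * (L * A * |x - y|) := by gcongr
        _ = _ := by ring
    have e6 : |deriv U (y - τ * lam i (U y)) i| ≤ A :=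
      (norm_le_pi_norm _ i).trans (hUA.deriv_le _)
    have e2x := e2 x
    set p := deriv U (x - τ * lam i (U x)) i
    set q := deriv U (y - τ * lam i (U y)) i
    set l := deriv (fun x => lam i (U x)) x
    set l' := deriv (fun x => lam i (U x)) y
    set g := deriv (fun x => F i (U x)) x
    set g' := deriv (fun x => F i (U x)) y
    set d := |x - y|
    have hd : 0 ≤ d := abs_nonneg _
    have e7 : p * (1 - τ * l) + τ * g - (q * (1 - τ * l') + τ * g')
        = (p - q) * (1 - τ * l) - τ * (q * (l - l')) + τ * (g - g') := by ring
    rw [e7]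
    have e8 : |1 - τ * l| ≤ 1 + τ * (L * A) := by
      calc |1 - τ * l| ≤ |1| + |τ * l| := abs_sub _ _
        _ = 1 + τ * |l| := by rw [abs_one, abs_mul, abs_of_nonneg hτ]
        _ ≤ _ := by gcongr
    calc _ ≤ |(p - q) * (1 - τ * l)| + |τ * (q * (l - l'))| + |τ * (g - g')| :=
          (abs_add_le _ _).trans (by gcongr; exact abs_sub _ _)
      _ = |p - q| * |1 - τ * l| + τ * (|q| * |l - l'|) + τ * |g - g'| := by
          rw [abs_mul, abs_mul, abs_mul, abs_mul, abs_of_nonneg hτ]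
      _ ≤ (b * ((1 + τ * (L * A)) * d)) * (1 + τ * (L * A)) + τ * (A * (Q * d)) + τ * (Q * d) := by
          gcongr
      _ = (b + (b * (2 * (L * A)) + b * (τ * (L * A) ^ 2) + (A + 1) * Q) * τ) * d := by ring
      _ ≤ (b + (B * (2 * (L * A)) + B * (1 * (L * A) ^ 2) + (A + 1) * Q) * τ) * d := by gcongr
      _ = _ := by ring

lemma charStep_sub_le (hlam : ∀ i, IsC11On L Ω (lam i)) (hF : ∀ i, IsC11On L Ω (F i)) {τ σ : ℝ}
    {U : ℝ → ι → ℝ} (hU : IsC11 A B U) (hUΩ : ∀ x, U x ∈ Ω) (hL : 0 ≤ L) (x : ℝ) :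
    ‖charStep lam F τ U x - charStep lam F σ U x‖ ≤ (A + 1) * L * |τ - σ| := by
  have hA := hU.nonneg.1
  refine (pi_norm_le_iff_of_nonneg (by positivity)).2 fun i => ?_
  have e1 := hU.abs_apply_sub_le (x - τ * lam i (U x)) (x - σ * lam i (U x)) i
  have e2 := (hlam i).le _ (hUΩ x)
  have e3 := (hF i).le _ (hUΩ x)
  have e4 : x - τ * lam i (U x) - (x - σ * lam i (U x)) = - ((τ - σ) * lam i (U x)) := by ring
  rw [e4, abs_neg, abs_mul] at e1
  have e5 : charStep lam F τ U x i - charStep lam F σ U x i = (U (x - τ * lam i (U x)) i -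
    U (x - σ * lam i (U x)) i) + (τ - σ) * F i (U x) := by simp only [charStep]; ring
  rw [Pi.sub_apply, e5, Real.norm_eq_abs]
  calc _ ≤ |U (x - τ * lam i (U x)) i - U (x - σ * lam i (U x)) i| + |τ - σ| * |F i (U x)| := by
        rw [← abs_mul]; exact abs_add_le _ _
    _ ≤ A * (|τ - σ| * L) + |τ - σ| * L := by
        gcongr; exact e1.trans (by gcongr)
    _ = _ := by ring

omit [Fintype ι] in
lemma charStep_zero (U : ℝ → ι → ℝ) : charStep lam F 0 U = U := by
  funext x i; simp [charStep]

/-- `U` and `V` are compared at the same foot point, and the displacement of the foot point is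
charged to `V` alone; so `U` needs no derivative bound. -/
lemma charStep_stable (hΩ : Convex ℝ Ω) (hlam : ∀ i, IsC11On L Ω (lam i))
    (hF : ∀ i, IsC11On L Ω (F i)) {τ δ : ℝ} {U V : ℝ → ι → ℝ} (hU : ∀ x, U x ∈ Ω)
    (hV : IsC11 A B V) (hVΩ : ∀ x, V x ∈ Ω) (hL : 0 ≤ L) (hτ : 0 ≤ τ)
    (hUV : ∀ x, ‖U x - V x‖ ≤ δ) (x : ℝ) :
    ‖charStep lam F τ U x - charStep lam F τ V x‖ ≤ (1 + (A + 1) * L * τ) * δ := by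
  have hA := hV.nonneg.1
  have hδ : 0 ≤ δ := (norm_nonneg _).trans (hUV x)
  refine (pi_norm_le_iff_of_nonneg (by positivity)).2 fun i => ?_
  have e1 := hV.abs_apply_sub_le (x - τ * lam i (U x)) (x - τ * lam i (V x)) i
  have e2 := ((hlam i).abs_sub_le hΩ (hU x) (hVΩ x)).trans
    (mul_le_mul_of_nonneg_left (hUV x) hL)
  have e3 := ((hF i).abs_sub_le hΩ (hU x) (hVΩ x)).trans
    (mul_le_mul_of_nonneg_left (hUV x) hL)
  have e4 : x - τ * lam i (U x) - (x - τ * lam i (V x))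
    = - (τ * (lam i (U x) - lam i (V x))) := by ring
  rw [e4, abs_neg, abs_mul, abs_of_nonneg hτ] at e1
  have e5 : charStep lam F τ U x i - charStep lam F τ V x i = (U (x - τ * lam i (U x)) i -
    V (x - τ * lam i (U x)) i) + (V (x - τ * lam i (U x)) i - V (x - τ * lam i (V x)) i)
    + τ * (F i (U x) - F i (V x)) := by simp only [charStep]; ring
  have e6 : |U (x - τ * lam i (U x)) i - V (x - τ * lam i (U x)) i| ≤ δ :=
    (norm_le_pi_norm (U (x - τ * lam i (U x)) - V (x - τ * lam i (U x))) i).trans (hUV _)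
  rw [Pi.sub_apply, e5, Real.norm_eq_abs]
  refine (abs_add_three _ _ _).trans ?_
  rw [abs_mul, abs_of_nonneg hτ]
  calc _ ≤ δ + A * (τ * (L * δ)) + τ * (L * δ) := by
        gcongr; exact e1.trans (by gcongr)
    _ = _ := by ring

/-- Two steps and the combined step differ because the frozen coefficients are evaluated at slightly
different states. The speed used during `τ` sees the state after time `σ`, and the speed used during
`σ` sees the state at a point displaced by `O(τ)`. Each discrepancy is multiplied by the other time,
which gives `τ σ`. -/
lemma charStep_consistent (hΩ : Convex ℝ Ω) (hlam : ∀ i, IsC11On L Ω (lam i))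
    (hF : ∀ i, IsC11On L Ω (F i)) {τ σ : ℝ} {U : ℝ → ι → ℝ}
    (hU : IsC11 A B U) (hUΩ : ∀ x, U x ∈ Ω) (hVΩ : ∀ x, charStep lam F σ U x ∈ Ω)
    (hL : 0 ≤ L) (hτ : 0 ≤ τ) (hσ : 0 ≤ σ) (x : ℝ) :
    ‖charStep lam F τ (charStep lam F σ U) x - charStep lam F (τ + σ) U x‖
      ≤ (A + 1) * (L * ((A + 1) * L) + L * (A * L)) * τ * σ := by
  have hA := hU.nonneg.1
  refine (pi_norm_le_iff_of_nonneg (by positivity)).2 fun i => ?_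
  set V := charStep lam F σ U with hV
  have hVU : ‖V x - U x‖ ≤ (A + 1) * L * σ := by
    have := charStep_sub_le hlam hF (τ := σ) (σ := 0) hU hUΩ hL x
    rwa [charStep_zero, sub_zero, abs_of_nonneg hσ] at this
  set y := x - τ * lam i (V x) with hy
  have hUy : ‖U y - U x‖ ≤ A * (τ * L) := by
    refine (hU.norm_sub_le _ _).trans ?_
    have : y - x = - (τ * lam i (V x)) := by rw [hy]; ring
    rw [this, abs_neg, abs_mul, abs_of_nonneg hτ]
    have := (hlam i).le _ (hVΩ x)
    gcongr
  have e1 := hU.abs_apply_sub_le (y - σ * lam i (U y)) (x - (τ + σ) * lam i (U x)) i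
  have e4 : y - σ * lam i (U y) - (x - (τ + σ) * lam i (U x))
    = - (τ * (lam i (V x) - lam i (U x)) + σ * (lam i (U y) - lam i (U x))) := by rw [hy]; ring
  have e2 : |y - σ * lam i (U y) - (x - (τ + σ) * lam i (U x))|
      ≤ τ * (L * ((A + 1) * L * σ)) + σ * (L * (A * (τ * L))) := by
    rw [e4, abs_neg]
    refine (abs_add_le _ _).trans ?_
    rw [abs_mul, abs_mul, abs_of_nonneg hτ, abs_of_nonneg hσ]
    have a1 := (hlam i).abs_sub_le hΩ (hVΩ x) (hUΩ x)
    have a2 := (hlam i).abs_sub_le hΩ (hUΩ y) (hUΩ x)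
    gcongr
    · exact a1.trans (by gcongr)
    · exact a2.trans (by gcongr)
  have a1 := ((hF i).abs_sub_le hΩ (hVΩ x) (hUΩ x)).trans (mul_le_mul_of_nonneg_left hVU hL)
  have a2 := ((hF i).abs_sub_le hΩ (hUΩ y) (hUΩ x)).trans (mul_le_mul_of_nonneg_left hUy hL)
  have e5 : charStep lam F τ V x i - charStep lam F (τ + σ) U x i = (U (y - σ * lam i (U y)) i -
      U (x - (τ + σ) * lam i (U x)) i) + σ * (F i (U y) - F i (U x))
      + τ * (F i (V x) - F i (U x)) := by
    have h1 : charStep lam F τ V x i = V y i + τ * F i (V x) := rfl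
    have h2 : V y i = U (y - σ * lam i (U y)) i + σ * F i (U y) := rfl
    rw [h1, h2]; simp only [charStep]; ring
  rw [Pi.sub_apply, e5, Real.norm_eq_abs]
  refine (abs_add_three _ _ _).trans ?_
  rw [abs_mul, abs_mul, abs_of_nonneg hτ, abs_of_nonneg hσ]
  calc _ ≤ A * (τ * (L * ((A + 1) * L * σ)) + σ * (L * (A * (τ * L))))
        + σ * (L * (A * (τ * L))) + τ * (L * ((A + 1) * L * σ)) := by
        gcongr
        exact e1.trans (by gcongr)
    _ = _ := by ring

/-- `K` adds the rates at which the distance to `U₀`, the derivative bound and the Lipschitz bound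
can grow. With `K T ≤ min η 1` the states stay in `Ω` by `hball` and the bounds stay below the
ceilings `a + 1` and `b + 1` on which `K` itself depends. -/
theorem exists_eulerScheme (hΩ : Convex ℝ Ω) (hlam : ∀ i, IsC11On L Ω (lam i))
    (hF : ∀ i, IsC11On L Ω (F i)) (hL : 0 ≤ L) {a b η : ℝ} {U₀ : ℝ → ι → ℝ} (hU₀ : IsC11 a b U₀)
    (hη : 0 < η) (hball : ∀ x u, ‖u - U₀ x‖ ≤ η → u ∈ Ω) :
    ∃ K T C : ℝ, 0 ≤ K ∧ T ≤ 1 ∧ K * T ≤ η ∧ K * T ≤ 1 ∧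
      EulerScheme (charStep lam F) (charSet U₀ a b K) T C := by
  obtain ⟨ha, hb⟩ := hU₀.nonneg
  set A := a + 1 with hA
  set B := b + 1 with hB
  set k1 := (A + 1) * L
  set k2 := A * L * A + L * A
  set k3 := B * (2 * (L * A) + (L * A) ^ 2) + (A + 1) * (L * A * A + L * B)
  have hA0 : 0 ≤ A := by positivity
  have hB0 : 0 ≤ B := by positivity
  have hk1 : 0 ≤ k1 := by positivity
  have hk2 : 0 ≤ k2 := by positivity
  have hk3 : 0 ≤ k3 := by positivity
  set K := k1 + k2 + k3 with hK
  have hK0 : 0 ≤ K := by positivity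
  set T := min (min η 1 / (K + 1)) 1 with hT
  have hT0 : 0 < T := by positivity
  have hKT : K * T ≤ min η 1 := by
    have : T ≤ min η 1 / (K + 1) := min_le_left _ _
    rw [le_div_iff₀ (by positivity)] at this
    nlinarith
  have hT1 : T ≤ 1 := min_le_right _ _
  have hKη := hKT.trans (min_le_left _ _)
  have hK1 := hKT.trans (min_le_right _ _)
  have hmem : ∀ ρ U, ρ ≤ T → U ∈ charSet U₀ a b K ρ → (∀ x, U x ∈ Ω) ∧ IsC11 A B U := by
    intro ρ U hρ hU
    have : K * ρ ≤ K * T := by gcongr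
    exact ⟨fun x => hball x _ ((hU.1 x).trans (by linarith)),
      hU.2.mono (by linarith) (by linarith)⟩
  have hmaps : ∀ ρ τ U, 0 ≤ ρ → 0 ≤ τ → ρ + τ ≤ T → U ∈ charSet U₀ a b K ρ →
      charStep lam F τ U ∈ charSet U₀ a b K (ρ + τ) := by
    intro ρ τ U hρ hτ hρτ hU
    obtain ⟨h1, h2⟩ := hmem ρ U (by linarith) hU
    have h3 : K * ρ ≤ K * T := by gcongr; linarith
    refine ⟨fun x => ?_, ?_⟩
    · have e1 := charStep_sub_le hlam hF (τ := τ) (σ := 0) h2 h1 hL x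
      rw [charStep_zero, sub_zero, abs_of_nonneg hτ] at e1
      have e2 := norm_sub_le_norm_sub_add_norm_sub (charStep lam F τ U x) (U x) (U₀ x)
      have e3 := hU.1 x
      have : (A + 1) * L * τ ≤ K * τ := by
        refine mul_le_mul_of_nonneg_right ?_ hτ
        linarith
      linarith
    · have := charStep_isC11 hlam hF hU.2 h1 (A := A) (B := B) (by linarith) (by linarith) hL hτ
        (by linarith)
      refine this.mono ?_ ?_
      · have : k2 * τ ≤ K * τ := mul_le_mul_of_nonneg_right (by linarith) hτ
        linarith
      · have : k3 * τ ≤ K * τ := mul_le_mul_of_nonneg_right (by linarith) hτ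
        linarith
  set C := k1 + (A + 1) * (L * ((A + 1) * L) + L * (A * L)) with hC
  have hC1 : k1 ≤ C := by
    have : 0 ≤ (A + 1) * (L * ((A + 1) * L) + L * (A * L)) := by positivity
    linarith
  refine ⟨K, T, C, hK0, hT1, hKη, hK1, hT0, by positivity, ?_, ?_, hmaps, ?_, ?_, ?_,
    charStep_zero⟩
  · intro ρ ρ' h U hU
    have : K * ρ ≤ K * ρ' := by gcongr
    exact ⟨fun x => (hU.1 x).trans this, hU.2.mono (by linarith) (by linarith)⟩
  · intro ρ u v _ hu hv
    exact ⟨fun x => le_of_tendsto' ((hv x).sub_const _).norm fun n => (hu n).1 x,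
      IsC11.of_tendsto (fun n => (hu n).2) hv⟩
  · intro τ U V δ hτ hτT hU hV hUV x
    refine (charStep_stable hΩ hlam hF (hmem T U le_rfl hU).1 (hmem T V le_rfl hV).2
      (hmem T V le_rfl hV).1 hL hτ hUV x).trans ?_
    have : 0 ≤ δ := (norm_nonneg _).trans (hUV x)
    gcongr
  · intro ρ τ σ U hρ hτ hσ h hU x
    obtain ⟨h1, h2⟩ := hmem ρ U (by linarith) hU
    have h3 := (hmem _ _ (by linarith) (hmaps ρ σ U hρ hσ (by linarith) hU)).1
    refine (charStep_consistent hΩ hlam hF h2 h1 h3 hL hτ hσ x).trans ?_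
    gcongr
    linarith
  · intro τ σ U _ _ _ _ hU x
    obtain ⟨h1, h2⟩ := hmem T U le_rfl hU
    refine (charStep_sub_le hlam hF h2 h1 hL x).trans ?_
    gcongr

end Quasilinear

/-! ### Local existence for diagonal quasilinear systems. -/

/-- A continuous function with a continuous right derivative is continuously differentiable. -/
lemma hasDerivWithinAt_Icc_of_right {T : ℝ} {g f : ℝ → ℝ}
    (hg : ContinuousOn g (Icc 0 T)) (hf : ContinuousOn f (Icc 0 T))
    (h : ∀ t ∈ Ico 0 T, HasDerivWithinAt g (f t) (Ici t) t) {t : ℝ} (ht : t ∈ Icc 0 T) :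
    HasDerivWithinAt g (f t) (Icc 0 T) t := by
  have hT : 0 ≤ T := ht.1.trans ht.2
  -- The extension of `f` by its end values is continuous on the line, so it has a primitive; `g`
  -- has the same right derivative as that primitive, hence differs from it by a constant.
  set f' : ℝ → ℝ := fun t => f (projIcc 0 T hT t) with hf'
  have hf'c : Continuous f' :=
    (continuousOn_iff_continuous_domRestrict.1 hf).comp continuous_projIcc
  have hf'e : ∀ t ∈ Icc 0 T, f' t = f t := fun t ht => by simp [hf', projIcc_of_mem hT ht]
  have hp : ∀ t, HasDerivAt (fun t => g 0 + ∫ s in (0:ℝ)..t, f' s) (f' t) t := fun t =>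
    (hf'c.integral_hasStrictDerivAt 0 t).hasDerivAt.const_add _
  have heq : ∀ y ∈ Icc 0 T, g y = g 0 + ∫ s in (0:ℝ)..y, f' s := by
    refine eq_of_has_deriv_right_eq (f' := f') (fun x hx => ?_)
      (fun x _ => (hp x).hasDerivWithinAt) hg
      (fun x _ => (hp x).continuousAt.continuousWithinAt) (by simp)
    rw [hf'e x ⟨hx.1, hx.2.le⟩]; exact h x hx
  rw [← hf'e t ht]
  exact (hp t).hasDerivWithinAt.congr heq (heq t ht)

lemma hasDerivWithinAt_zero_of_sq {g : ℝ → ℝ} {t T C : ℝ} (htT : t < T) (h0 : g t = 0)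
    (h : ∀ h, 0 ≤ h → t + h ≤ T → |g (t + h)| ≤ C * h ^ 2) :
    HasDerivWithinAt g 0 (Ici t) t := by
  rw [hasDerivWithinAt_iff_isLittleO]
  refine Asymptotics.IsBigO.trans_isLittleO (g := fun y => (y - t) * (y - t)) ?_ ?_
  · refine Asymptotics.IsBigO.of_bound C ?_
    have : Iic T ∈ 𝓝[Ici t] t := mem_nhdsWithin_of_mem_nhds (Iic_mem_nhds htT)
    filter_upwards [self_mem_nhdsWithin, this] with y hy hyT
    have := h (y - t) (sub_nonneg.2 hy) (by rw [add_sub_cancel]; exact hyT)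
    rw [add_sub_cancel] at this
    simp only [h0, sub_zero, smul_zero, Real.norm_eq_abs]
    rwa [← pow_two, abs_of_nonneg (sq_nonneg (y - t))]
  · have h0 : Tendsto (fun y : ℝ => y - t) (𝓝[Ici t] t) (𝓝 0) := by
      have : Continuous fun y : ℝ => y - t := by fun_prop
      simpa using (this.tendsto t).mono_left nhdsWithin_le_nhds
    simpa using ((Asymptotics.isLittleO_one_iff ℝ).2 h0).mul_isBigO
      (Asymptotics.isBigO_refl (fun y => y - t) (𝓝[Ici t] t))

/-- A family of functions which is Lipschitz in time has derivatives continuous in time. -/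
lemma continuousOn_deriv_of_isC11 {V : Type*} [NormedAddCommGroup V] [NormedSpace ℝ V]
    {u : ℝ → ℝ → V} {T A B M : ℝ} (hu : ∀ t ∈ Icc 0 T, IsC11 A B (u t))
    (hM : ∀ t ∈ Icc 0 T, ∀ t' ∈ Icc 0 T, ∀ x, ‖u t' x - u t x‖ ≤ M * |t' - t|)
    {t : ℝ} (ht : t ∈ Icc 0 T) {ε : ℝ} (hε : 0 < ε) :
    ∃ δ > 0, ∀ t' ∈ Icc 0 T, |t' - t| < δ → ∀ x, ‖deriv (u t') x - deriv (u t) x‖ ≤ ε := by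
  obtain ⟨δ, hδ, H⟩ := IsC11.exists_deriv_close (V := V) B (hu t ht).nonneg.2 hε
  refine ⟨δ / (|M| + 1), by positivity, fun t' ht' h x => ?_⟩
  refine H A _ _ (hu t' ht') (hu t ht) (fun y => (hM t ht t' ht' y).trans ?_) x
  rw [lt_div_iff₀ (by positivity)] at h
  calc M * |t' - t| ≤ (|M| + 1) * |t' - t| := by
        gcongr; linarith [le_abs_self M]
    _ ≤ δ := by linarith

section Quasilinear

variable {ι : Type*} [Fintype ι] {lam F : ι → (ι → ℝ) → ℝ} {Ω : Set (ι → ℝ)} {L : ℝ}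

/-- Local existence for diagonal quasilinear hyperbolic systems with `C^{1,1}` data. -/
theorem exists_quasilinear_solution (hΩ : Convex ℝ Ω) (hlam : ∀ i, IsC11On L Ω (lam i))
    (hF : ∀ i, IsC11On L Ω (F i)) (hL : 0 ≤ L) {a b η : ℝ} {U₀ : ℝ → ι → ℝ} (hU₀ : IsC11 a b U₀)
    (hη : 0 < η) (hball : ∀ x u, ‖u - U₀ x‖ ≤ η → u ∈ Ω) :
    ∃ (T : ℝ) (u : ℝ → ℝ → ι → ℝ) (A B M : ℝ), 0 < T ∧ u 0 = U₀ ∧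
      (∀ t ∈ Icc 0 T, IsC11 A B (u t)) ∧
      (∀ t ∈ Icc 0 T, ∀ x, ‖u t x - U₀ x‖ ≤ η) ∧
      (∀ t ∈ Icc 0 T, ∀ t' ∈ Icc 0 T, ∀ x, ‖u t' x - u t x‖ ≤ M * |t' - t|) ∧
      ∀ t ∈ Icc 0 T, ∀ x i, HasDerivWithinAt (fun τ => u τ x i)
        (-lam i (u t x) * deriv (u t) x i + F i (u t x)) (Icc 0 T) t := by
  obtain ⟨K, T, C, hK, hT1, hKη, hK1, S⟩ := exists_eulerScheme hΩ hlam hF hL hU₀ hη hball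
  have h0 : U₀ ∈ charSet U₀ a b K 0 := ⟨fun x => by simp, by simpa using hU₀⟩
  obtain ⟨u, hu0, hmem, C', hC', hstep⟩ := S.exists_limit h0
  have hC := S.C_nonneg
  have hle : ∀ t ∈ Icc 0 T, K * t ≤ K * T := fun t ht => by gcongr; exact ht.2
  have hC11 : ∀ t ∈ Icc 0 T, IsC11 (a + 1) (b + 1) (u t) := fun t ht =>
    (hmem t ht).2.mono (by linarith [hle t ht]) (by linarith [hle t ht])
  have hη' : ∀ t ∈ Icc 0 T, ∀ x, ‖u t x - U₀ x‖ ≤ η := fun t ht x =>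
    ((hmem t ht).1 x).trans ((hle t ht).trans hKη)
  have huΩ : ∀ t ∈ Icc 0 T, ∀ x, u t x ∈ Ω := fun t ht x => hball x _ (hη' t ht x)
  have hLip1 : ∀ t h, 0 ≤ t → 0 ≤ h → t + h ≤ T → ∀ x, ‖u (t + h) x - u t x‖ ≤ (C' + C) * h := by
    intro t h ht hh hth x
    have e1 := hstep t h ht hh hth x
    have ht' : t ∈ Icc 0 T := ⟨ht, by linarith⟩
    have e2 := S.lipschitz_time h 0 (u t) hh (by linarith) le_rfl S.T_pos.le
      (S.mono _ _ ht'.2 (hmem t ht')) x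
    rw [charStep_zero, sub_zero, abs_of_nonneg hh] at e2
    have e3 : h ^ 2 ≤ h := by nlinarith
    have e4 : C' * h ^ 2 ≤ C' * h := by gcongr
    have := norm_sub_le_norm_sub_add_norm_sub (u (t + h) x) (charStep lam F h (u t) x) (u t x)
    linarith
  have hLip : ∀ t ∈ Icc 0 T, ∀ t' ∈ Icc 0 T, ∀ x, ‖u t' x - u t x‖ ≤ (C' + C) * |t' - t| := by
    intro t ht t' ht' x
    rcases le_total t t' with h | h
    · have := hLip1 t (t' - t) ht.1 (sub_nonneg.2 h) (by linarith [ht'.2]) x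
      rwa [add_sub_cancel, ← abs_of_nonneg (sub_nonneg.2 h)] at this
    · have := hLip1 t' (t - t') ht'.1 (sub_nonneg.2 h) (by linarith [ht.2]) x
      rwa [add_sub_cancel, ← abs_of_nonneg (sub_nonneg.2 h), abs_sub_comm, norm_sub_rev] at this
  refine ⟨T, u, a + 1, b + 1, C' + C, S.T_pos, hu0, hC11, hη', hLip, fun t ht x i => ?_⟩
  have hcu : ContinuousOn (fun t => u t x) (Icc 0 T) := by
    have : LipschitzOnWith (C' + C).toNNReal (fun t => u t x) (Icc 0 T) :=
      LipschitzOnWith.of_dist_le' fun t' ht' t ht => by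
        rw [dist_eq_norm, Real.dist_eq]; exact hLip t ht t' ht' x
    exact this.continuousOn
  have hcd : ContinuousOn (fun t => deriv (u t) x) (Icc 0 T) := by
    rw [Metric.continuousOn_iff]
    intro t ht ε hε
    obtain ⟨δ, hδ, H⟩ := continuousOn_deriv_of_isC11 hC11 hLip ht (half_pos hε)
    refine ⟨δ, hδ, fun t' ht' h => ?_⟩
    rw [dist_eq_norm]
    exact (H t' ht' h x).trans_lt (half_lt_self hε)
  have hcl : ContinuousOn (fun t => lam i (u t x)) (Icc 0 T) := fun t ht =>
    ((hlam i).diff _ (huΩ t ht x)).continuousAt.comp_continuousWithinAt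
      (f := fun t => u t x) (hcu t ht)
  have hcF : ContinuousOn (fun t => F i (u t x)) (Icc 0 T) := fun t ht =>
    ((hF i).diff _ (huΩ t ht x)).continuousAt.comp_continuousWithinAt
      (f := fun t => u t x) (hcu t ht)
  refine hasDerivWithinAt_Icc_of_right
    (f := fun t => -lam i (u t x) * deriv (u t) x i + F i (u t x)) ?_ ?_ ?_ ht
  · exact (continuous_apply i).comp_continuousOn hcu
  · exact (hcl.neg.mul ((continuous_apply i).comp_continuousOn hcd)).add hcF
  · intro t ht
    have ht' : t ∈ Icc 0 T := ⟨ht.1, ht.2.le⟩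
    -- The solution leaves each of its states tangentially to the Euler step, with error `C' h²`.
    -- Its right derivative is thus that of the step at length `0`, and this is the right-hand side
    -- of the equation.
    have h1 : HasDerivWithinAt (fun τ => u τ x i - charStep lam F (τ - t) (u t) x i) 0
        (Ici t) t := by
      refine hasDerivWithinAt_zero_of_sq ht.2 (C := C') ?_ fun h hh hth => ?_
      · simp [charStep_zero]
      · rw [add_sub_cancel_left]
        exact (norm_le_pi_norm (u (t + h) x - charStep lam F h (u t) x) i).trans
          (hstep t h ht.1 hh hth x)
    have h2 : HasDerivAt (fun τ => charStep lam F (τ - t) (u t) x i)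
        (-lam i (u t x) * deriv (u t) x i + F i (u t x)) t := by
      have e1 : HasDerivAt (fun τ : ℝ => τ - t) 1 t := (hasDerivAt_id t).sub_const t
      have e2 : HasDerivAt (fun τ : ℝ => x - (τ - t) * lam i (u t x)) (-lam i (u t x)) t := by
        simpa using (e1.mul_const (lam i (u t x))).const_sub x
      have e3 : HasDerivAt (fun y => u t y i) (deriv (u t) x i) (x - (t - t) * lam i (u t x)) := by
        rw [sub_self, zero_mul, sub_zero]
        exact hasDerivAt_pi.1 ((hC11 t ht').diff x).hasDerivAt i
      have := (e3.comp t e2).add (e1.mul_const (F i (u t x)))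
      rw [one_mul, mul_comm] at this
      exact this
    have h3 := h1.add h2.hasDerivWithinAt
    rw [zero_add] at h3
    exact h3.congr (fun τ _ => by simp) (by simp)

end Quasilinear

/-! ### Backward cones and uniqueness. -/

/-- The backward cone of slope `M` with tip `z₀`, cut off at time `0`. -/
def cone (M : ℝ) (z₀ : ℝ × ℝ) : Set (ℝ × ℝ) :=
  {z | 0 ≤ z.1 ∧ z.1 ≤ z₀.1 ∧ |z.2 - z₀.2| ≤ M * (z₀.1 - z.1)}

lemma isCompact_cone {M : ℝ} (hM : 0 ≤ M) (z₀ : ℝ × ℝ) : IsCompact (cone M z₀) := by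
  refine IsCompact.of_isClosed_subset
    (isCompact_Icc (a := 0) (b := z₀.1) |>.prod
      (isCompact_Icc (a := z₀.2 - M * z₀.1) (b := z₀.2 + M * z₀.1))) ?_ ?_
  · exact (isClosed_le continuous_const continuous_fst).inter
      ((isClosed_le continuous_fst continuous_const).inter
        (isClosed_le (f := fun z : ℝ × ℝ => |z.2 - z₀.2|) (g := fun z => M * (z₀.1 - z.1))
          (by fun_prop) (by fun_prop)))
  · rintro z ⟨h1, h2, h3⟩
    have : M * (z₀.1 - z.1) ≤ M * z₀.1 := by gcongr; linarith
    obtain ⟨h4, h5⟩ := abs_le.1 h3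
    exact ⟨⟨h1, h2⟩, ⟨by linarith, by linarith⟩⟩

lemma deriv_right_nonpos_of_le {g : ℝ → ℝ} {g' ε : ℝ} (hε : 0 < ε)
    (hg : HasDerivWithinAt g g' (Ici 0) 0) (h : ∀ x ∈ Icc 0 ε, g x ≤ g 0) : g' ≤ 0 := by
  have h1 : Tendsto (slope g 0) (𝓝[>] 0) (𝓝 g') := by
    have := hasDerivWithinAt_iff_tendsto_slope.1 hg
    rwa [Ici_sdiff_left] at this
  refine le_of_tendsto h1 ?_
  filter_upwards [Ioc_mem_nhdsGT hε] with x hx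
  rw [slope_def_field]
  exact div_nonpos_of_nonpos_of_nonneg (by linarith [h x ⟨hx.1.le, hx.2⟩]) (by linarith [hx.1])

/-- Functions vanishing at time `0` whose derivatives along directions of slope at most `M` are
controlled by the functions themselves vanish on backward cones. -/
theorem eq_zero_on_cone {ι : Type*} [Fintype ι] {M C : ℝ} (hM : 0 ≤ M) {z₀ : ℝ × ℝ}
    {d : ℝ × ℝ → ι → ℝ} (hd : ContinuousOn d (cone M z₀))
    (h0 : ∀ z ∈ cone M z₀, z.1 = 0 → d z = 0)
    (h : ∀ z ∈ cone M z₀, 0 < z.1 → ∀ i, ∃ l D : ℝ, |l| ≤ M ∧ |D| ≤ C * ‖d z‖ ∧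
      HasDerivWithinAt (fun h : ℝ => d (z - h • ((1 : ℝ), l)) i) (-D) (Ici 0) 0) :
    ∀ z ∈ cone M z₀, d z = 0 := by
  by_contra! hcon
  obtain ⟨z1, hz1, hdz1⟩ := hcon
  -- The decay rate `C + 1` exceeds the growth rate `C` of `d`. At a positive maximum of the
  -- weighted norm, moving back in time would strictly increase it, which is the contradiction aimed
  -- at.
  have hφ : ContinuousOn (fun z : ℝ × ℝ => Real.exp (-(C + 1) * z.1) * ‖d z‖) (cone M z₀) :=
    ContinuousOn.mul (by fun_prop) hd.norm
  obtain ⟨z, hz, hmax⟩ := (isCompact_cone hM z₀).exists_isMaxOn ⟨z1, hz1⟩ hφ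
  have hpos : 0 < Real.exp (-(C + 1) * z.1) * ‖d z‖ :=
    (mul_pos (Real.exp_pos _) (norm_pos_iff.2 hdz1)).trans_le (hmax hz1)
  have hdz : 0 < ‖d z‖ := pos_of_mul_pos_right hpos (Real.exp_pos _).le
  have hz0 : 0 < z.1 := by
    refine lt_of_le_of_ne hz.1 fun h => ?_
    rw [h0 z hz h.symm, norm_zero] at hdz
    exact lt_irrefl _ hdz
  -- In the supremum norm one component carries the whole norm at the maximum, so a single
  -- characteristic direction is enough although the components have different speeds.
  obtain ⟨i, hi⟩ : ∃ i, ‖d z i‖ = ‖d z‖ := by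
    by_contra! hne
    exact lt_irrefl _ ((pi_norm_lt_iff hdz).2 fun i => (norm_le_pi_norm (d z) i).lt_of_ne (hne i))
  obtain ⟨l, D, hl, hD, hder⟩ := h z hz hz0 i
  obtain ⟨σ, hσ1, hσ⟩ : ∃ σ : ℝ, |σ| = 1 ∧ σ * d z i = ‖d z‖ := by
    rw [← hi, Real.norm_eq_abs]
    rcases le_total 0 (d z i) with h | h
    · exact ⟨1, by simp, by rw [abs_of_nonneg h, one_mul]⟩
    · exact ⟨-1, by simp, by rw [abs_of_nonpos h, neg_one_mul]⟩
  have hexp : HasDerivAt (fun h : ℝ => Real.exp (-(C + 1) * (z.1 - h)))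
      (Real.exp (-(C + 1) * z.1) * (C + 1)) 0 := by
    have h1 : HasDerivAt (fun h : ℝ => -(C + 1) * (z.1 - h)) (C + 1) 0 := by
      simpa using ((hasDerivAt_id (0:ℝ)).const_sub z.1).const_mul (-(C + 1))
    simpa using h1.exp
  have hg := hexp.hasDerivWithinAt (s := Ici 0) |>.mul (hder.const_mul σ)
  have := deriv_right_nonpos_of_le hz0 hg fun h hh => by
    simp only [Pi.mul_apply, zero_smul, sub_zero, hσ]
    have hmem : z - h • ((1 : ℝ), l) ∈ cone M z₀ := by
      obtain ⟨-, a2, a3⟩ := hz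
      refine ⟨?_, ?_, ?_⟩
      · simpa using hh.2
      · simp; linarith [hh.1]
      · simp only [Prod.snd_sub, Prod.smul_snd, smul_eq_mul, Prod.fst_sub, Prod.smul_fst, mul_one]
        have e1 : z.2 - h * l - z₀.2 = (z.2 - z₀.2) - h * l := by ring
        have e2 : |h * l| ≤ h * M := by
          rw [abs_mul, abs_of_nonneg hh.1]; exact mul_le_mul_of_nonneg_left hl hh.1
        rw [e1]
        refine (abs_sub _ _).trans ?_
        linarith
    refine le_trans ?_ (hmax hmem)
    simp only [Prod.fst_sub, Prod.smul_fst, smul_eq_mul, mul_one]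
    refine mul_le_mul_of_nonneg_left ?_ (Real.exp_pos _).le
    refine (le_abs_self _).trans ?_
    rw [abs_mul, hσ1, one_mul]
    exact norm_le_pi_norm (d (z - h • ((1 : ℝ), l))) i
  simp only [zero_smul, sub_zero, hσ] at this
  have e1 : σ * D ≤ C * ‖d z‖ := by
    refine (le_abs_self _).trans ?_
    rwa [abs_mul, hσ1, one_mul]
  have e2 : Real.exp (-(C + 1) * z.1) * ((C + 1) * ‖d z‖ - σ * D) ≤ 0 := by
    nlinarith
  have e3 : 0 < Real.exp (-(C + 1) * z.1) * ((C + 1) * ‖d z‖ - σ * D) :=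
    mul_pos (Real.exp_pos _) (by linarith)
  linarith

/-- `K` is not assumed convex, so the mean value inequality does not apply; the local Lipschitz
bounds are combined by compactness. -/
lemma exists_lipschitz_of_contDiffOn {V : Type*} [NormedAddCommGroup V] [NormedSpace ℝ V]
    {f : V → ℝ} {O K : Set V} (hO : IsOpen O)
    (hf : ContDiffOn ℝ 1 f O) (hK : IsCompact K) (hKO : K ⊆ O) :
    ∃ C : ℝ, 0 ≤ C ∧ ∀ u ∈ K, ∀ v ∈ K, |f u - f v| ≤ C * ‖u - v‖ := by
  have h1 : LocallyLipschitzOn K f := fun x hx => by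
    obtain ⟨C, t, ht, h⟩ :=
      ((hf x (hKO hx)).contDiffAt (hO.mem_nhds (hKO hx))).exists_lipschitzOnWith
    exact ⟨C, t, mem_nhdsWithin_of_mem_nhds ht, h⟩
  obtain ⟨C, hC⟩ := h1.exists_lipschitzOnWith_of_compact hK
  refine ⟨C, C.2, fun u hu v hv => ?_⟩
  rw [← Real.dist_eq, ← dist_eq_norm]
  exact hC.dist_le_mul u hu v hv

lemma uniqueDiffOn_strip {T : ℝ} (hT : 0 < T) :
    UniqueDiffOn ℝ (Icc 0 T ×ˢ univ : Set (ℝ × ℝ)) :=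
  (uniqueDiffOn_Icc hT).prod uniqueDiffOn_univ

lemma _root_.HasFDerivWithinAt.hasDerivWithinAt_backward {ι : Type*} [Fintype ι]
    {W : ℝ × ℝ → ι → ℝ} {W' : ℝ × ℝ →L[ℝ] ι → ℝ} {S : Set (ℝ × ℝ)} {z : ℝ × ℝ} {l ε : ℝ}
    (hW : HasFDerivWithinAt W W' S z) (i : ι) (hε : 0 < ε)
    (hS : ∀ h ∈ Icc 0 ε, z - h • ((1 : ℝ), l) ∈ S) :
    HasDerivWithinAt (fun h : ℝ => W (z - h • ((1 : ℝ), l)) i) (-(W' (1, l) i)) (Ici 0) 0 := by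
  have hγ : HasDerivWithinAt (fun h : ℝ => z - h • ((1 : ℝ), l)) (-((1 : ℝ), l)) (Icc 0 ε) 0 := by
    have := (((hasDerivAt_id (0 : ℝ)).smul_const ((1 : ℝ), l)).const_sub z)
    rw [one_smul] at this
    exact this.hasDerivWithinAt
  have hW0 : HasFDerivWithinAt W W' S (z - (0 : ℝ) • ((1 : ℝ), l)) := by
    rwa [zero_smul, sub_zero]
  have h1 := HasFDerivWithinAt.comp_hasDerivWithinAt (0 : ℝ) hW0 hγ hS
  rw [map_neg] at h1
  exact (hasDerivWithinAt_pi.1 h1 i).mono_of_mem_nhdsWithin (Icc_mem_nhdsGE hε)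

/-- Uniqueness for diagonal quasilinear systems `m(U) (∂ₜUᵢ + lamᵢ(U) ∂ₓUᵢ) = Hᵢ(U)` with bounded
speeds of propagation; `m` is required not to vanish along one of the two solutions only. -/
theorem quasilinear_unique {ι : Type*} [Fintype ι] {O : Set (ι → ℝ)} (hO : IsOpen O)
    {lam H : ι → (ι → ℝ) → ℝ} {m : (ι → ℝ) → ℝ}
    (hlam : ∀ i, ContDiffOn ℝ 1 (lam i) O) (hH : ∀ i, ContDiffOn ℝ 1 (H i) O)
    (hm : ContDiffOn ℝ 1 m O) {M : ℝ} (hM0 : 0 ≤ M) (hM : ∀ i, ∀ u ∈ O, |lam i u| ≤ M)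
    {T : ℝ} (hT : 0 < T) {U V : ℝ × ℝ → ι → ℝ}
    (hU : ContDiffOn ℝ 1 U (Icc 0 T ×ˢ univ)) (hV : ContDiffOn ℝ 1 V (Icc 0 T ×ˢ univ))
    (hUO : ∀ z ∈ (Icc 0 T ×ˢ univ : Set (ℝ × ℝ)), U z ∈ O)
    (hVO : ∀ z ∈ (Icc 0 T ×ˢ univ : Set (ℝ × ℝ)), V z ∈ O)
    (hUm : ∀ z ∈ (Icc 0 T ×ˢ univ : Set (ℝ × ℝ)), m (U z) ≠ 0)
    (hUeq : ∀ z ∈ (Icc 0 T ×ˢ univ : Set (ℝ × ℝ)), ∀ i,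
      m (U z) * fderivWithin ℝ U (Icc 0 T ×ˢ univ) z (1, lam i (U z)) i = H i (U z))
    (hVeq : ∀ z ∈ (Icc 0 T ×ˢ univ : Set (ℝ × ℝ)), ∀ i,
      m (V z) * fderivWithin ℝ V (Icc 0 T ×ˢ univ) z (1, lam i (V z)) i = H i (V z))
    (h0 : ∀ x, U (0, x) = V (0, x)) :
    ∀ z ∈ (Icc 0 T ×ˢ univ : Set (ℝ × ℝ)), U z = V z := by
  intro z₀ hz₀
  set S : Set (ℝ × ℝ) := Icc 0 T ×ˢ univ with hS
  set K := cone M z₀ with hK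
  have hKS : K ⊆ S := fun z hz => ⟨⟨hz.1, hz.2.1.trans hz₀.1.2⟩, mem_univ _⟩
  have hKc : IsCompact K := isCompact_cone hM0 z₀
  have hUK : ContinuousOn U K := hU.continuousOn.mono hKS
  have hVK : ContinuousOn V K := hV.continuousOn.mono hKS
  set B := U '' K ∪ V '' K with hB
  have hBc : IsCompact B := (hKc.image_of_continuousOn hUK).union (hKc.image_of_continuousOn hVK)
  have hBO : B ⊆ O := by
    rintro _ (⟨z, hz, rfl⟩ | ⟨z, hz, rfl⟩)
    exacts [hUO z (hKS hz), hVO z (hKS hz)]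
  have hUB : ∀ z ∈ K, U z ∈ B := fun z hz => .inl ⟨z, hz, rfl⟩
  have hVB : ∀ z ∈ K, V z ∈ B := fun z hz => .inr ⟨z, hz, rfl⟩
  choose CH hCH0 hCH using fun i =>
    exists_lipschitz_of_contDiffOn hO (hH i) hBc hBO
  choose Cl hCl0 hCl using fun i =>
    exists_lipschitz_of_contDiffOn hO (hlam i) hBc hBO
  obtain ⟨Cm, hCm0, hCm⟩ := exists_lipschitz_of_contDiffOn hO hm hBc hBO
  obtain ⟨N, hN⟩ := hKc.exists_bound_of_continuousOn
    ((hV.continuousOn_fderivWithin (uniqueDiffOn_strip hT) le_rfl).mono hKS)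
  obtain ⟨μ, hμ⟩ := hKc.exists_bound_of_continuousOn
    (ContinuousOn.inv₀ (hm.continuousOn.comp hUK fun z hz => hBO (hUB z hz))
      fun z hz => hUm z (hKS hz))
  have hz₀K : z₀ ∈ K := ⟨hz₀.1.1, le_rfl, by simp⟩
  have hN0 : 0 ≤ N := (norm_nonneg _).trans (hN z₀ hz₀K)
  have hμ0 : 0 ≤ μ := (norm_nonneg _).trans (hμ z₀ hz₀K)
  set C := ∑ i, (μ * (CH i + Cm * (N * (1 + M))) + Cl i * N) with hC
  have hCi : ∀ i, μ * (CH i + Cm * (N * (1 + M))) + Cl i * N ≤ C := fun i =>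
    Finset.single_le_sum (f := fun i => μ * (CH i + Cm * (N * (1 + M))) + Cl i * N)
      (fun i _ => by have := hCH0 i; have := hCl0 i; positivity) (Finset.mem_univ i)
  have key := eq_zero_on_cone (C := C) (d := fun z => U z - V z) hM0 (z₀ := z₀)
    (hUK.sub hVK) (fun z hz h => by
      have : z = (0, z.2) := by rw [← h]
      rw [this, h0, sub_self]) ?_ z₀ hz₀K
  · exact sub_eq_zero.1 key
  intro z hz hzpos i
  have hzS := hKS hz
  set l := lam i (U z) with hl
  set U' := fderivWithin ℝ U S z
  set V' := fderivWithin ℝ V S z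
  have hlM : |l| ≤ M := hM i _ (hUO z hzS)
  refine ⟨l, U' (1, l) i - V' (1, l) i, hlM, ?_, ?_⟩
  · have eU := hUeq z hzS i
    have eV := hVeq z hzS i
    have hl1 : ‖((1 : ℝ), lam i (V z))‖ ≤ 1 + M := by
      rw [Prod.norm_def]
      refine max_le (by simp; exact hM0) ?_
      exact (hM i _ (hVO z hzS)).trans (by linarith)
    -- The difference `U - V` is differentiated along the characteristic of `U`. For `V` this
    -- direction is not its own, and the discrepancy costs a factor `lam (U) - lam (V)` times a
    -- derivative of `V`, which is bounded on the cone.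
    have hsplit : V' (1, l) i = V' (1, lam i (V z)) i + (l - lam i (V z)) * V' (0, 1) i := by
      have : ((1 : ℝ), l) = (1, lam i (V z)) + (l - lam i (V z)) • (0, 1) := by
        ext <;> simp
      rw [this, map_add, map_smul]; simp
    set δ := ‖U z - V z‖
    have b1 := hCH i _ (hUB z hz) _ (hVB z hz)
    have b2 := hCl i _ (hUB z hz) _ (hVB z hz)
    have b3 := hCm _ (hUB z hz) _ (hVB z hz)
    have b4 : |V' (1, lam i (V z)) i| ≤ N * (1 + M) := by
      refine (norm_le_pi_norm _ i).trans ((V'.le_opNorm _).trans ?_)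
      exact mul_le_mul (hN z hz) hl1 (norm_nonneg _) hN0
    have b5 : |V' (0, 1) i| ≤ N := by
      refine (norm_le_pi_norm _ i).trans ((V'.le_opNorm _).trans ?_)
      have : ‖((0 : ℝ), (1 : ℝ))‖ = 1 := by simp [Prod.norm_def]
      rw [this, mul_one]; exact hN z hz
    have b6 : |(m (U z))⁻¹| ≤ μ := hμ z hz
    have hmU := hUm z hzS
    -- Only `m (U z)` is inverted: the equation for `V` is rewritten with weight `m (U z)`, and the
    -- change of weight becomes another error term proportional to `U - V`.
    have e1 : U' (1, l) i - V' (1, l) i = (m (U z))⁻¹ * ((H i (U z) - H i (V z))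
        - (m (U z) - m (V z)) * V' (1, lam i (V z)) i) - (l - lam i (V z)) * V' (0, 1) i := by
      rw [hsplit, ← eU, ← eV]
      field_simp
      ring
    rw [e1]
    refine (abs_sub _ _).trans ?_
    refine le_trans ?_ (mul_le_mul_of_nonneg_right (hCi i) (norm_nonneg _))
    rw [abs_mul, abs_mul]
    calc _ ≤ μ * (CH i * δ + Cm * δ * (N * (1 + M))) + Cl i * δ * N := by
          have := hCl0 i
          have hδ : 0 ≤ δ := norm_nonneg _
          gcongr
          refine (abs_sub _ _).trans ?_
          rw [abs_mul]
          gcongr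
      _ = _ := by ring
  · have hdiff : HasFDerivWithinAt (fun z => U z - V z) (U' - V') S z :=
      ((hU.differentiableOn one_ne_zero) z hzS).hasFDerivWithinAt.sub
        ((hV.differentiableOn one_ne_zero) z hzS).hasFDerivWithinAt
    exact hdiff.hasDerivWithinAt_backward i hzpos fun h hh =>
      ⟨⟨by simpa using hh.2, by simp; linarith [hh.1, hzS.1.2]⟩, mem_univ _⟩

/-! ### Differential calculus on the closed strip. -/

/-- The strip `[0, T] × ℝ`. -/
abbrev strip (T : ℝ) : Set (ℝ × ℝ) := Icc 0 T ×ˢ univ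

section Strip

variable {T : ℝ} {f ft fx g : ℝ → ℝ → ℝ}

/-- The linear form `(τ, y) ↦ a τ + b y`. -/
noncomputable def linForm (a b : ℝ) : ℝ × ℝ →L[ℝ] ℝ :=
  a • ContinuousLinearMap.fst ℝ ℝ ℝ + b • ContinuousLinearMap.snd ℝ ℝ ℝ

@[simp] lemma linForm_apply (a b : ℝ) (z : ℝ × ℝ) : linForm a b z = a * z.1 + b * z.2 := by
  simp [linForm]

lemma hasDerivWithinAt_fst {f' : ℝ × ℝ →L[ℝ] ℝ} {t x : ℝ}
    (h : HasFDerivWithinAt (fun z : ℝ × ℝ => f z.1 z.2) f' (strip T) (t, x)) :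
    HasDerivWithinAt (fun τ => f τ x) (f' (1, 0)) (Icc 0 T) t := by
  have h1 : HasDerivWithinAt (fun τ : ℝ => (τ, x)) ((1 : ℝ), (0 : ℝ)) (Icc 0 T) t :=
    ((hasDerivAt_id t).prodMk (hasDerivAt_const t x)).hasDerivWithinAt
  have hm : MapsTo (fun τ : ℝ => (τ, x)) (Icc 0 T) (strip T) := fun τ hτ => ⟨hτ, mem_univ _⟩
  exact HasFDerivWithinAt.comp_hasDerivWithinAt t h h1 hm

lemma hasDerivAt_snd {f' : ℝ × ℝ →L[ℝ] ℝ} {t x : ℝ} (ht : t ∈ Icc 0 T)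
    (h : HasFDerivWithinAt (fun z : ℝ × ℝ => f z.1 z.2) f' (strip T) (t, x)) :
    HasDerivAt (fun y => f t y) (f' (0, 1)) x := by
  have h1 : HasDerivWithinAt (fun y : ℝ => (t, y)) ((0 : ℝ), (1 : ℝ)) univ x :=
    ((hasDerivAt_const x t).prodMk (hasDerivAt_id x)).hasDerivWithinAt
  have hm : MapsTo (fun y : ℝ => (t, y)) univ (strip T) := fun y _ => ⟨ht, mem_univ _⟩
  exact hasDerivWithinAt_univ.1 (HasFDerivWithinAt.comp_hasDerivWithinAt x h h1 hm)

lemma dt_eq_of_hasDerivWithinAt (hT : 0 < T) {t x a : ℝ} (ht : t ∈ Icc 0 T)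
    (h : HasDerivWithinAt (fun τ => f τ x) a (Icc 0 T) t) : dt T f t x = a :=
  h.derivWithin (uniqueDiffOn_Icc hT t ht)

lemma dt_eq_of_hasFDerivWithinAt (hT : 0 < T) {f' : ℝ × ℝ →L[ℝ] ℝ} {t x : ℝ} (ht : t ∈ Icc 0 T)
    (h : HasFDerivWithinAt (fun z : ℝ × ℝ => f z.1 z.2) f' (strip T) (t, x)) :
    dt T f t x = f' (1, 0) :=
  dt_eq_of_hasDerivWithinAt hT ht (hasDerivWithinAt_fst h)

lemma dx_eq_of_hasFDerivWithinAt {f' : ℝ × ℝ →L[ℝ] ℝ} {t x : ℝ} (ht : t ∈ Icc 0 T)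
    (h : HasFDerivWithinAt (fun z : ℝ × ℝ => f z.1 z.2) f' (strip T) (t, x)) :
    dx f t x = f' (0, 1) :=
  (hasDerivAt_snd ht h).deriv

/-- A function with partial derivatives, the spatial one being continuous, is differentiable. -/
lemma hasFDerivWithinAt_of_partial {t x : ℝ} (ht : t ∈ Icc 0 T)
    (h1 : HasDerivWithinAt (fun τ => f τ x) (ft t x) (Icc 0 T) t)
    (h2 : ∀ t ∈ Icc 0 T, ∀ x, HasDerivAt (fun y => f t y) (fx t x) x)
    (hc : ContinuousOn (fun z : ℝ × ℝ => fx z.1 z.2) (strip T)) :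
    HasFDerivWithinAt (fun z : ℝ × ℝ => f z.1 z.2) (linForm (ft t x) (fx t x)) (strip T)
      (t, x) := by
  rw [hasFDerivWithinAt_iff_isLittleO, Asymptotics.isLittleO_iff]
  intro ε hε
  have h1' := (hasDerivWithinAt_iff_isLittleO.1 h1).def (half_pos hε)
  obtain ⟨δ1, hδ1, H1⟩ := Metric.mem_nhdsWithin_iff.1 h1'
  obtain ⟨δ2, hδ2, H2⟩ := Metric.continuousOn_iff.1 hc (t, x) ⟨ht, mem_univ _⟩ (ε / 2)
    (half_pos hε)
  refine Metric.mem_nhdsWithin_iff.2 ⟨min δ1 δ2, lt_min hδ1 hδ2, ?_⟩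
  rintro ⟨t', x'⟩ ⟨hz, hz'⟩
  rw [Metric.mem_ball, Prod.dist_eq, max_lt_iff, lt_min_iff, lt_min_iff] at hz
  obtain ⟨⟨a1, a2⟩, a3, a4⟩ := hz
  have e1 := H1 ⟨a1, hz'.1⟩
  simp only [mem_ofPred_eq, linForm_apply, Prod.fst_sub, Prod.snd_sub, Prod.mk_sub_mk, smul_eq_mul]
    at e1 ⊢
  have e2 : ‖(f t' x' - fx t x * x') - (f t' x - fx t x * x)‖ ≤ ε / 2 * ‖x' - x‖ := by
    refine Convex.norm_image_sub_le_of_norm_hasDerivWithin_le (s := Metric.ball x δ2)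
      (f := fun y => f t' y - fx t x * y) (f' := fun y => fx t' y - fx t x) (fun y _ => ?_)
      (fun y hy => ?_) (convex_ball _ _) (Metric.mem_ball_self hδ2) a4
    · have := (h2 t' hz'.1 y).sub ((hasDerivAt_id y).const_mul (fx t x))
      rw [mul_one] at this
      exact this.hasDerivWithinAt
    · rw [← dist_eq_norm]
      refine (H2 (t', y) ⟨hz'.1, mem_univ _⟩ ?_).le
      rw [Prod.dist_eq]; exact max_lt a2 hy
  have e3 : f t' x' - f t x - (ft t x * (t' - t) + fx t x * (x' - x))
      = ((f t' x' - fx t x * x') - (f t' x - fx t x * x))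
        + (f t' x - f t x - (t' - t) * ft t x) := by ring
  rw [e3]
  have b1 : ‖t' - t‖ ≤ ‖((t' - t, x' - x) : ℝ × ℝ)‖ := norm_fst_le (t' - t, x' - x)
  have b2 : ‖x' - x‖ ≤ ‖((t' - t, x' - x) : ℝ × ℝ)‖ := norm_snd_le (t' - t, x' - x)
  calc _ ≤ ε / 2 * ‖x' - x‖ + ε / 2 * ‖t' - t‖ := (norm_add_le _ _).trans (add_le_add e2 e1)
    _ ≤ ε / 2 * ‖((t' - t, x' - x) : ℝ × ℝ)‖ + ε / 2 * ‖((t' - t, x' - x) : ℝ × ℝ)‖ := by gcongr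
    _ = _ := by ring

lemma contDiffOn_linForm {n : WithTop ℕ∞} {S : Set (ℝ × ℝ)} {a b : ℝ × ℝ → ℝ}
    (ha : ContDiffOn ℝ n a S) (hb : ContDiffOn ℝ n b S) :
    ContDiffOn ℝ n (fun z => linForm (a z) (b z)) S := by
  unfold linForm
  exact (ha.smul contDiffOn_const).add (hb.smul contDiffOn_const)

/-- A function whose partial derivatives are of class `C^n` is of class `C^(n+1)`. -/
lemma contDiffOn_succ_of_partial (hT : 0 < T) {n : ℕ}
    (h1 : ∀ t ∈ Icc 0 T, ∀ x, HasDerivWithinAt (fun τ => f τ x) (ft t x) (Icc 0 T) t)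
    (h2 : ∀ t ∈ Icc 0 T, ∀ x, HasDerivAt (fun y => f t y) (fx t x) x)
    (hft : ContDiffOn ℝ n (fun z : ℝ × ℝ => ft z.1 z.2) (strip T))
    (hfx : ContDiffOn ℝ n (fun z : ℝ × ℝ => fx z.1 z.2) (strip T)) :
    ContDiffOn ℝ (n + 1) (fun z : ℝ × ℝ => f z.1 z.2) (strip T) := by
  rw [contDiffOn_succ_iff_hasFDerivWithinAt_of_uniqueDiffOn (uniqueDiffOn_strip hT)]
  refine ⟨fun h => by exact absurd h (by simp), fun z => linForm (ft z.1 z.2) (fx z.1 z.2),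
    contDiffOn_linForm hft hfx, fun z hz => ?_⟩
  exact hasFDerivWithinAt_of_partial hz.1 (h1 _ hz.1 z.2) h2 hfx.continuousOn

lemma linForm_eq (f' : ℝ × ℝ →L[ℝ] ℝ) : linForm (f' (1, 0)) (f' (0, 1)) = f' := by
  ext <;> simp

/-- The differential of a `C¹` function on the strip. -/
lemma hasFDerivWithinAt_strip (hT : 0 < T)
    (hf : ContDiffOn ℝ 1 (fun z : ℝ × ℝ => f z.1 z.2) (strip T)) {t x : ℝ} (ht : t ∈ Icc 0 T) :
    HasFDerivWithinAt (fun z : ℝ × ℝ => f z.1 z.2) (linForm (dt T f t x) (dx f t x)) (strip T)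
      (t, x) := by
  have h := (hf.differentiableOn one_ne_zero (t, x) ⟨ht, mem_univ _⟩).hasFDerivWithinAt
  rw [dt_eq_of_hasFDerivWithinAt hT ht h, dx_eq_of_hasFDerivWithinAt ht h, linForm_eq]
  exact h

lemma fderivWithin_strip_apply (hT : 0 < T)
    (hf : ContDiffOn ℝ 1 (fun z : ℝ × ℝ => f z.1 z.2) (strip T)) {z : ℝ × ℝ} (hz : z ∈ strip T)
    (w : ℝ × ℝ) : fderivWithin ℝ (fun z : ℝ × ℝ => f z.1 z.2) (strip T) z w
      = dt T f z.1 z.2 * w.1 + dx f z.1 z.2 * w.2 := by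
  rw [(hasFDerivWithinAt_strip hT hf hz.1).fderivWithin (uniqueDiffOn_strip hT z hz),
    linForm_apply]

lemma contDiffOn_dt (hT : 0 < T) {n : ℕ}
    (hf : ContDiffOn ℝ (n + 1) (fun z : ℝ × ℝ => f z.1 z.2) (strip T)) :
    ContDiffOn ℝ n (fun z : ℝ × ℝ => dt T f z.1 z.2) (strip T) := by
  have h1 := hf.fderivWithin (uniqueDiffOn_strip hT) le_rfl
  refine (h1.clm_apply (contDiffOn_const (c := ((1 : ℝ), (0 : ℝ))))).congr fun z hz => ?_
  rw [fderivWithin_strip_apply hT (hf.of_le (by simp)) hz]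
  simp

lemma contDiffOn_dx (hT : 0 < T) {n : ℕ}
    (hf : ContDiffOn ℝ (n + 1) (fun z : ℝ × ℝ => f z.1 z.2) (strip T)) :
    ContDiffOn ℝ n (fun z : ℝ × ℝ => dx f z.1 z.2) (strip T) := by
  have h1 := hf.fderivWithin (uniqueDiffOn_strip hT) le_rfl
  refine (h1.clm_apply (contDiffOn_const (c := ((0 : ℝ), (1 : ℝ))))).congr fun z hz => ?_
  rw [fderivWithin_strip_apply hT (hf.of_le (by simp)) hz]
  simp

lemma mem_closure_interior_strip (hT : 0 < T) {z : ℝ × ℝ} (hz : z ∈ strip T) :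
    z ∈ closure (interior (strip T)) := by
  rw [interior_prod_eq, interior_Icc, interior_univ, closure_prod_eq, closure_Ioo hT.ne,
    closure_univ]
  exact hz

/-- Symmetry of the second derivative within the strip holds also at the boundary times, because the
strip lies in the closure of its interior. -/
lemma dx_dt_comm (hT : 0 < T) (hf : ContDiffOn ℝ 2 (fun z : ℝ × ℝ => f z.1 z.2) (strip T))
    {t x : ℝ} (ht : t ∈ Icc 0 T) : dx (dt T f) t x = dt T (dx f) t x := by
  have hz : (t, x) ∈ strip T := ⟨ht, mem_univ _⟩
  have hf' : ContDiffOn ℝ ((1 : ℕ) + 1) (fun z : ℝ × ℝ => f z.1 z.2) (strip T) := by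
    norm_num; exact hf
  have h1 : ContDiffOn ℝ 1 (fderivWithin ℝ (fun z : ℝ × ℝ => f z.1 z.2) (strip T)) (strip T) :=
    hf'.fderivWithin (uniqueDiffOn_strip hT) le_rfl
  have h2 := (h1.differentiableOn one_ne_zero (t, x) hz).hasFDerivWithinAt
  have hf1 := hf.of_le (one_le_two)
  have hsymm := (hf (t, x) hz).isSymmSndFDerivWithinAt (by simp) (uniqueDiffOn_strip hT)
    (mem_closure_interior_strip hT hz) hz
  have e1 : HasFDerivWithinAt (fun z : ℝ × ℝ => dt T f z.1 z.2)
      ((ContinuousLinearMap.apply ℝ ℝ ((1 : ℝ), (0 : ℝ))).comp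
        (fderivWithin ℝ (fderivWithin ℝ (fun z : ℝ × ℝ => f z.1 z.2) (strip T)) (strip T) (t, x)))
      (strip T) (t, x) := by
    refine ((ContinuousLinearMap.apply ℝ ℝ ((1 : ℝ), (0 : ℝ))).hasFDerivAt.comp_hasFDerivWithinAt
      (t, x) h2).congr (fun z hz => ?_) ?_
    · simp [fderivWithin_strip_apply hT hf1 hz]
    · simp [fderivWithin_strip_apply hT hf1 hz]
  have e2 : HasFDerivWithinAt (fun z : ℝ × ℝ => dx f z.1 z.2)
      ((ContinuousLinearMap.apply ℝ ℝ ((0 : ℝ), (1 : ℝ))).comp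
        (fderivWithin ℝ (fderivWithin ℝ (fun z : ℝ × ℝ => f z.1 z.2) (strip T)) (strip T) (t, x)))
      (strip T) (t, x) := by
    refine ((ContinuousLinearMap.apply ℝ ℝ ((0 : ℝ), (1 : ℝ))).hasFDerivAt.comp_hasFDerivWithinAt
      (t, x) h2).congr (fun z hz => ?_) ?_
    · simp [fderivWithin_strip_apply hT hf1 hz]
    · simp [fderivWithin_strip_apply hT hf1 hz]
  rw [dx_eq_of_hasFDerivWithinAt ht e1, dt_eq_of_hasFDerivWithinAt hT ht e2]
  simp only [ContinuousLinearMap.comp_apply, ContinuousLinearMap.apply_apply]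
  exact hsymm _ _

lemma exists_primitive_Icc (hT : 0 ≤ T) {f : ℝ → ℝ} (hf : ContinuousOn f (Icc 0 T)) :
    ∃ p : ℝ → ℝ, p 0 = 0 ∧ ∀ t ∈ Icc 0 T, HasDerivWithinAt p (f t) (Icc 0 T) t := by
  set f' : ℝ → ℝ := fun t => f (projIcc 0 T hT t) with hf'
  have hf'c : Continuous f' :=
    (continuousOn_iff_continuous_domRestrict.1 hf).comp continuous_projIcc
  refine ⟨fun t => ∫ s in (0:ℝ)..t, f' s, by simp, fun t ht => ?_⟩
  have := (hf'c.integral_hasStrictDerivAt 0 t).hasDerivAt.hasDerivWithinAt (s := Icc 0 T)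
  rwa [show f' t = f t by simp [hf', projIcc_of_mem hT ht]] at this

/-- Interchange of the derivatives in time and in space. -/
lemma hasDerivWithinAt_deriv {A B A' B' : ℝ} (hT : 0 < T)
    (hfg : ∀ t ∈ Icc 0 T, ∀ x, HasDerivWithinAt (fun τ => f τ x) (g t x) (Icc 0 T) t)
    (hf : ∀ t ∈ Icc 0 T, IsC11 A B (f t)) (hg : ∀ t ∈ Icc 0 T, IsC11 A' B' (g t)) (x : ℝ)
    (hc : ContinuousOn (fun t => deriv (g t) x) (Icc 0 T)) {t : ℝ} (ht : t ∈ Icc 0 T) :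
    HasDerivWithinAt (fun t => deriv (f t) x) (deriv (g t) x) (Icc 0 T) t := by
  obtain ⟨p, hp0, hp⟩ := exists_primitive_Icc hT.le hc
  have h0T : (0 : ℝ) ∈ Icc 0 T := ⟨le_rfl, hT.le⟩
  have hB := (hf t ht).nonneg.2
  have hB' := (hg t ht).nonneg.2
  -- No mixed second derivative of `f` is available, so finite differences replace it. The increment
  -- `f t (x + h) - f t x - h * p t` changes in time by at most `B' h² T`, and at both times it is
  -- linear in `h` up to `B h²`; dividing by `h` and letting `h → 0` gives the identity.
  have key : ∀ t ∈ Icc 0 T, deriv (f t) x = deriv (f 0) x + p t := by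
    intro t ht
    have hh : ∀ h > 0, |deriv (f t) x - (deriv (f 0) x + p t)| ≤ (2 * B + B' * T) * h := by
      intro h hh
      have e1 := (hf t ht).taylor x (x + h)
      have e2 := (hf 0 h0T).taylor x (x + h)
      have e3 : ‖(f t (x + h) - f t x - h * p t) - (f 0 (x + h) - f 0 x - h * p 0)‖
          ≤ B' * h ^ 2 * ‖t - 0‖ := by
        refine Convex.norm_image_sub_le_of_norm_hasDerivWithin_le (s := Icc 0 T)
          (f := fun t => f t (x + h) - f t x - h * p t)
          (f' := fun t => g t (x + h) - g t x - h * deriv (g t) x) (fun s hs => ?_)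
          (fun s hs => ?_) (convex_Icc _ _) h0T ht
        · exact ((hfg s hs (x + h)).sub (hfg s hs x)).sub ((hp s hs).const_mul h)
        · simpa using (hg s hs).taylor x (x + h)
      rw [hp0, mul_zero, sub_zero, sub_zero, Real.norm_eq_abs, Real.norm_eq_abs,
        abs_of_nonneg ht.1] at e3
      simp only [add_sub_cancel_left, smul_eq_mul, Real.norm_eq_abs, sq_abs] at e1 e2
      have e5 : B' * h ^ 2 * t ≤ B' * h ^ 2 * T := by gcongr; exact ht.2
      have e4 : h * |deriv (f t) x - (deriv (f 0) x + p t)| ≤ (2 * B + B' * T) * h * h := by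
        rw [← abs_of_pos hh, ← abs_mul, abs_of_pos hh]
        rw [abs_le] at e1 e2 e3 ⊢
        constructor <;> nlinarith
      rw [mul_comm] at e4
      exact le_of_mul_le_mul_right e4 hh
    have : |deriv (f t) x - (deriv (f 0) x + p t)| ≤ 0 := by
      refine le_of_forall_pos_le_add fun ε hε => ?_
      rw [zero_add]
      have hC : 0 ≤ 2 * B + B' * T := by positivity
      refine (hh (ε / (2 * B + B' * T + 1)) (by positivity)).trans ?_
      rw [mul_div_assoc', div_le_iff₀ (by positivity)]
      nlinarith
    exact sub_eq_zero.1 (abs_nonpos_iff.1 this)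
  exact ((hp t ht).const_add (deriv (f 0) x)).congr key (key t ht)

end Strip

/-! ### The wave speed and its logarithmic derivative. -/

section WaveSpeed

variable {K1 K3 : ℝ}

lemma waveSpeed_sq_pos (hK1 : 0 < K1) (hK3 : 0 < K3) (p : ℝ) :
    0 < K1 * Real.sin p ^ 2 + K3 * Real.cos p ^ 2 := by
  have h := Real.sin_sq_add_cos_sq p
  rcases eq_or_ne (Real.sin p) 0 with h0 | h0
  · rw [h0] at h ⊢
    have : Real.cos p ^ 2 = 1 := by linarith
    rw [this]; linarith
  · have : 0 < Real.sin p ^ 2 := by positivity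
    positivity

lemma waveSpeed_pos (hK1 : 0 < K1) (hK3 : 0 < K3) (p : ℝ) : 0 < waveSpeed K1 K3 p :=
  Real.sqrt_pos.2 (waveSpeed_sq_pos hK1 hK3 p)

lemma waveSpeed_le (hK1 : 0 < K1) (hK3 : 0 < K3) (p : ℝ) :
    waveSpeed K1 K3 p ≤ Real.sqrt (K1 + K3) := by
  apply Real.sqrt_le_sqrt
  have h1 := Real.sin_sq_le_one p
  have h2 := Real.cos_sq_le_one p
  nlinarith

lemma contDiff_waveSpeed (hK1 : 0 < K1) (hK3 : 0 < K3) {n : WithTop ℕ∞} :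
    ContDiff ℝ n (waveSpeed K1 K3) := by
  unfold waveSpeed
  refine ContDiff.sqrt ?_ fun x => (waveSpeed_sq_pos hK1 hK3 x).ne'
  exact (contDiff_const.mul (Real.contDiff_sin.pow 2)).add
    (contDiff_const.mul (Real.contDiff_cos.pow 2))

/-- The logarithmic derivative `c' / c` of the wave speed. -/
noncomputable def logDerivSpeed (K1 K3 p : ℝ) : ℝ :=
  (K1 - K3) * (Real.sin p * Real.cos p) / (K1 * Real.sin p ^ 2 + K3 * Real.cos p ^ 2)

lemma contDiff_logDerivSpeed (hK1 : 0 < K1) (hK3 : 0 < K3) {n : WithTop ℕ∞} :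
    ContDiff ℝ n (logDerivSpeed K1 K3) := by
  unfold logDerivSpeed
  refine ContDiff.div ?_ ?_ fun x => (waveSpeed_sq_pos hK1 hK3 x).ne'
  · exact contDiff_const.mul (Real.contDiff_sin.mul Real.contDiff_cos)
  · exact (contDiff_const.mul (Real.contDiff_sin.pow 2)).add
      (contDiff_const.mul (Real.contDiff_cos.pow 2))

lemma hasDerivAt_waveSpeed (hK1 : 0 < K1) (hK3 : 0 < K3) (p : ℝ) :
    HasDerivAt (waveSpeed K1 K3) (logDerivSpeed K1 K3 p * waveSpeed K1 K3 p) p := by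
  have hpos := waveSpeed_sq_pos hK1 hK3 p
  have h1 : HasDerivAt (fun p => K1 * Real.sin p ^ 2 + K3 * Real.cos p ^ 2)
      (2 * ((K1 - K3) * (Real.sin p * Real.cos p))) p := by
    have := (((Real.hasDerivAt_sin p).fun_pow 2).const_mul K1).add
      (((Real.hasDerivAt_cos p).fun_pow 2).const_mul K3)
    refine this.congr_deriv ?_
    push_cast; ring
  have h2 := h1.sqrt hpos.ne'
  refine h2.congr_deriv ?_
  unfold logDerivSpeed waveSpeed
  have h3 := Real.sqrt_pos.2 hpos
  have h4 := Real.mul_self_sqrt hpos.le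
  set r := Real.sqrt (K1 * Real.sin p ^ 2 + K3 * Real.cos p ^ 2)
  rw [← h4]
  field_simp

lemma deriv_waveSpeed (hK1 : 0 < K1) (hK3 : 0 < K3) (p : ℝ) :
    deriv (waveSpeed K1 K3) p = logDerivSpeed K1 K3 p * waveSpeed K1 K3 p :=
  (hasDerivAt_waveSpeed hK1 hK3 p).deriv

end WaveSpeed

/-! ### The first-order system in Riemann variables. -/

/-- The characteristic speeds of the first-order system for
`(ψ, s, ψₜ + c ψₓ, ψₜ - c ψₓ, sₜ + c sₓ, sₜ - c sₓ)`. -/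
noncomputable def charSpeed (K1 K3 : ℝ) (i : Fin 6) (u : Fin 6 → ℝ) : ℝ :=
  ![0, 0, -waveSpeed K1 K3 (u 0), waveSpeed K1 K3 (u 0), -waveSpeed K1 K3 (u 0),
    waveSpeed K1 K3 (u 0)] i

/-- The right-hand sides of the first-order system, multiplied by `s²`. -/
noncomputable def numer (K1 K3 : ℝ) (W : ℝ → ℝ) (i : Fin 6) (u : Fin 6 → ℝ) : ℝ :=
  ![u 1 ^ 2 * ((u 2 + u 3) / 2),
    u 1 ^ 2 * ((u 4 + u 5) / 2),
    -u 1 * (u 2 * u 5 + u 3 * u 4) - logDerivSpeed K1 K3 (u 0) * (u 4 - u 5) ^ 2 / 4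
      + u 1 ^ 2 * (logDerivSpeed K1 K3 (u 0) * (u 2 ^ 2 - u 3 ^ 2) / 4),
    -u 1 * (u 2 * u 5 + u 3 * u 4) - logDerivSpeed K1 K3 (u 0) * (u 4 - u 5) ^ 2 / 4
      - u 1 ^ 2 * (logDerivSpeed K1 K3 (u 0) * (u 2 ^ 2 - u 3 ^ 2) / 4),
    u 1 ^ 2 * (logDerivSpeed K1 K3 (u 0) * (u 2 - u 3) * (u 4 - u 5) / 4 + u 1 * u 2 * u 3
      - deriv W (u 1) + logDerivSpeed K1 K3 (u 0) * (u 2 + u 3) * (u 4 - u 5) / 4),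
    u 1 ^ 2 * (logDerivSpeed K1 K3 (u 0) * (u 2 - u 3) * (u 4 - u 5) / 4 + u 1 * u 2 * u 3
      - deriv W (u 1) - logDerivSpeed K1 K3 (u 0) * (u 2 + u 3) * (u 4 - u 5) / 4)] i

section Smooth

variable {K1 K3 : ℝ} {W : ℝ → ℝ}

lemma contDiff_charSpeed (hK1 : 0 < K1) (hK3 : 0 < K3) {n : WithTop ℕ∞} (i : Fin 6) :
    ContDiff ℝ n (charSpeed K1 K3 i) := by
  have h0 : ContDiff ℝ n fun u : Fin 6 → ℝ => waveSpeed K1 K3 (u 0) :=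
    (contDiff_waveSpeed hK1 hK3).comp (contDiff_apply ℝ ℝ 0)
  fin_cases i
  exacts [contDiff_const, contDiff_const, h0.neg, h0, h0.neg, h0]

lemma abs_charSpeed_le (hK1 : 0 < K1) (hK3 : 0 < K3) (i : Fin 6) (u : Fin 6 → ℝ) :
    |charSpeed K1 K3 i u| ≤ Real.sqrt (K1 + K3) := by
  have h1 := waveSpeed_pos hK1 hK3 (u 0)
  have h2 := waveSpeed_le hK1 hK3 (u 0)
  have h3 := Real.sqrt_nonneg (K1 + K3)
  fin_cases i <;> simp [charSpeed, abs_of_pos h1, h2, h3]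

lemma contDiffAt_deriv {σ : ℝ} (hW : ContDiffOn ℝ 4 W (Ioo (-1 / 2 : ℝ) 1))
    (hσ : σ ∈ Ioo (-1 / 2 : ℝ) 1) : ContDiffAt ℝ 3 (deriv W) σ := by
  have h1 : ContDiffOn ℝ 3 (deriv W) (Ioo (-1 / 2 : ℝ) 1) :=
    ((contDiffOn_succ_iff_deriv_of_isOpen (n := 3) isOpen_Ioo).1 (hW.of_le (by norm_num))).2.2
  exact (h1 σ hσ).contDiffAt (isOpen_Ioo.mem_nhds hσ)

lemma contDiffAt_numer (hK1 : 0 < K1) (hK3 : 0 < K3)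
    (hW : ContDiffOn ℝ 4 W (Ioo (-1 / 2 : ℝ) 1)) {u : Fin 6 → ℝ}
    (hu : u 1 ∈ Ioo (-1 / 2 : ℝ) 1) (i : Fin 6) :
    ContDiffAt ℝ 2 (numer K1 K3 W i) u := by
  have hp : ∀ j, ContDiffAt ℝ 2 (fun u : Fin 6 → ℝ => u j) u := fun j =>
    (contDiff_apply ℝ ℝ j).contDiffAt
  have h0 := hp 0
  have h1 := hp 1
  have h2 := hp 2
  have h3 := hp 3
  have h4 := hp 4
  have h5 := hp 5
  have hκ : ContDiffAt ℝ 2 (fun u : Fin 6 → ℝ => logDerivSpeed K1 K3 (u 0)) u :=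
    ((contDiff_logDerivSpeed hK1 hK3).comp (contDiff_apply ℝ ℝ 0)).contDiffAt
  have hW' : ContDiffAt ℝ 2 (fun u : Fin 6 → ℝ => deriv W (u 1)) u :=
    ContDiffAt.comp u
      (f := fun u : Fin 6 → ℝ => u 1) ((contDiffAt_deriv hW hu).of_le (by norm_num)) h1
  have key : ContDiffAt ℝ 2 (fun u i => numer K1 K3 W i u) u := by
    refine contDiffAt_pi.2 fun i => ?_
    fin_cases i
    · exact (h1.pow 2).mul ((h2.add h3).div_const 2)
    · exact (h1.pow 2).mul ((h4.add h5).div_const 2)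
    · exact ((h1.neg.mul ((h2.mul h5).add (h3.mul h4))).sub
        ((hκ.mul ((h4.sub h5).pow 2)).div_const 4)).add ((h1.pow 2).mul
          ((hκ.mul ((h2.pow 2).sub (h3.pow 2))).div_const 4))
    · exact ((h1.neg.mul ((h2.mul h5).add (h3.mul h4))).sub
        ((hκ.mul ((h4.sub h5).pow 2)).div_const 4)).sub ((h1.pow 2).mul
          ((hκ.mul ((h2.pow 2).sub (h3.pow 2))).div_const 4))
    · exact (h1.pow 2).mul ((((((hκ.mul (h2.sub h3)).mul (h4.sub h5)).div_const 4).add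
        ((h1.mul h2).mul h3)).sub hW').add (((hκ.mul (h2.add h3)).mul (h4.sub h5)).div_const 4))
    · exact (h1.pow 2).mul ((((((hκ.mul (h2.sub h3)).mul (h4.sub h5)).div_const 4).add
        ((h1.mul h2).mul h3)).sub hW').sub (((hκ.mul (h2.add h3)).mul (h4.sub h5)).div_const 4))
  exact contDiffAt_pi.1 key i

end Smooth

/-! ### From classical solutions to the first-order system, and uniqueness. -/

section Classical

variable {K1 K3 : ℝ} {W : ℝ → ℝ} {T : ℝ} {ψ s f : ℝ → ℝ → ℝ}

/-- This is the factorisation of the wave operator, with `ε = ±1` and `f` either `ψ` or `s`. The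
mixed derivatives cancel by `dx_dt_comm`, and differentiating the coefficient `c(ψ)` in time leaves
the single term `ε c'(ψ) ψₜ fₓ`, of first order only. -/
lemma dt_add_mul_dx (hK1 : 0 < K1) (hK3 : 0 < K3) (hT : 0 < T) {ε : ℝ} (hε : ε ^ 2 = 1)
    (hψ : ContDiffOn ℝ 2 (fun z : ℝ × ℝ => ψ z.1 z.2) (strip T))
    (hf : ContDiffOn ℝ 2 (fun z : ℝ × ℝ => f z.1 z.2) (strip T)) {t x : ℝ} (ht : t ∈ Icc 0 T) :
    dt T (fun t x => dt T f t x + ε * (waveSpeed K1 K3 (ψ t x) * dx f t x)) t x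
      - ε * waveSpeed K1 K3 (ψ t x) *
        dx (fun t x => dt T f t x + ε * (waveSpeed K1 K3 (ψ t x) * dx f t x)) t x
      = dt T (dt T f) t x
        - waveSpeed K1 K3 (ψ t x) * dx (fun t y => waveSpeed K1 K3 (ψ t y) * dx f t y) t x
        + ε * (logDerivSpeed K1 K3 (ψ t x) * waveSpeed K1 K3 (ψ t x) * dt T ψ t x * dx f t x) := by
  have hft := contDiffOn_dt (n := 1) hT (by norm_num; exact hf)
  have hfx := contDiffOn_dx (n := 1) hT (by norm_num; exact hf)
  have a1 := hasFDerivWithinAt_strip hT hft (x := x) ht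
  have a2 := hasFDerivWithinAt_strip hT hfx (x := x) ht
  have a3 := hasFDerivWithinAt_strip hT (hψ.of_le one_le_two) (x := x) ht
  have hc : ∀ p, HasDerivAt (waveSpeed K1 K3) _ p := hasDerivAt_waveSpeed hK1 hK3
  have t1 := hasDerivWithinAt_fst a1
  have t2 := hasDerivWithinAt_fst a2
  have t3 := (hc (ψ t x)).comp_hasDerivWithinAt t (hasDerivWithinAt_fst a3)
  have x1 := hasDerivAt_snd ht a1
  have x2 := hasDerivAt_snd ht a2
  have x3 := (hc (ψ t x)).comp x (hasDerivAt_snd ht a3)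
  have eT := dt_eq_of_hasDerivWithinAt
    (f := fun t x => dt T f t x + ε * (waveSpeed K1 K3 (ψ t x) * dx f t x)) hT ht
    (t1.add ((t3.mul t2).const_mul ε))
  have eX : dx (fun t x => dt T f t x + ε * (waveSpeed K1 K3 (ψ t x) * dx f t x)) t x = _ :=
    (x1.add ((x3.mul x2).const_mul ε)).deriv
  have eC : dx (fun t y => waveSpeed K1 K3 (ψ t y) * dx f t y) t x = _ := (x3.mul x2).deriv
  rw [eT, eX, eC, ← dx_dt_comm hT hf ht]
  simp only [linForm_apply, Function.comp]
  linear_combination (-waveSpeed K1 K3 (ψ t x) * (logDerivSpeed K1 K3 (ψ t x) *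
    waveSpeed K1 K3 (ψ t x) * dx ψ t x * dx f t x + waveSpeed K1 K3 (ψ t x) * dx (dx f) t x)) * hε

/-- The unknowns of the first-order system attached to a pair `(ψ, s)`. -/
noncomputable def riemannState (K1 K3 T : ℝ) (ψ s : ℝ → ℝ → ℝ) (t x : ℝ) : Fin 6 → ℝ :=
  ![ψ t x, s t x,
    dt T ψ t x + 1 * (waveSpeed K1 K3 (ψ t x) * dx ψ t x),
    dt T ψ t x + (-1) * (waveSpeed K1 K3 (ψ t x) * dx ψ t x),
    dt T s t x + 1 * (waveSpeed K1 K3 (ψ t x) * dx s t x),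
    dt T s t x + (-1) * (waveSpeed K1 K3 (ψ t x) * dx s t x)]

lemma contDiffOn_riemannState (hK1 : 0 < K1) (hK3 : 0 < K3) (hT : 0 < T)
    (h : IsClassicalSolution K1 K3 W T ψ s) :
    ContDiffOn ℝ 1 (fun z : ℝ × ℝ => riemannState K1 K3 T ψ s z.1 z.2) (strip T) := by
  have hψ := h.contDiff_psi.of_le one_le_two
  have hs := h.contDiff_s.of_le one_le_two
  have hc : ContDiffOn ℝ 1 (fun z : ℝ × ℝ => waveSpeed K1 K3 (ψ z.1 z.2)) (strip T) :=
    (contDiff_waveSpeed hK1 hK3).comp_contDiffOn hψ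
  have h1 := contDiffOn_dt (n := 1) hT (by norm_num; exact h.contDiff_psi)
  have h2 := contDiffOn_dx (n := 1) hT (by norm_num; exact h.contDiff_psi)
  have h3 := contDiffOn_dt (n := 1) hT (by norm_num; exact h.contDiff_s)
  have h4 := contDiffOn_dx (n := 1) hT (by norm_num; exact h.contDiff_s)
  refine contDiffOn_pi.2 fun i => ?_
  fin_cases i
  · exact hψ
  · exact hs
  · exact h1.add (contDiffOn_const.mul (hc.mul h2))
  · exact h1.add (contDiffOn_const.mul (hc.mul h2))
  · exact h3.add (contDiffOn_const.mul (hc.mul h4))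
  · exact h3.add (contDiffOn_const.mul (hc.mul h4))

lemma fderivWithin_strip_pi_apply {ι : Type*} [Fintype ι] (hT : 0 < T) {U : ℝ → ℝ → ι → ℝ}
    (hU : ContDiffOn ℝ 1 (fun z : ℝ × ℝ => U z.1 z.2) (strip T)) {z : ℝ × ℝ} (hz : z ∈ strip T)
    (w : ℝ × ℝ) (i : ι) : fderivWithin ℝ (fun z : ℝ × ℝ => U z.1 z.2) (strip T) z w i
      = dt T (fun t x => U t x i) z.1 z.2 * w.1 + dx (fun t x => U t x i) z.1 z.2 * w.2 := by
  have hi := contDiffOn_pi.1 hU i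
  have h1 := hasFDerivWithinAt_pi'.1
    (hU.differentiableOn one_ne_zero z hz).hasFDerivWithinAt i
  rw [← fderivWithin_strip_apply (f := fun t x => U t x i) hT hi hz w,
    h1.fderivWithin (uniqueDiffOn_strip hT z hz)]
  rfl

/-- A classical solution satisfies the first-order system. -/
lemma riemannState_eq (hK1 : 0 < K1) (hK3 : 0 < K3) (hT : 0 < T)
    (h : IsClassicalSolution K1 K3 W T ψ s) {z : ℝ × ℝ} (hz : z ∈ strip T) (i : Fin 6) :
    riemannState K1 K3 T ψ s z.1 z.2 1 ^ 2 *
      fderivWithin ℝ (fun z : ℝ × ℝ => riemannState K1 K3 T ψ s z.1 z.2) (strip T) z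
        (1, charSpeed K1 K3 i (riemannState K1 K3 T ψ s z.1 z.2)) i
      = numer K1 K3 W i (riemannState K1 K3 T ψ s z.1 z.2) := by
  rw [fderivWithin_strip_pi_apply hT (contDiffOn_riemannState hK1 hK3 hT h) hz]
  have e1 := h.eq_psi z.1 hz.1 z.2
  have e2 := h.eq_s z.1 hz.1 z.2
  rw [deriv_waveSpeed hK1 hK3] at e1 e2
  have a1 := dt_add_mul_dx hK1 hK3 hT (ε := 1) (by norm_num) h.contDiff_psi h.contDiff_psi
    (x := z.2) hz.1
  have a2 := dt_add_mul_dx hK1 hK3 hT (ε := -1) (by norm_num) h.contDiff_psi h.contDiff_psi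
    (x := z.2) hz.1
  have a3 := dt_add_mul_dx hK1 hK3 hT (ε := 1) (by norm_num) h.contDiff_psi h.contDiff_s
    (x := z.2) hz.1
  have a4 := dt_add_mul_dx hK1 hK3 hT (ε := -1) (by norm_num) h.contDiff_psi h.contDiff_s
    (x := z.2) hz.1
  fin_cases i
  · simp [charSpeed, numer, riemannState]
    left
    change dt T ψ _ _ = _
    ring
  · simp [charSpeed, numer, riemannState]
    left
    change dt T s _ _ = _
    ring
  -- The literal factors `1` and `(-1)` in `riemannState` match `ε` in `dt_add_mul_dx`, so the state
  -- component unfolds to exactly the function treated there.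
  · change s z.1 z.2 ^ 2 * (dt T (fun t x => dt T ψ t x + 1 * (waveSpeed K1 K3 (ψ t x) * dx ψ t x))
      z.1 z.2 * 1 + dx (fun t x => dt T ψ t x + 1 * (waveSpeed K1 K3 (ψ t x) * dx ψ t x))
      z.1 z.2 * (-waveSpeed K1 K3 (ψ z.1 z.2))) = _
    simp [numer, riemannState] at a1 ⊢
    linear_combination e1 + s z.1 z.2 ^ 2 * a1
  · change s z.1 z.2 ^ 2 * (dt T (fun t x => dt T ψ t x + (-1) * (waveSpeed K1 K3 (ψ t x) * dx ψ t x))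
      z.1 z.2 * 1 + dx (fun t x => dt T ψ t x + (-1) * (waveSpeed K1 K3 (ψ t x) * dx ψ t x))
      z.1 z.2 * (waveSpeed K1 K3 (ψ z.1 z.2))) = _
    simp [numer, riemannState] at a2 ⊢
    linear_combination e1 + s z.1 z.2 ^ 2 * a2
  · change s z.1 z.2 ^ 2 * (dt T (fun t x => dt T s t x + 1 * (waveSpeed K1 K3 (ψ t x) * dx s t x))
      z.1 z.2 * 1 + dx (fun t x => dt T s t x + 1 * (waveSpeed K1 K3 (ψ t x) * dx s t x))
      z.1 z.2 * (-waveSpeed K1 K3 (ψ z.1 z.2))) = _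
    simp [numer, riemannState] at a3 ⊢
    left
    linear_combination e2 + a3
  · change s z.1 z.2 ^ 2 * (dt T (fun t x => dt T s t x + (-1) * (waveSpeed K1 K3 (ψ t x) * dx s t x))
      z.1 z.2 * 1 + dx (fun t x => dt T s t x + (-1) * (waveSpeed K1 K3 (ψ t x) * dx s t x))
      z.1 z.2 * (waveSpeed K1 K3 (ψ z.1 z.2))) = _
    simp [numer, riemannState] at a4 ⊢
    left
    linear_combination e2 + a4

/-- Classical solutions are determined by their initial data as long as `s` does not vanish. -/
theorem IsClassicalSolution.unique (hK1 : 0 < K1) (hK3 : 0 < K3)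
    (hW : ContDiffOn ℝ 4 W (Ioo (-1 / 2 : ℝ) 1)) {ψ0 ψt0 s0 st0 : ℝ → ℝ} {T' : ℝ}
    (hT : 0 < T) (hT' : 0 < T') {ψ' s' : ℝ → ℝ → ℝ}
    (h : IsClassicalSolution K1 K3 W T ψ s) (hi : HasInitialData T ψ0 ψt0 s0 st0 ψ s)
    (hs : ∀ t ∈ Icc 0 T, ∀ x, s t x ≠ 0)
    (h' : IsClassicalSolution K1 K3 W T' ψ' s') (hi' : HasInitialData T' ψ0 ψt0 s0 st0 ψ' s') :
    ∀ t ∈ Icc 0 (min T T'), ∀ x, ψ' t x = ψ t x ∧ s' t x = s t x := by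
  have hm : 0 < min T T' := lt_min hT hT'
  have hsub : strip (min T T') ⊆ strip T :=
    prod_mono (Icc_subset_Icc_right (min_le_left _ _)) le_rfl
  have hsub' : strip (min T T') ⊆ strip T' :=
    prod_mono (Icc_subset_Icc_right (min_le_right _ _)) le_rfl
  have hO : IsOpen {u : Fin 6 → ℝ | u 1 ∈ Ioo (-1 / 2 : ℝ) 1} :=
    isOpen_Ioo.preimage (continuous_apply 1)
  have c1 := contDiffOn_riemannState hK1 hK3 hT h
  have c2 := contDiffOn_riemannState hK1 hK3 hT' h'
  -- The open set `O` contains states with `u 1 = 0`, as it must for the second solution; the weight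
  -- `u 1 ^ 2` is nonzero only along the first one.
  have key := quasilinear_unique hO (lam := charSpeed K1 K3) (H := numer K1 K3 W)
    (m := fun u => u 1 ^ 2) (fun i => (contDiff_charSpeed hK1 hK3 i).contDiffOn)
    (fun i u hu => ((contDiffAt_numer hK1 hK3 hW hu i).of_le one_le_two).contDiffWithinAt)
    ((contDiff_apply ℝ ℝ (1 : Fin 6)).pow 2).contDiffOn (Real.sqrt_nonneg (K1 + K3))
    (fun i u _ => abs_charSpeed_le hK1 hK3 i u) hm
    (U := fun z => riemannState K1 K3 T ψ s z.1 z.2)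
    (V := fun z => riemannState K1 K3 T' ψ' s' z.1 z.2)
    (c1.mono hsub) (c2.mono hsub')
    (fun z hz => h.range_s z.1 (hsub hz).1 z.2) (fun z hz => h'.range_s z.1 (hsub' hz).1 z.2)
    (fun z hz => pow_ne_zero 2 (hs z.1 (hsub hz).1 z.2))
    (fun z hz i => by
      rw [fderivWithin_subset hsub (uniqueDiffOn_strip hm z hz)
        (c1.differentiableOn one_ne_zero z (hsub hz))]
      exact riemannState_eq hK1 hK3 hT h (hsub hz) i)
    (fun z hz i => by
      rw [fderivWithin_subset hsub' (uniqueDiffOn_strip hm z hz)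
        (c2.differentiableOn one_ne_zero z (hsub' hz))]
      exact riemannState_eq hK1 hK3 hT' h' (hsub' hz) i)
    (fun x => by
      have e1 : ψ 0 = ψ' 0 := funext fun x => (hi.init_psi x).trans (hi'.init_psi x).symm
      have e2 : s 0 = s' 0 := funext fun x => (hi.init_s x).trans (hi'.init_s x).symm
      simp only [riemannState, dx, hi.init_psi_t, hi'.init_psi_t, hi.init_s_t, hi'.init_s_t, e1,
        e2])
  intro t ht x
  have hz := key (t, x) ⟨ht, mem_univ _⟩
  exact ⟨(congrFun hz 0).symm, (congrFun hz 1).symm⟩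

end Classical

/-! ### Regularity of solutions of the quasilinear system. -/

lemma continuousInSup_of_le {V : Type*} [NormedAddCommGroup V] {T C : ℝ} {f : ℝ → ℝ → V}
    {g : ℝ → ℝ → ℝ} (hC : 0 ≤ C) (hb : ∀ t ∈ Icc 0 T, ∃ M : ℝ, ∀ x, |g t x| ≤ M)
    (hg : ∀ t ∈ Icc 0 T, ∀ t' ∈ Icc 0 T, ∀ x, |g t' x - g t x| ≤ C * ‖f t' x - f t x‖)
    (hf : ∀ t ∈ Icc 0 T, ∀ ε > 0, ∃ δ > 0, ∀ t' ∈ Icc 0 T, |t' - t| < δ →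
      ∀ x, ‖f t' x - f t x‖ ≤ ε) : ContinuousInSup T g := by
  refine ⟨hb, fun t ht ε hε => ?_⟩
  obtain ⟨δ, hδ, H⟩ := hf t ht (ε / (C + 1)) (by positivity)
  refine ⟨δ, hδ, fun t' ht' h x => (hg t ht t' ht' x).trans ?_⟩
  calc C * ‖f t' x - f t x‖ ≤ C * (ε / (C + 1)) := by gcongr; exact H t' ht' h x
    _ ≤ ε := by rw [mul_div_assoc', div_le_iff₀ (by positivity)]; nlinarith

/-- A solution of a diagonal quasilinear system with values in `Ω` which is Lipschitz in time and
`C^{1,1}` in space. -/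
structure QuasilinearSolution {ι : Type*} [Fintype ι] (lam F : ι → (ι → ℝ) → ℝ) (Ω : Set (ι → ℝ))
    (T A B M : ℝ) (u : ℝ → ℝ → ι → ℝ) : Prop where
  T_pos : 0 < T
  isC11 : ∀ t ∈ Icc 0 T, IsC11 A B (u t)
  mem : ∀ t ∈ Icc 0 T, ∀ x, u t x ∈ Ω
  lipschitz : ∀ t ∈ Icc 0 T, ∀ t' ∈ Icc 0 T, ∀ x, ‖u t' x - u t x‖ ≤ M * |t' - t|
  hasDeriv : ∀ t ∈ Icc 0 T, ∀ x i, HasDerivWithinAt (fun τ => u τ x i)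
    (-lam i (u t x) * deriv (u t) x i + F i (u t x)) (Icc 0 T) t

namespace QuasilinearSolution

variable {ι : Type*} [Fintype ι] {lam F : ι → (ι → ℝ) → ℝ} {Ω : Set (ι → ℝ)} {L T A B M : ℝ}
  {u : ℝ → ℝ → ι → ℝ}

lemma exists_close (Q : QuasilinearSolution lam F Ω T A B M u) {t : ℝ} (ht : t ∈ Icc 0 T) {ε : ℝ}
    (hε : 0 < ε) : ∃ δ > 0, ∀ t' ∈ Icc 0 T, |t' - t| < δ → ∀ x,
      ‖((u t' x, deriv (u t') x) : (ι → ℝ) × (ι → ℝ)) - (u t x, deriv (u t) x)‖ ≤ ε := by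
  obtain ⟨δ, hδ, H⟩ := continuousOn_deriv_of_isC11 Q.isC11 Q.lipschitz ht hε
  refine ⟨min δ (ε / (|M| + 1)), by positivity, fun t' ht' h x => ?_⟩
  rw [lt_min_iff] at h
  rw [Prod.mk_sub_mk, Prod.norm_mk]
  refine max_le ((Q.lipschitz t ht t' ht' x).trans ?_) (H t' ht' h.1 x)
  have h2 := h.2
  rw [lt_div_iff₀ (by positivity)] at h2
  calc M * |t' - t| ≤ (|M| + 1) * |t' - t| := by
        gcongr; linarith [le_abs_self M]
    _ ≤ ε := by linarith

lemma continuousOn_prod (Q : QuasilinearSolution lam F Ω T A B M u) :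
    ContinuousOn (fun z : ℝ × ℝ => ((u z.1 z.2, deriv (u z.1) z.2) : (ι → ℝ) × (ι → ℝ)))
      (strip T) := by
  rw [Metric.continuousOn_iff]
  rintro ⟨t, x⟩ ⟨ht, -⟩ ε hε
  obtain ⟨δ, hδ, H⟩ := Q.exists_close ht (half_pos hε)
  obtain ⟨hA, hB⟩ := (Q.isC11 t ht).nonneg
  refine ⟨min δ (ε / 2 / (A + B + 1)), by positivity, ?_⟩
  rintro ⟨t', x'⟩ ⟨ht', -⟩ h
  rw [Prod.dist_eq, max_lt_iff, lt_min_iff, lt_min_iff] at h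
  have h1 := H t' ht' h.1.1 x'
  have h2 : ‖((u t x', deriv (u t) x') : (ι → ℝ) × (ι → ℝ)) - (u t x, deriv (u t) x)‖
      ≤ (A + B) * |x' - x| := by
    rw [Prod.mk_sub_mk, Prod.norm_mk]
    refine max_le (((Q.isC11 t ht).norm_sub_le x' x).trans ?_)
      (((Q.isC11 t ht).deriv_lip x' x).trans ?_) <;> gcongr <;> linarith
  have h3 : (A + B) * |x' - x| < ε / 2 := by
    have := h.2.2
    rw [lt_div_iff₀ (by positivity), Real.dist_eq] at this
    have h0 : 0 ≤ |x' - x| := abs_nonneg _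
    have h00 : (A + B) * |x' - x| ≤ |x' - x| * (A + B + 1) := by nlinarith
    linarith
  rw [dist_eq_norm]
  have := norm_sub_le_norm_sub_add_norm_sub
    ((u t' x', deriv (u t') x') : (ι → ℝ) × (ι → ℝ)) (u t x', deriv (u t) x')
    (u t x, deriv (u t) x)
  simp only at *
  linarith

lemma hasDerivAt_apply (Q : QuasilinearSolution lam F Ω T A B M u) {t : ℝ} (ht : t ∈ Icc 0 T)
    (x : ℝ) (i : ι) : HasDerivAt (fun y => u t y i) (deriv (u t) x i) x :=
  hasDerivAt_pi.1 ((Q.isC11 t ht).diff x).hasDerivAt i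

lemma continuousOn_apply (Q : QuasilinearSolution lam F Ω T A B M u) (i : ι) :
    ContinuousOn (fun z : ℝ × ℝ => u z.1 z.2 i) (strip T) :=
  (continuous_apply i).comp_continuousOn (continuous_fst.comp_continuousOn Q.continuousOn_prod)

lemma continuousOn_deriv_apply (Q : QuasilinearSolution lam F Ω T A B M u) (i : ι) :
    ContinuousOn (fun z : ℝ × ℝ => deriv (u z.1) z.2 i) (strip T) :=
  (continuous_apply i).comp_continuousOn (continuous_snd.comp_continuousOn Q.continuousOn_prod)

lemma continuousOn_comp (Q : QuasilinearSolution lam F Ω T A B M u) {G : (ι → ℝ) → ℝ}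
    (hG : IsC11On L Ω G) : ContinuousOn (fun z : ℝ × ℝ => G (u z.1 z.2)) (strip T) :=
  fun z hz => ContinuousAt.comp_continuousWithinAt (f := fun z : ℝ × ℝ => u z.1 z.2)
    (hG.diff _ (Q.mem z.1 hz.1 z.2)).continuousAt
    ((continuous_fst.comp_continuousOn Q.continuousOn_prod) z hz)

lemma contDiffOn (Q : QuasilinearSolution lam F Ω T A B M u) (hlam : ∀ i, IsC11On L Ω (lam i))
    (hF : ∀ i, IsC11On L Ω (F i)) (i : ι) :
    ContDiffOn ℝ 1 (fun z : ℝ × ℝ => u z.1 z.2 i) (strip T) := by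
  have := contDiffOn_succ_of_partial (n := 0) (f := fun t x => u t x i) Q.T_pos
    (fun t ht x => Q.hasDeriv t ht x i) (fun t ht x => Q.hasDerivAt_apply ht x i)
    (contDiffOn_zero.2 (((Q.continuousOn_comp (hlam i)).neg.mul
      (Q.continuousOn_deriv_apply i)).add (Q.continuousOn_comp (hF i))))
    (contDiffOn_zero.2 (Q.continuousOn_deriv_apply i))
  simpa using this

/-- The subtracted function `h` is there for `ψ - ψ₀`: `ψ₀` may be unbounded although its
derivatives are bounded. The time derivative is read off from the equation, and its continuity in
time comes from that of the pair `(u, deriv u)` in the supremum norm. -/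
lemma inSolutionSpace (Q : QuasilinearSolution lam F Ω T A B M u)
    (hΩ : Convex ℝ Ω) (hlam : ∀ i, IsC11On L Ω (lam i))
    (hF : ∀ i, IsC11On L Ω (F i)) (l : (ι → ℝ) →L[ℝ] ℝ) {a b N : ℝ} {h : ℝ → ℝ} (hh : IsC11 a b h)
    (hN : ∀ x, |l (u 0 x) - h x| ≤ N) : InSolutionSpace T fun t x => l (u t x) - h x := by
  have h0T : (0 : ℝ) ∈ Icc 0 T := ⟨le_rfl, Q.T_pos.le⟩
  have hA := (Q.isC11 0 h0T).nonneg.1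
  have hL : ∀ i : ι, 0 ≤ L := fun i => (abs_nonneg _).trans ((hF i).le _ (Q.mem 0 h0T 0))
  have hl := norm_nonneg l
  have hdx : ∀ t ∈ Icc 0 T, ∀ x, dx (fun t x => l (u t x) - h x) t x
      = l (deriv (u t) x) - deriv h x := fun t ht x =>
    ((l.hasFDerivAt.comp_hasDerivAt x ((Q.isC11 t ht).diff x).hasDerivAt).sub
      (hh.diff x).hasDerivAt).deriv
  set v : ℝ → ℝ → ι → ℝ := fun t x i => -lam i (u t x) * deriv (u t) x i + F i (u t x) with hv
  have hdt : ∀ t ∈ Icc 0 T, ∀ x, dt T (fun t x => l (u t x) - h x) t x = l (v t x) := by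
    intro t ht x
    refine dt_eq_of_hasDerivWithinAt Q.T_pos ht ?_
    have h1 : HasDerivWithinAt (fun τ => u τ x) (v t x) (Icc 0 T) t :=
      hasDerivWithinAt_pi.2 fun i => Q.hasDeriv t ht x i
    exact (l.hasFDerivAt.comp_hasDerivWithinAt t h1).sub_const _
  have hdi : ∀ t ∈ Icc 0 T, ∀ x i, |deriv (u t) x i| ≤ A := fun t ht x i =>
    (norm_le_pi_norm _ i).trans ((Q.isC11 t ht).deriv_le x)
  refine ⟨?_, ?_, ?_⟩
  · refine continuousInSup_of_le (C := ‖l‖) (f := fun t x =>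
      ((u t x, deriv (u t) x) : (ι → ℝ) × (ι → ℝ))) hl (fun t ht => ?_)
      (fun t ht t' ht' x => ?_) (fun t ht ε hε => Q.exists_close ht hε)
    · refine ⟨‖l‖ * (M * |t - 0|) + N, fun x => ?_⟩
      have e : l (u t x) - h x = l (u t x - u 0 x) + (l (u 0 x) - h x) := by rw [map_sub]; ring
      rw [e]
      refine (abs_add_le _ _).trans (add_le_add ?_ (hN x))
      exact (l.le_opNorm _).trans (mul_le_mul_of_nonneg_left (Q.lipschitz 0 h0T t ht x) hl)
    · have e : l (u t' x) - h x - (l (u t x) - h x) = l (u t' x - u t x) := by rw [map_sub]; ring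
      rw [e]
      refine (l.le_opNorm _).trans (mul_le_mul_of_nonneg_left ?_ hl)
      exact norm_fst_le (((u t' x, deriv (u t') x) : (ι → ℝ) × (ι → ℝ)) - (u t x, deriv (u t) x))
  · refine continuousInSup_of_le (C := ‖l‖) (f := fun t x =>
      ((u t x, deriv (u t) x) : (ι → ℝ) × (ι → ℝ))) hl (fun t ht => ?_)
      (fun t ht t' ht' x => ?_) (fun t ht ε hε => Q.exists_close ht hε)
    · refine ⟨‖l‖ * A + a, fun x => ?_⟩
      rw [hdx t ht]
      refine (abs_sub _ _).trans (add_le_add ?_ (hh.deriv_le x))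
      exact (l.le_opNorm _).trans (mul_le_mul_of_nonneg_left ((Q.isC11 t ht).deriv_le x) hl)
    · rw [hdx t ht, hdx t' ht']
      have e : l (deriv (u t') x) - deriv h x - (l (deriv (u t) x) - deriv h x)
        = l (deriv (u t') x - deriv (u t) x) := by rw [map_sub]; ring
      rw [e]
      refine (l.le_opNorm _).trans (mul_le_mul_of_nonneg_left ?_ hl)
      exact norm_snd_le (((u t' x, deriv (u t') x) : (ι → ℝ) × (ι → ℝ)) - (u t x, deriv (u t) x))
  · refine continuousInSup_of_le (C := ‖l‖ * (|L| + |L| * A + |L|)) (f := fun t x =>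
      ((u t x, deriv (u t) x) : (ι → ℝ) × (ι → ℝ))) (by positivity) (fun t ht => ?_)
      (fun t ht t' ht' x => ?_) (fun t ht ε hε => Q.exists_close ht hε)
    · refine ⟨‖l‖ * (|L| * A + |L|), fun x => ?_⟩
      rw [hdt t ht]
      refine (l.le_opNorm _).trans (mul_le_mul_of_nonneg_left ?_ hl)
      refine (pi_norm_le_iff_of_nonneg (by positivity)).2 fun i => ?_
      rw [abs_of_nonneg (hL i), Real.norm_eq_abs]
      refine (abs_add_le _ _).trans (add_le_add ?_ ((hF i).le _ (Q.mem t ht x)))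
      rw [abs_mul, abs_neg]
      exact mul_le_mul ((hlam i).le _ (Q.mem t ht x)) (hdi t ht x i) (abs_nonneg _) (hL i)
    · rw [hdt t ht, hdt t' ht', ← map_sub, mul_assoc]
      refine (l.le_opNorm _).trans (mul_le_mul_of_nonneg_left ?_ hl)
      refine (pi_norm_le_iff_of_nonneg (by positivity)).2 fun i => ?_
      rw [abs_of_nonneg (hL i), Real.norm_eq_abs, Pi.sub_apply]
      have hLi := hL i
      set d := ‖((u t' x, deriv (u t') x) : (ι → ℝ) × (ι → ℝ)) - (u t x, deriv (u t) x)‖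
      have d1 : ‖u t' x - u t x‖ ≤ d :=
        norm_fst_le (((u t' x, deriv (u t') x) : (ι → ℝ) × (ι → ℝ)) - (u t x, deriv (u t) x))
      have d2 : |deriv (u t') x i - deriv (u t) x i| ≤ d :=
        (norm_le_pi_norm (deriv (u t') x - deriv (u t) x) i).trans
        (norm_snd_le (((u t' x, deriv (u t') x) : (ι → ℝ) × (ι → ℝ)) - (u t x, deriv (u t) x)))
      have e1 := ((hlam i).abs_sub_le hΩ (Q.mem t' ht' x) (Q.mem t ht x)).trans
        (mul_le_mul_of_nonneg_left d1 hLi)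
      have e2 := ((hF i).abs_sub_le hΩ (Q.mem t' ht' x) (Q.mem t ht x)).trans
        (mul_le_mul_of_nonneg_left d1 hLi)
      have e3 := (hlam i).le _ (Q.mem t' ht' x)
      have e4 := hdi t ht x i
      have e : v t' x i - v t x i = -(lam i (u t' x) * (deriv (u t') x i - deriv (u t) x i))
        + -((lam i (u t' x) - lam i (u t x)) * deriv (u t) x i)
        + (F i (u t' x) - F i (u t x)) := by simp only [hv]; ring
      rw [e]
      refine (abs_add_three _ _ _).trans ?_
      rw [abs_neg, abs_neg, abs_mul, abs_mul]
      calc _ ≤ L * d + L * d * A + L * d := by gcongr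
        _ = _ := by ring

end QuasilinearSolution

/-! ### Uniform bounds for the coefficients on boxes of states. -/

/-- A translation leaving `F` invariant leaves its first two derivatives invariant as well. Their
bounds on the compact `K` therefore hold on all of `Ω`, and convexity turns the second-derivative
bound into a Lipschitz bound. -/
lemma isC11On_of_translations {V : Type*} [NormedAddCommGroup V] [NormedSpace ℝ V] {Ω K : Set V}
    {F : V → ℝ} (hΩ : Convex ℝ Ω) (hK : IsCompact K) (hKΩ : K ⊆ Ω)
    (hF : ∀ u ∈ Ω, ContDiffAt ℝ 2 F u)
    (htr : ∀ u ∈ Ω, ∃ e, (∀ v, F (v + e) = F v) ∧ u + e ∈ K) :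
    ∃ L, 0 ≤ L ∧ IsC11On L Ω F := by
  have h1 : ∀ u ∈ Ω, ContDiffAt ℝ 1 (fderiv ℝ F) u := fun u hu =>
    (hF u hu).fderiv_right (by norm_num)
  have h2 : ∀ u ∈ Ω, ContDiffAt ℝ 0 (fderiv ℝ (fderiv ℝ F)) u := fun u hu =>
    (h1 u hu).fderiv_right (by norm_num)
  obtain ⟨C0, hC0⟩ := hK.exists_bound_of_continuousOn (f := F) fun u hu =>
    (hF u (hKΩ hu)).continuousAt.continuousWithinAt
  obtain ⟨C1, hC1⟩ := hK.exists_bound_of_continuousOn (f := fderiv ℝ F) fun u hu =>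
    (h1 u (hKΩ hu)).continuousAt.continuousWithinAt
  obtain ⟨C2, hC2⟩ := hK.exists_bound_of_continuousOn (f := fderiv ℝ (fderiv ℝ F)) fun u hu =>
    (h2 u (hKΩ hu)).continuousAt.continuousWithinAt
  set L := max (max C0 C1) (max C2 0)
  have l0 : C0 ≤ L := (le_max_left _ _).trans (le_max_left _ _)
  have l1 : C1 ≤ L := (le_max_right _ _).trans (le_max_left _ _)
  have l2 : C2 ≤ L := (le_max_left _ _).trans (le_max_right _ _)
  have l3 : 0 ≤ L := (le_max_right _ _).trans (le_max_right _ _)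
  have hp1 : ∀ e, (∀ v, F (v + e) = F v) → ∀ v, fderiv ℝ F (v + e) = fderiv ℝ F v := by
    intro e he v
    rw [← fderiv_comp_add_right]
    congr 1; funext v; exact he v
  have hp2 : ∀ e, (∀ v, F (v + e) = F v) → ∀ v,
      fderiv ℝ (fderiv ℝ F) (v + e) = fderiv ℝ (fderiv ℝ F) v := by
    intro e he v
    rw [← fderiv_comp_add_right]
    congr 1; funext v; exact hp1 e he v
  refine ⟨L, l3, fun u hu => (hF u hu).differentiableAt two_ne_zero, fun u hu => ?_,
    fun u hu => ?_, fun u hu v hv => ?_⟩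
  · obtain ⟨e, he, hK⟩ := htr u hu
    rw [← he u]; exact (hC0 _ hK).trans l0
  · obtain ⟨e, he, hK⟩ := htr u hu
    rw [← hp1 e he u]; exact (hC1 _ hK).trans l1
  · refine hΩ.norm_image_sub_le_of_norm_fderiv_le (f := fderiv ℝ F)
      (fun w hw => (h1 w hw).differentiableAt one_ne_zero) (fun w hw => ?_) hv hu
    obtain ⟨e, he, hK⟩ := htr w hw
    rw [← hp2 e he w]; exact (hC2 _ hK).trans l2

/-- States whose order parameter lies in `[a, b]` and whose Riemann variables are bounded by `N`. -/
def stateBox (a b N : ℝ) : Set (Fin 6 → ℝ) :=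
  {u | u 1 ∈ Icc a b ∧ ∀ j : Fin 6, 2 ≤ j → |u j| ≤ N}

/-- The right-hand sides of the first-order system. -/
noncomputable def source (K1 K3 : ℝ) (W : ℝ → ℝ) (i : Fin 6) (u : Fin 6 → ℝ) : ℝ :=
  numer K1 K3 W i u / u 1 ^ 2

lemma convex_stateBox (a b N : ℝ) : Convex ℝ (stateBox a b N) := by
  intro u hu v hv p q hp hq hpq
  refine ⟨convex_Icc a b hu.1 hv.1 hp hq hpq, fun j hj => ?_⟩
  exact abs_le.2 (convex_Icc (-N) N (abs_le.1 (hu.2 j hj)) (abs_le.1 (hv.2 j hj)) hp hq hpq)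

section

variable {K1 K3 : ℝ} {W : ℝ → ℝ} {a b N : ℝ}

lemma waveSpeed_periodic : Function.Periodic (waveSpeed K1 K3) (2 * Real.pi) := fun p => by
  simp [waveSpeed]

lemma logDerivSpeed_periodic : Function.Periodic (logDerivSpeed K1 K3) (2 * Real.pi) := fun p => by
  simp [logDerivSpeed]

lemma exists_translate_mem_stateBox {u : Fin 6 → ℝ} (hu : u ∈ stateBox a b N) :
    ∃ n : ℤ, u + Pi.single 0 (-(n * (2 * Real.pi))) ∈
      stateBox a b N ∩ {u | u 0 ∈ Icc 0 (2 * Real.pi)} := by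
  have hπ := Real.two_pi_pos
  have h1 := Int.floor_le (u 0 / (2 * Real.pi))
  have h2 := (Int.lt_floor_add_one (u 0 / (2 * Real.pi))).le
  rw [le_div_iff₀ hπ] at h1
  rw [div_le_iff₀ hπ] at h2
  refine ⟨⌊u 0 / (2 * Real.pi)⌋, ⟨?_, fun j hj => ?_⟩, ?_⟩
  · simpa using hu.1
  · have : j ≠ 0 := by rintro rfl; simp at hj
    simpa [this] using hu.2 j hj
  · simp only [mem_ofPred_eq, Pi.add_apply, Pi.single_eq_same]
    constructor <;> linarith

lemma isCompact_stateBox_inter : IsCompact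
    (stateBox a b N ∩ {u | u 0 ∈ Icc 0 (2 * Real.pi)}) := by
  have : stateBox a b N ∩ {u | u 0 ∈ Icc 0 (2 * Real.pi)} = Set.pi univ fun j : Fin 6 =>
      if j = 0 then Icc 0 (2 * Real.pi) else if j = 1 then Icc a b else Icc (-N) N := by
    ext u
    simp only [stateBox, mem_inter_iff, mem_ofPred_eq, mem_univ_pi, Fin.forall_fin_succ, mem_Icc,
      abs_le]
    simp [Fin.le_def, Fin.ext_iff]
    tauto
  rw [this]
  refine isCompact_univ_pi fun j => ?_
  split_ifs <;> exact isCompact_Icc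

/-- The box is unbounded only in the direction of `u 0 = ψ`, on which speeds and sources depend
`2π`-periodically. The hypothesis `h0` makes the division by `u 1 ^ 2` harmless. -/
lemma exists_isC11On (hK1 : 0 < K1) (hK3 : 0 < K3) (hW : ContDiffOn ℝ 4 W (Ioo (-1 / 2 : ℝ) 1))
    (hab : Icc a b ⊆ Ioo (-1 / 2 : ℝ) 1) (h0 : (0 : ℝ) ∉ Icc a b) :
    ∃ L, 0 ≤ L ∧ (∀ i, IsC11On L (stateBox a b N) (charSpeed K1 K3 i)) ∧
      ∀ i, IsC11On L (stateBox a b N) (source K1 K3 W i) := by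
  have key : ∀ G : (Fin 6 → ℝ) → ℝ, (∀ u ∈ stateBox a b N, ContDiffAt ℝ 2 G u) →
      (∀ (n : ℤ) v, G (v + Pi.single 0 (-(n * (2 * Real.pi)))) = G v) →
      ∃ L, 0 ≤ L ∧ IsC11On L (stateBox a b N) G := fun G h1 h2 =>
    isC11On_of_translations (convex_stateBox a b N) isCompact_stateBox_inter inter_subset_left h1
      fun u hu => by
        obtain ⟨n, hn⟩ := exists_translate_mem_stateBox hu
        exact ⟨_, h2 n, hn⟩
  have hper : ∀ (n : ℤ) (v : Fin 6 → ℝ), waveSpeed K1 K3 (v 0 + -(n * (2 * Real.pi)))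
      = waveSpeed K1 K3 (v 0) := fun n v => by
    rw [← sub_eq_add_neg]; exact waveSpeed_periodic.sub_int_mul_eq n
  have hper' : ∀ (n : ℤ) (v : Fin 6 → ℝ), logDerivSpeed K1 K3 (v 0 + -(n * (2 * Real.pi)))
      = logDerivSpeed K1 K3 (v 0) := fun n v => by
    rw [← sub_eq_add_neg]; exact logDerivSpeed_periodic.sub_int_mul_eq n
  choose L1 hL1 H1 using fun i => key (charSpeed K1 K3 i)
    (fun u _ => (contDiff_charSpeed hK1 hK3 i).contDiffAt)
    (fun n v => by simp [charSpeed, hper])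
  choose L2 hL2 H2 using fun i => key (source K1 K3 W i)
    (fun u hu => (contDiffAt_numer hK1 hK3 hW (hab hu.1) i).div
      ((contDiff_apply ℝ ℝ (1 : Fin 6)).contDiffAt.pow 2)
      (pow_ne_zero 2 fun h => h0 (h ▸ hu.1)))
    (fun n v => by simp [source, numer, hper'])
  refine ⟨∑ i, (L1 i + L2 i), Finset.sum_nonneg fun i _ => add_nonneg (hL1 i) (hL2 i),
    fun i => (H1 i).mono ?_, fun i => (H2 i).mono ?_⟩
  · exact (le_add_of_nonneg_right (hL2 i)).trans (Finset.single_le_sum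
      (f := fun i => L1 i + L2 i) (fun i _ => add_nonneg (hL1 i) (hL2 i)) (Finset.mem_univ i))
  · exact (le_add_of_nonneg_left (hL1 i)).trans (Finset.single_le_sum
      (f := fun i => L1 i + L2 i) (fun i _ => add_nonneg (hL1 i) (hL2 i)) (Finset.mem_univ i))

end

/-! ### From the first-order system back to the wave system. -/

lemma eq_zero_of_linear_ode {T C : ℝ} {w k : ℝ → ℝ}
    (hw : ∀ t ∈ Icc 0 T, HasDerivWithinAt w (k t * w t) (Icc 0 T) t)
    (hk : ∀ t ∈ Icc 0 T, |k t| ≤ C) (h0 : w 0 = 0) : ∀ t ∈ Icc 0 T, w t = 0 := by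
  intro t ht
  have := norm_le_gronwallBound_of_norm_deriv_right_le (f := w) (f' := fun t => k t * w t)
    (δ := 0) (K := C) (ε := 0) (a := 0) (b := T)
    (fun t ht => (hw t ht).continuousWithinAt)
    (fun t ht => (hw t ⟨ht.1, ht.2.le⟩).mono_of_mem_nhdsWithin (Icc_mem_nhdsGE_of_mem ht))
    (by simp [h0]) (fun t ht => by
      rw [add_zero, norm_mul]
      exact mul_le_mul_of_nonneg_right (hk t ⟨ht.1, ht.2.le⟩) (norm_nonneg _)) t ht
  simpa [gronwallBound_ε0_δ0] using this

lemma IsC11.clm {V V' : Type*} [NormedAddCommGroup V] [NormedSpace ℝ V] [NormedAddCommGroup V']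
    [NormedSpace ℝ V'] {A B : ℝ} {f : ℝ → V} (hf : IsC11 A B f) (l : V →L[ℝ] V') :
    IsC11 (‖l‖ * A) (‖l‖ * B) fun x => l (f x) := by
  refine IsC11.of_hasDerivAt (f' := fun x => l (deriv f x))
    (fun x => l.hasFDerivAt.comp_hasDerivAt x (hf.diff x).hasDerivAt) (fun x => ?_) fun x y => ?_
  · exact (l.le_opNorm _).trans (mul_le_mul_of_nonneg_left (hf.deriv_le x) (norm_nonneg _))
  · rw [← map_sub, mul_assoc]
    exact (l.le_opNorm _).trans (mul_le_mul_of_nonneg_left (hf.deriv_lip x y) (norm_nonneg _))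

section FirstOrder

variable {K1 K3 : ℝ} {W : ℝ → ℝ} {a b N T A B M : ℝ} {u : ℝ → ℝ → Fin 6 → ℝ}

/-- Propagation of the relation between a function and its Riemann variables. -/
lemma constraint_propagates (hK1 : 0 < K1) (hK3 : 0 < K3)
    (Q : QuasilinearSolution (charSpeed K1 K3) (source K1 K3 W) (stateBox a b N) T A B M u)
    (f p m : Fin 6) (hf : ∀ v, charSpeed K1 K3 f v = 0)
    (hp : ∀ v, charSpeed K1 K3 p v = -waveSpeed K1 K3 (v 0))
    (hm : ∀ v, charSpeed K1 K3 m v = waveSpeed K1 K3 (v 0))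
    (hFf : ∀ v ∈ stateBox a b N, source K1 K3 W f v = (v p + v m) / 2)
    (hF0 : ∀ v ∈ stateBox a b N, source K1 K3 W 0 v = (v 2 + v 3) / 2)
    (hFpm : ∀ v ∈ stateBox a b N, source K1 K3 W p v - source K1 K3 W m v
      = logDerivSpeed K1 K3 (v 0) * ((v 2 + v 3) / 2) * (v p - v m))
    (x : ℝ) (h0 : u 0 x p - u 0 x m = 2 * (waveSpeed K1 K3 (u 0 x 0) * deriv (u 0) x f)) :
    ∀ t ∈ Icc 0 T, u t x p - u t x m = 2 * (waveSpeed K1 K3 (u t x 0) * deriv (u t) x f) := by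
  have hline : ContinuousOn (fun t : ℝ => (t, x)) (Icc 0 T) := by fun_prop
  have hmaps : MapsTo (fun t : ℝ => (t, x)) (Icc 0 T) (strip T) := fun t ht => ⟨ht, mem_univ _⟩
  have hu : ∀ i, ContinuousOn (fun t => u t x i) (Icc 0 T) := fun i =>
    (Q.continuousOn_apply i).comp hline hmaps
  have hu' : ∀ i, ContinuousOn (fun t => deriv (u t) x i) (Icc 0 T) := fun i =>
    (Q.continuousOn_deriv_apply i).comp hline hmaps
  have hκ : ContinuousOn (fun t => logDerivSpeed K1 K3 (u t x 0) * ((u t x 2 + u t x 3) / 2))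
      (Icc 0 T) :=
    (((contDiff_logDerivSpeed (n := 0) hK1 hK3).continuous.comp_continuousOn (hu 0)).mul
      (((hu 2).add (hu 3)).div_const 2))
  obtain ⟨C, hC⟩ := isCompact_Icc.exists_bound_of_continuousOn hκ
  have hgx : ∀ t ∈ Icc 0 T, ∀ x, HasDerivAt (fun y => (u t y p + u t y m) / 2)
      ((deriv (u t) x p + deriv (u t) x m) / 2) x := fun t ht x =>
    ((Q.hasDerivAt_apply ht x p).add (Q.hasDerivAt_apply ht x m)).div_const 2
  set l : (Fin 6 → ℝ) →L[ℝ] ℝ := (1 / 2 : ℝ) •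
    (ContinuousLinearMap.proj (R := ℝ) (φ := fun _ : Fin 6 => ℝ) p +
      ContinuousLinearMap.proj (R := ℝ) (φ := fun _ : Fin 6 => ℝ) m)
  have hl : ∀ v, l v = (v p + v m) / 2 := fun v => by simp [l]; ring
  -- Component `f` has speed `0`, so its time derivative is `(u p + u m) / 2`, which is again
  -- `C^{1,1}` in space; this is what allows the interchange of the two derivatives.
  have hfx : ∀ t ∈ Icc 0 T, HasDerivWithinAt (fun t => deriv (u t) x f)
      ((deriv (u t) x p + deriv (u t) x m) / 2) (Icc 0 T) t := by
    intro t ht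
    have h1 := hasDerivWithinAt_deriv (f := fun t y => u t y f)
      (g := fun t y => (u t y p + u t y m) / 2) Q.T_pos (fun t ht y => by
        have := Q.hasDeriv t ht y f
        rw [hf, hFf _ (Q.mem t ht y)] at this
        simpa using this)
      (fun t ht => (Q.isC11 t ht).clm
        (ContinuousLinearMap.proj (R := ℝ) (φ := fun _ : Fin 6 => ℝ) f))
      (fun t ht => by
        have := (Q.isC11 t ht).clm l
        simpa only [hl] using this) x
      ((((hu' p).add (hu' m)).div_const 2).congr fun t ht => (hgx t ht x).deriv) ht
    rw [(hgx t ht x).deriv] at h1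
    exact h1.congr (fun t ht => (Q.hasDerivAt_apply ht x f).deriv.symm)
      (Q.hasDerivAt_apply ht x f).deriv.symm
  -- The transport terms of `u p` and `u m` cancel against the time derivative of `deriv (u t) x f`.
  -- The defect `w` of the relation is left with `w' = (c' / c)(ψ) ψₜ w`, and it vanishes at time
  -- `0`.
  have key := eq_zero_of_linear_ode (T := T) (C := C)
    (w := fun t => u t x p - u t x m - 2 * (waveSpeed K1 K3 (u t x 0) * deriv (u t) x f))
    (k := fun t => logDerivSpeed K1 K3 (u t x 0) * ((u t x 2 + u t x 3) / 2)) (fun t ht => ?_) hC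
    (by rw [h0, sub_self])
  · intro t ht
    exact sub_eq_zero.1 (key t ht)
  · have hmem := Q.mem t ht x
    have hc := (hasDerivAt_waveSpeed hK1 hK3 (u t x 0)).comp_hasDerivWithinAt t
      (Q.hasDeriv t ht x 0)
    have := ((Q.hasDeriv t ht x p).sub (Q.hasDeriv t ht x m)).sub
      ((hc.mul (hfx t ht)).const_mul 2)
    refine this.congr_deriv ?_
    have e0 : charSpeed K1 K3 0 (u t x) = 0 := rfl
    simp only [Function.comp]
    rw [hp, hm, e0, hF0 _ hmem]
    linear_combination hFpm _ hmem

end FirstOrder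

section

variable {K1 K3 : ℝ} {W : ℝ → ℝ} {v : Fin 6 → ℝ}

lemma source_zero (hv : v 1 ≠ 0) : source K1 K3 W 0 v = (v 2 + v 3) / 2 := by
  simp [source, numer]; field_simp

lemma source_one (hv : v 1 ≠ 0) : source K1 K3 W 1 v = (v 4 + v 5) / 2 := by
  simp [source, numer]; field_simp

lemma source_two_sub (hv : v 1 ≠ 0) : source K1 K3 W 2 v - source K1 K3 W 3 v
    = logDerivSpeed K1 K3 (v 0) * ((v 2 + v 3) / 2) * (v 2 - v 3) := by
  simp [source, numer]; field_simp; ring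

lemma source_four_sub (hv : v 1 ≠ 0) : source K1 K3 W 4 v - source K1 K3 W 5 v
    = logDerivSpeed K1 K3 (v 0) * ((v 2 + v 3) / 2) * (v 4 - v 5) := by
  simp [source, numer]; field_simp; ring

lemma source_two_add (hv : v 1 ≠ 0) : v 1 ^ 2 * (source K1 K3 W 2 v + source K1 K3 W 3 v)
    = -2 * v 1 * (v 2 * v 5 + v 3 * v 4) - logDerivSpeed K1 K3 (v 0) * (v 4 - v 5) ^ 2 / 2 := by
  simp [source, numer]; field_simp; ring

lemma source_four_add (hv : v 1 ≠ 0) : source K1 K3 W 4 v + source K1 K3 W 5 v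
    = logDerivSpeed K1 K3 (v 0) * (v 2 - v 3) * (v 4 - v 5) / 2 + 2 * (v 1 * v 2 * v 3)
      - 2 * deriv W (v 1) := by
  simp [source, numer]; field_simp; ring

end

lemma dt_congr {T : ℝ} {f g : ℝ → ℝ → ℝ} (h : ∀ t ∈ Icc 0 T, ∀ x, f t x = g t x) {t : ℝ}
    (ht : t ∈ Icc 0 T) (x : ℝ) : dt T f t x = dt T g t x :=
  derivWithin_congr (fun τ hτ => h τ hτ x) (h t ht x)

lemma dx_congr {f g : ℝ → ℝ → ℝ} {t : ℝ} (h : ∀ x, f t x = g t x) (x : ℝ) :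
    dx f t x = dx g t x := by
  have : f t = g t := funext h
  simp only [dx, this]

lemma ContinuousInSup.congr {T : ℝ} {f g : ℝ → ℝ → ℝ} (hf : ContinuousInSup T f)
    (h : ∀ t ∈ Icc 0 T, ∀ x, f t x = g t x) : ContinuousInSup T g := by
  refine ⟨fun t ht => ?_, fun t ht ε hε => ?_⟩
  · obtain ⟨M, hM⟩ := hf.1 t ht
    exact ⟨M, fun x => by rw [← h t ht]; exact hM x⟩
  · obtain ⟨δ, hδ, H⟩ := hf.2 t ht ε hε
    exact ⟨δ, hδ, fun t' ht' h' x => by rw [← h t ht, ← h t' ht']; exact H t' ht' h' x⟩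

lemma InSolutionSpace.congr {T : ℝ} {f g : ℝ → ℝ → ℝ} (hf : InSolutionSpace T f)
    (h : ∀ t ∈ Icc 0 T, ∀ x, f t x = g t x) : InSolutionSpace T g :=
  ⟨hf.1.congr h, hf.2.1.congr fun _ ht x => dx_congr (h _ ht) x,
    hf.2.2.congr fun _ ht x => dt_congr h ht x⟩

/-- The linear form `v ↦ p vᵢ + q vⱼ`. -/
noncomputable def coordForm (p q : ℝ) (i j : Fin 6) : (Fin 6 → ℝ) →L[ℝ] ℝ :=
  p • ContinuousLinearMap.proj (R := ℝ) (φ := fun _ : Fin 6 => ℝ) i +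
    q • ContinuousLinearMap.proj (R := ℝ) (φ := fun _ : Fin 6 => ℝ) j

lemma coordForm_apply (p q : ℝ) (i j : Fin 6) (v : Fin 6 → ℝ) :
    coordForm p q i j v = p * v i + q * v j := by
  simp [coordForm]

section FirstOrder

variable {K1 K3 : ℝ} {W : ℝ → ℝ} {a b N T A B M : ℝ} {u : ℝ → ℝ → Fin 6 → ℝ}

lemma dt_apply (Q : QuasilinearSolution (charSpeed K1 K3) (source K1 K3 W) (stateBox a b N) T A B
    M u) {t : ℝ} (ht : t ∈ Icc 0 T) (x : ℝ) (i : Fin 6) : dt T (fun t x => u t x i) t x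
      = -charSpeed K1 K3 i (u t x) * deriv (u t) x i + source K1 K3 W i (u t x) :=
  dt_eq_of_hasDerivWithinAt Q.T_pos ht (Q.hasDeriv t ht x i)

lemma dx_apply (Q : QuasilinearSolution (charSpeed K1 K3) (source K1 K3 W) (stateBox a b N) T A B
    M u) {t : ℝ} (ht : t ∈ Icc 0 T) (x : ℝ) (i : Fin 6) :
    dx (fun t x => u t x i) t x = deriv (u t) x i :=
  (Q.hasDerivAt_apply ht x i).deriv

/-- Both first derivatives of component `f` are algebraic expressions in the `C¹` Riemann variables
and the positive smooth speed, which gains one order of differentiability. -/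
lemma contDiffOn_two_of_riemann (hK1 : 0 < K1) (hK3 : 0 < K3)
    (Q : QuasilinearSolution (charSpeed K1 K3) (source K1 K3 W) (stateBox a b N) T A B M u)
    (hu : ∀ i, ContDiffOn ℝ 1 (fun z : ℝ × ℝ => u z.1 z.2 i) (strip T)) (f p m : Fin 6)
    (ht : ∀ t ∈ Icc 0 T, ∀ x, -charSpeed K1 K3 f (u t x) * deriv (u t) x f
      + source K1 K3 W f (u t x) = (u t x p + u t x m) / 2)
    (hx : ∀ t ∈ Icc 0 T, ∀ x,
      u t x p - u t x m = 2 * (waveSpeed K1 K3 (u t x 0) * deriv (u t) x f)) :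
    ContDiffOn ℝ 2 (fun z : ℝ × ℝ => u z.1 z.2 f) (strip T) := by
  have := contDiffOn_succ_of_partial (n := 1) (f := fun t x => u t x f)
    (ft := fun t x => (u t x p + u t x m) / 2)
    (fx := fun t x => (u t x p - u t x m) / (2 * waveSpeed K1 K3 (u t x 0))) Q.T_pos
    (fun t h x => (ht t h x) ▸ Q.hasDeriv t h x f) (fun t h x => by
      have hc := waveSpeed_pos hK1 hK3 (u t x 0)
      refine (Q.hasDerivAt_apply h x f).congr_deriv ?_
      rw [hx t h x]; field_simp)
    (((hu p).add (hu m)).div_const 2)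
    (((hu p).sub (hu m)).div (contDiffOn_const.mul
      ((contDiff_waveSpeed hK1 hK3).comp_contDiffOn (hu 0)))
      fun z _ => (mul_pos two_pos (waveSpeed_pos hK1 hK3 (u z.1 z.2 0))).ne')
  norm_num at this
  exact this

/-- The pair `(ψ, s)` extracted from a solution of the first-order system, together with its
derivatives. -/
structure RiemannRelations (K1 K3 T : ℝ) (u : ℝ → ℝ → Fin 6 → ℝ) : Prop where
  dt_psi : ∀ t ∈ Icc 0 T, ∀ x, dt T (fun t x => u t x 0) t x = (u t x 2 + u t x 3) / 2
  dt_s : ∀ t ∈ Icc 0 T, ∀ x, dt T (fun t x => u t x 1) t x = (u t x 4 + u t x 5) / 2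
  dx_psi : ∀ t ∈ Icc 0 T, ∀ x,
    waveSpeed K1 K3 (u t x 0) * dx (fun t x => u t x 0) t x = (u t x 2 - u t x 3) / 2
  dx_s : ∀ t ∈ Icc 0 T, ∀ x,
    waveSpeed K1 K3 (u t x 0) * dx (fun t x => u t x 1) t x = (u t x 4 - u t x 5) / 2

theorem riemannRelations (hK1 : 0 < K1) (hK3 : 0 < K3)
    (Q : QuasilinearSolution (charSpeed K1 K3) (source K1 K3 W) (stateBox a b N) T A B M u)
    (h0 : (0 : ℝ) ∉ Icc a b)
    (hi1 : ∀ x, u 0 x 2 - u 0 x 3 = 2 * (waveSpeed K1 K3 (u 0 x 0) * deriv (u 0) x 0))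
    (hi2 : ∀ x, u 0 x 4 - u 0 x 5 = 2 * (waveSpeed K1 K3 (u 0 x 0) * deriv (u 0) x 1)) :
    RiemannRelations K1 K3 T u := by
  have hne : ∀ v ∈ stateBox a b N, v 1 ≠ 0 := fun v hv h => h0 (h ▸ hv.1)
  have c1 : ∀ t ∈ Icc 0 T, ∀ x, _ := fun t ht x => constraint_propagates hK1 hK3 Q 0 2 3
    (fun _ => rfl) (fun _ => rfl) (fun _ => rfl) (fun v hv => source_zero (hne v hv))
    (fun v hv => source_zero (hne v hv)) (fun v hv => source_two_sub (hne v hv)) x (hi1 x) t ht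
  have c2 : ∀ t ∈ Icc 0 T, ∀ x, _ := fun t ht x => constraint_propagates hK1 hK3 Q 1 4 5
    (fun _ => rfl) (fun _ => rfl) (fun _ => rfl) (fun v hv => source_one (hne v hv))
    (fun v hv => source_zero (hne v hv)) (fun v hv => source_four_sub (hne v hv)) x (hi2 x) t ht
  refine ⟨fun t ht x => ?_, fun t ht x => ?_, fun t ht x => ?_, fun t ht x => ?_⟩
  · rw [dt_apply Q ht, source_zero (hne _ (Q.mem t ht x))]
    simp [charSpeed]
  · rw [dt_apply Q ht, source_one (hne _ (Q.mem t ht x))]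
    simp [charSpeed]
  · rw [dx_apply Q ht, c1 t ht x]; ring
  · rw [dx_apply Q ht, c2 t ht x]; ring

/-- A solution of the first-order system yields a classical solution. -/
theorem isClassicalSolution_of_riemann (hK1 : 0 < K1) (hK3 : 0 < K3)
    (Q : QuasilinearSolution (charSpeed K1 K3) (source K1 K3 W) (stateBox a b N) T A B M u)
    (hab : Icc a b ⊆ Ioo (-1 / 2 : ℝ) 1) (h0 : (0 : ℝ) ∉ Icc a b)
    (hu : ∀ i, ContDiffOn ℝ 1 (fun z : ℝ × ℝ => u z.1 z.2 i) (strip T))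
    (R : RiemannRelations K1 K3 T u) :
    IsClassicalSolution K1 K3 W T (fun t x => u t x 0) fun t x => u t x 1 := by
  have hne : ∀ t ∈ Icc 0 T, ∀ x, u t x 1 ≠ 0 := fun t ht x h => h0 (h ▸ (Q.mem t ht x).1)
  have htt : ∀ f p m : Fin 6, (∀ t ∈ Icc 0 T, ∀ x, dt T (fun t x => u t x f) t x
      = (u t x p + u t x m) / 2) → ∀ t ∈ Icc 0 T, ∀ x, dt T (dt T fun t x => u t x f) t x
      = ((-charSpeed K1 K3 p (u t x) * deriv (u t) x p + source K1 K3 W p (u t x))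
        + (-charSpeed K1 K3 m (u t x) * deriv (u t) x m + source K1 K3 W m (u t x))) / 2 := by
    intro f p m h t ht x
    rw [dt_congr h ht]
    exact dt_eq_of_hasDerivWithinAt (f := fun t x => (u t x p + u t x m) / 2) Q.T_pos ht
      (((Q.hasDeriv t ht x p).add (Q.hasDeriv t ht x m)).div_const 2)
  have hxx : ∀ f p m : Fin 6, (∀ t ∈ Icc 0 T, ∀ x,
      waveSpeed K1 K3 (u t x 0) * dx (fun t x => u t x f) t x = (u t x p - u t x m) / 2) →
      ∀ t ∈ Icc 0 T, ∀ x,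
      dx (fun t y => waveSpeed K1 K3 (u t y 0) * dx (fun t x => u t x f) t y) t x
      = (deriv (u t) x p - deriv (u t) x m) / 2 := by
    intro f p m h t ht x
    rw [dx_congr (g := fun t x => (u t x p - u t x m) / 2) (h t ht)]
    exact (((Q.hasDerivAt_apply ht x p).sub (Q.hasDerivAt_apply ht x m)).div_const 2).deriv
  refine ⟨?_, ?_, fun t ht x => hab (Q.mem t ht x).1, fun t ht x => ?_, fun t ht x => ?_⟩
  · refine contDiffOn_two_of_riemann hK1 hK3 Q hu 0 2 3 (fun t ht x => ?_) fun t ht x => ?_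
    · rw [← dt_apply Q ht, R.dt_psi t ht x]
    · have := R.dx_psi t ht x
      rw [dx_apply Q ht] at this
      linarith
  · refine contDiffOn_two_of_riemann hK1 hK3 Q hu 1 4 5 (fun t ht x => ?_) fun t ht x => ?_
    · rw [← dt_apply Q ht, R.dt_s t ht x]
    · have := R.dx_s t ht x
      rw [dx_apply Q ht] at this
      linarith
  · have e1 := R.dt_psi t ht x
    have e2 := R.dt_s t ht x
    have e3 := R.dx_psi t ht x
    have e4 := R.dx_s t ht x
    have e5 := source_two_add (K1 := K1) (K3 := K3) (W := W) (hne t ht x)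
    rw [htt 0 2 3 R.dt_psi t ht x, hxx 0 2 3 R.dx_psi t ht x, deriv_waveSpeed hK1 hK3, e1, e2]
    have s2 : charSpeed K1 K3 2 (u t x) = -waveSpeed K1 K3 (u t x 0) := rfl
    have s3 : charSpeed K1 K3 3 (u t x) = waveSpeed K1 K3 (u t x 0) := rfl
    rw [s2, s3]
    have e6 : waveSpeed K1 K3 (u t x 0) ^ 2 * dx (fun t x => u t x 0) t x
        * dx (fun t x => u t x 1) t x = (u t x 2 - u t x 3) / 2 * ((u t x 4 - u t x 5) / 2) := by
      rw [← e3, ← e4]; ring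
    have e7 : (waveSpeed K1 K3 (u t x 0) * dx (fun t x => u t x 1) t x) ^ 2
        = ((u t x 4 - u t x 5) / 2) ^ 2 := by rw [e4]
    rw [e6]
    linear_combination e5 / 2 + logDerivSpeed K1 K3 (u t x 0) * e7
  · have e1 := R.dt_psi t ht x
    have e2 := R.dt_s t ht x
    have e3 := R.dx_psi t ht x
    have e4 := R.dx_s t ht x
    have e5 := source_four_add (K1 := K1) (K3 := K3) (W := W) (hne t ht x)
    rw [htt 1 4 5 R.dt_s t ht x, hxx 1 4 5 R.dx_s t ht x, deriv_waveSpeed hK1 hK3, e1]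
    have s4 : charSpeed K1 K3 4 (u t x) = -waveSpeed K1 K3 (u t x 0) := rfl
    have s5 : charSpeed K1 K3 5 (u t x) = waveSpeed K1 K3 (u t x 0) := rfl
    rw [s4, s5]
    have e6 : (waveSpeed K1 K3 (u t x 0) * dx (fun t x => u t x 0) t x)
        * (waveSpeed K1 K3 (u t x 0) * dx (fun t x => u t x 1) t x)
        = (u t x 2 - u t x 3) / 2 * ((u t x 4 - u t x 5) / 2) := by
      rw [e3, e4]
    have e7 : (waveSpeed K1 K3 (u t x 0) * dx (fun t x => u t x 0) t x) ^ 2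
        = ((u t x 2 - u t x 3) / 2) ^ 2 := by rw [e3]
    linear_combination e5 / 2 - logDerivSpeed K1 K3 (u t x 0) * e6 + u t x 1 * e7

end FirstOrder

/-! ### Conservation of energy. -/

section Conservation

variable {T M : ℝ} {e f g : ℝ → ℝ → ℝ}

/-- A potential for a conservation law `∂ₜe = ∂ₓf`. -/
lemma exists_potential (hT : 0 < T)
    (hec : ContinuousOn (fun z : ℝ × ℝ => e z.1 z.2) (strip T))
    (hfc : ContinuousOn (fun z : ℝ × ℝ => f z.1 z.2) (strip T))
    (hgc : ContinuousOn (fun z : ℝ × ℝ => g z.1 z.2) (strip T))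
    (het : ∀ t ∈ Icc 0 T, ∀ x, HasDerivWithinAt (fun τ => e τ x) (g t x) (Icc 0 T) t)
    (hfx : ∀ t ∈ Icc 0 T, ∀ x, HasDerivAt (fun y => f t y) (g t x) x) :
    ∃ m : ℝ → ℝ → ℝ,
      (∀ t ∈ Icc 0 T, ∀ x, HasDerivWithinAt (fun τ => m τ x) (f t x) (Icc 0 T) t) ∧
      ∀ t ∈ Icc 0 T, ∀ x, HasDerivAt (fun y => m t y) (e t x) x := by
  -- Clamping time to `[0, T]` extends functions continuous on the strip to continuous functions on
  -- the plane, as wanted for differentiating under the integral sign.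
  set π : ℝ → ℝ := fun t => projIcc 0 T hT.le t with hπ
  have hπc : Continuous π := continuous_subtype_val.comp continuous_projIcc
  have hπm : ∀ t, π t ∈ Icc 0 T := fun t => (projIcc 0 T hT.le t).2
  have hπe : ∀ t ∈ Icc 0 T, π t = t := fun t ht => by simp [hπ, projIcc_of_mem hT.le ht]
  have hext : ∀ h : ℝ → ℝ → ℝ, ContinuousOn (fun z : ℝ × ℝ => h z.1 z.2) (strip T) →
      Continuous fun z : ℝ × ℝ => h (π z.1) z.2 := fun h hh =>
    hh.comp_continuous (f := fun z : ℝ × ℝ => (π z.1, z.2)) (by fun_prop)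
      fun z => ⟨hπm z.1, mem_univ _⟩
  have hf' := hext f hfc
  have hg' := hext g hgc
  have he0 : Continuous fun y => e 0 y :=
    hec.comp_continuous (f := fun y : ℝ => ((0 : ℝ), y)) (by fun_prop)
      fun y => ⟨⟨le_rfl, hT.le⟩, mem_univ _⟩
  -- The potential integrates `e` along the initial line and then `f` upwards in time. Its spatial
  -- derivative is `e 0 x + ∫ g`, and this equals `e t x` because `g` is also the time derivative of
  -- `e`.
  refine ⟨fun t x => (∫ y in (0:ℝ)..x, e 0 y) + ∫ τ in (0:ℝ)..t, f (π τ) x, fun t ht x => ?_,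
    fun t ht x => ?_⟩
  · have hc : Continuous fun τ => f (π τ) x :=
      hf'.comp (g := fun z : ℝ × ℝ => f (π z.1) z.2) (f := fun τ : ℝ => (τ, x)) (by fun_prop)
    have := (hc.integral_hasStrictDerivAt 0 t).hasDerivAt.const_add (∫ y in (0:ℝ)..x, e 0 y)
    rw [hπe t ht] at this
    exact this.hasDerivWithinAt
  · have h1 := (he0.integral_hasStrictDerivAt 0 x).hasDerivAt
    obtain ⟨C, hC⟩ := ((isCompact_Icc (a := 0) (b := T)).prod
      (isCompact_closedBall x 1)).exists_bound_of_continuousOn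
      (f := fun z : ℝ × ℝ => g (π z.1) z.2) hg'.continuousOn
    have hcx : ∀ y, Continuous fun τ => f (π τ) y := fun y =>
      hf'.comp (g := fun z : ℝ × ℝ => f (π z.1) z.2) (f := fun τ : ℝ => (τ, y)) (by fun_prop)
    have hgx : ∀ y, Continuous fun τ => g (π τ) y := fun y =>
      hg'.comp (g := fun z : ℝ × ℝ => g (π z.1) z.2) (f := fun τ : ℝ => (τ, y)) (by fun_prop)
    have h2 := (intervalIntegral.hasDerivAt_integral_of_dominated_loc_of_deriv_le
      (μ := volume) (a := 0) (b := t) (bound := fun _ => C) (x₀ := x)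
      (s := Metric.ball x 1)
      (F := fun y τ => f (π τ) y) (F' := fun y τ => g (π τ) y) (Metric.ball_mem_nhds x one_pos)
      (Eventually.of_forall fun y => (hcx y).aestronglyMeasurable)
      ((hcx x).intervalIntegrable _ _) (hgx x).aestronglyMeasurable
      (Eventually.of_forall fun τ hτ y hy => by
        refine hC (τ, y) ⟨?_, Metric.ball_subset_closedBall hy⟩
        rw [uIoc_of_le ht.1] at hτ
        exact ⟨hτ.1.le, hτ.2.trans ht.2⟩)
      intervalIntegrable_const
      (Eventually.of_forall fun τ _ y _ => hfx (π τ) (hπm τ) y)).2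
    have h3 : ∫ τ in (0:ℝ)..t, g (π τ) x = e t x - e 0 x := by
      refine intervalIntegral.integral_eq_sub_of_hasDeriv_right_of_le ht.1
        (f := fun τ => e τ x) (fun τ hτ => ?_) (fun τ hτ => ?_) ((hgx x).intervalIntegrable _ _)
      · have hτ' : τ ∈ Icc 0 T := ⟨hτ.1, hτ.2.trans ht.2⟩
        exact (het τ hτ' x).continuousWithinAt.mono (Icc_subset_Icc_right ht.2)
      · have hτ' : τ ∈ Icc 0 T := ⟨hτ.1.le, hτ.2.le.trans ht.2⟩
        rw [hπe τ hτ']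
        exact ((het τ hτ' x).hasDerivAt
          (Icc_mem_nhds hτ.1 (hτ.2.trans_le ht.2))).hasDerivWithinAt
    have h4 := h1.add h2
    rw [h3, add_sub_cancel] at h4
    exact h4

/-- Conservation of the integral of a density dominating its flux. -/
theorem integral_conserved (hT : 0 < T)
    (hec : ContinuousOn (fun z : ℝ × ℝ => e z.1 z.2) (strip T))
    (hfc : ContinuousOn (fun z : ℝ × ℝ => f z.1 z.2) (strip T))
    (hgc : ContinuousOn (fun z : ℝ × ℝ => g z.1 z.2) (strip T))
    (het : ∀ t ∈ Icc 0 T, ∀ x, HasDerivWithinAt (fun τ => e τ x) (g t x) (Icc 0 T) t)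
    (hfx : ∀ t ∈ Icc 0 T, ∀ x, HasDerivAt (fun y => f t y) (g t x) x)
    (he : ∀ t ∈ Icc 0 T, ∀ x, 0 ≤ e t x) (hfe : ∀ t ∈ Icc 0 T, ∀ x, |f t x| ≤ M * e t x)
    (hint : Integrable (e 0)) {t : ℝ} (ht : t ∈ Icc 0 T) :
    Integrable (e t) ∧ ∫ x, e t x = ∫ x, e 0 x := by
  obtain ⟨m, hmt, hmx⟩ := exists_potential hT hec hfc hgc het hfx
  have h0 : (0 : ℝ) ∈ Icc 0 T := ⟨le_rfl, hT.le⟩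
  have hsub : Icc 0 t ⊆ Icc 0 T := Icc_subset_Icc_right ht.2
  have hline : ∀ k y, ∀ τ ∈ Icc 0 T, HasDerivWithinAt (fun τ => m τ (y + k * τ))
      (f τ (y + k * τ) + k * e τ (y + k * τ)) (Icc 0 T) τ := by
    intro k y τ hτ
    have h1 := hasFDerivWithinAt_of_partial (x := y + k * τ) hτ (hmt τ hτ _) hmx hec
    have h2 : HasDerivWithinAt (fun τ : ℝ => (τ, y + k * τ)) ((1 : ℝ), k) (Icc 0 T) τ := by
      have := (hasDerivAt_id τ).prodMk (((hasDerivAt_id τ).const_mul k).const_add y)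
      rw [mul_one] at this
      exact this.hasDerivWithinAt
    have hm : MapsTo (fun τ : ℝ => (τ, y + k * τ)) (Icc 0 T) (strip T) :=
      fun τ hτ => ⟨hτ, mem_univ _⟩
    refine (HasFDerivWithinAt.comp_hasDerivWithinAt τ h1 h2 hm).congr_deriv ?_
    rw [linForm_apply]; ring
  -- Along lines of slope `±M` the potential has derivative `f ± M e`, which has a fixed sign by
  -- `hfe`. Its increments are the energies of intervals, so the energy of an interval at one time
  -- is bounded by that of the enlarged interval at the other time.
  have hup : ∀ y, m 0 y ≤ m t (y + M * t) := by
    intro y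
    have : MonotoneOn (fun τ => m τ (y + M * τ)) (Icc 0 T) :=
      monotoneOn_of_hasDerivWithinAt_nonneg (convex_Icc 0 T)
        (fun τ hτ => (hline M y τ hτ).continuousWithinAt)
        (fun τ hτ => (hline M y τ (interior_subset hτ)).mono interior_subset) fun τ hτ => by
          have := (abs_le.1 (hfe τ (interior_subset hτ) (y + M * τ))).1
          linarith
    simpa using this h0 ht ht.1
  have hdown : ∀ y, m t (y - M * t) ≤ m 0 y := by
    intro y
    have : AntitoneOn (fun τ => m τ (y + -M * τ)) (Icc 0 T) :=
      antitoneOn_of_hasDerivWithinAt_nonpos (convex_Icc 0 T)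
        (fun τ hτ => (hline (-M) y τ hτ).continuousWithinAt)
        (fun τ hτ => (hline (-M) y τ (interior_subset hτ)).mono interior_subset) fun τ hτ => by
          have := (abs_le.1 (hfe τ (interior_subset hτ) (y + -M * τ))).2
          linarith
    have := this h0 ht ht.1
    simp only [mul_zero, add_zero] at this
    rwa [neg_mul, ← sub_eq_add_neg] at this
  have hcont : ∀ t ∈ Icc 0 T, Continuous fun y => e t y := fun t ht =>
    hec.comp_continuous (f := fun y : ℝ => (t, y)) (by fun_prop) fun y => ⟨ht, mem_univ _⟩
  have hsubm : ∀ t ∈ Icc 0 T, ∀ a b, ∫ x in a..b, e t x = m t b - m t a := fun t ht a b =>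
    intervalIntegral.integral_eq_sub_of_hasDerivAt (fun x _ => hmx t ht x)
      ((hcont t ht).intervalIntegrable _ _)
  have hle : ∀ t ∈ Icc 0 T, Integrable (e t) → ∀ a b, a ≤ b →
      ∫ x in a..b, e t x ≤ ∫ x, e t x := fun t ht hi a b hab => by
    rw [intervalIntegral.integral_of_le hab]
    exact setIntegral_le_integral hi (Eventually.of_forall (he t ht))
  have hbot : Tendsto (fun n : ℕ => -(n : ℝ)) atTop atBot :=
    tendsto_neg_atTop_atBot.comp tendsto_natCast_atTop_atTop
  have htop : Tendsto (fun n : ℕ => (n : ℝ)) atTop atTop := tendsto_natCast_atTop_atTop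
  -- `M` is not assumed nonnegative, so the endpoints `±(n + M t)` are in the right order only for
  -- large `n`.
  have hbig : ∀ᶠ n : ℕ in atTop, |M * t| ≤ n := htop.eventually_ge_atTop _
  have hupper : ∀ᶠ n : ℕ in atTop, ∫ x in (-(n : ℝ))..n, e t x ≤ ∫ x, e 0 x := by
    filter_upwards [hbig] with n hn
    have := abs_le.1 hn
    have h1 := hdown (n + M * t)
    have h2 := hup (-n - M * t)
    rw [add_sub_cancel_right] at h1
    rw [sub_add_cancel] at h2
    refine le_trans ?_ (hle 0 h0 hint (-n - M * t) (n + M * t) (by linarith))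
    rw [hsubm t ht, hsubm 0 h0]
    linarith
  have hinti : Integrable (e t) := by
    refine integrable_of_intervalIntegral_norm_bounded (∫ x, e 0 x) (a := fun n : ℕ => -(n : ℝ))
      (b := fun n : ℕ => (n : ℝ)) (fun n => (hcont t ht).integrableOn_Ioc) hbot htop ?_
    filter_upwards [hupper] with n hn
    simpa only [Real.norm_of_nonneg (he t ht _)] using hn
  refine ⟨hinti, le_antisymm ?_ ?_⟩
  · exact le_of_tendsto (intervalIntegral_tendsto_integral hinti hbot htop) hupper
  · refine le_of_tendsto (intervalIntegral_tendsto_integral hint hbot htop) ?_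
    filter_upwards [hbig] with n hn
    have := abs_le.1 hn
    refine le_trans ?_ (hle t ht hinti (-n - M * t) (n + M * t) (by linarith))
    rw [hsubm t ht, hsubm 0 h0]
    have h1 := hup n
    have h2 := hdown (-n)
    linarith

end Conservation

section Energy

variable {K1 K3 : ℝ} {W : ℝ → ℝ} {a b N T A B M : ℝ} {u : ℝ → ℝ → Fin 6 → ℝ}

/-- The energy density in terms of the Riemann variables. -/
noncomputable def stateEnergy (W : ℝ → ℝ) (v : Fin 6 → ℝ) : ℝ :=
  (v 1 ^ 2 * (v 2 ^ 2 + v 3 ^ 2) + (v 4 ^ 2 + v 5 ^ 2)) / 4 + W (v 1)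

lemma solutionEnergyDensity_eq (R : RiemannRelations K1 K3 T u) {t : ℝ} (ht : t ∈ Icc 0 T)
    (x : ℝ) : solutionEnergyDensity K1 K3 W T (fun t x => u t x 0) (fun t x => u t x 1) t x
      = stateEnergy W (u t x) := by
  unfold solutionEnergyDensity energyDensity stateEnergy
  rw [← mul_pow, ← mul_pow, R.dt_psi t ht, R.dt_s t ht, R.dx_psi t ht, R.dx_s t ht]
  ring

/-- The flux is the wave speed times the difference of the right- and left-moving parts of the
density up to sign; as `W ≥ 0` on `[a, b]`, it is at most `√(K₁ + K₃)` times the density. In the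
common derivative `g`, the products `c ψₓ` and `c sₓ` are replaced by Riemann variables: the time
derivative of the density has this form by the equations alone, the spatial derivative of the flux
by the relations `R`. -/
theorem energy_conserved (hK1 : 0 < K1) (hK3 : 0 < K3)
    (hW : ContDiffOn ℝ 4 W (Ioo (-1 / 2 : ℝ) 1))
    (Q : QuasilinearSolution (charSpeed K1 K3) (source K1 K3 W) (stateBox a b N) T A B M u)
    (hab : Icc a b ⊆ Ioo (-1 / 2 : ℝ) 1) (h0 : (0 : ℝ) ∉ Icc a b)
    (hWpos : ∀ σ ∈ Icc a b, 0 ≤ W σ) (R : RiemannRelations K1 K3 T u)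
    (hint : Integrable fun x => stateEnergy W (u 0 x)) {t : ℝ} (ht : t ∈ Icc 0 T) :
    Integrable (fun x => stateEnergy W (u t x)) ∧
      ∫ x, stateEnergy W (u t x) = ∫ x, stateEnergy W (u 0 x) := by
  have hne : ∀ t ∈ Icc 0 T, ∀ x, u t x 1 ≠ 0 := fun t ht x h => h0 (h ▸ (Q.mem t ht x).1)
  have hWd : ∀ t ∈ Icc 0 T, ∀ x, HasDerivAt W (deriv W (u t x 1)) (u t x 1) := fun t ht x =>
    ((hW.differentiableOn (by norm_num)) _ (hab (Q.mem t ht x).1)).differentiableAt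
      (isOpen_Ioo.mem_nhds (hab (Q.mem t ht x).1)) |>.hasDerivAt
  have c := Q.continuousOn_apply
  have d := Q.continuousOn_deriv_apply
  have hc : ContinuousOn (fun z : ℝ × ℝ => waveSpeed K1 K3 (u z.1 z.2 0)) (strip T) :=
    (contDiff_waveSpeed (n := 0) hK1 hK3).continuous.comp_continuousOn (c 0)
  have hκ : ContinuousOn (fun z : ℝ × ℝ => logDerivSpeed K1 K3 (u z.1 z.2 0)) (strip T) :=
    (contDiff_logDerivSpeed (n := 0) hK1 hK3).continuous.comp_continuousOn (c 0)
  have hWc : ContinuousOn (fun z : ℝ × ℝ => W (u z.1 z.2 1)) (strip T) :=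
    hW.continuousOn.comp (c 1) fun z hz => hab (Q.mem z.1 hz.1 z.2).1
  refine integral_conserved (M := Real.sqrt (K1 + K3)) (e := fun t x => stateEnergy W (u t x))
    (f := fun t x => waveSpeed K1 K3 (u t x 0) *
      ((u t x 1 ^ 2 * (u t x 2 ^ 2 - u t x 3 ^ 2) + (u t x 4 ^ 2 - u t x 5 ^ 2)) / 4))
    (g := fun t x => logDerivSpeed K1 K3 (u t x 0) * ((u t x 2 - u t x 3) / 2) *
      ((u t x 1 ^ 2 * (u t x 2 ^ 2 - u t x 3 ^ 2) + (u t x 4 ^ 2 - u t x 5 ^ 2)) / 4)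
      + (u t x 1 * ((u t x 4 - u t x 5) * (u t x 2 ^ 2 - u t x 3 ^ 2))
        + 2 * (waveSpeed K1 K3 (u t x 0) *
          (u t x 1 ^ 2 * (u t x 2 * deriv (u t) x 2 - u t x 3 * deriv (u t) x 3)
            + (u t x 4 * deriv (u t) x 4 - u t x 5 * deriv (u t) x 5)))) / 4)
    Q.T_pos ?_ ?_ ?_ (fun t ht x => ?_) (fun t ht x => ?_) (fun t ht x => ?_) (fun t ht x => ?_)
    hint ht
  · exact (((((c 1).pow 2).mul (((c 2).pow 2).add ((c 3).pow 2))).add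
      (((c 4).pow 2).add ((c 5).pow 2))).div_const 4).add hWc
  · exact hc.mul (((((c 1).pow 2).mul (((c 2).pow 2).sub ((c 3).pow 2))).add
      (((c 4).pow 2).sub ((c 5).pow 2))).div_const 4)
  · have c0 := c 0
    have c1 := c 1
    have c2 := c 2
    have c3 := c 3
    have c4 := c 4
    have c5 := c 5
    have d2 := d 2
    have d3 := d 3
    have d4 := d 4
    have d5 := d 5
    fun_prop
  · have q := Q.hasDeriv t ht x
    have hs := (hWd t ht x).comp_hasDerivWithinAt t (q 1)
    have := (((((q 1).fun_pow 2).mul (((q 2).fun_pow 2).add ((q 3).fun_pow 2))).add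
      (((q 4).fun_pow 2).add ((q 5).fun_pow 2))).div_const 4).add hs
    refine this.congr_deriv ?_
    have s1 : charSpeed K1 K3 1 (u t x) = 0 := rfl
    have s2 : charSpeed K1 K3 2 (u t x) = -waveSpeed K1 K3 (u t x 0) := rfl
    have s3 : charSpeed K1 K3 3 (u t x) = waveSpeed K1 K3 (u t x 0) := rfl
    have s4 : charSpeed K1 K3 4 (u t x) = -waveSpeed K1 K3 (u t x 0) := rfl
    have s5 : charSpeed K1 K3 5 (u t x) = waveSpeed K1 K3 (u t x 0) := rfl
    have hn := hne t ht x
    rw [s1, s2, s3, s4, s5]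
    simp [source, numer]
    field_simp
    ring
  · have q := Q.hasDerivAt_apply ht x
    have hcx := (hasDerivAt_waveSpeed hK1 hK3 (u t x 0)).comp x (q 0)
    have := hcx.mul (((((q 1).fun_pow 2).mul (((q 2).fun_pow 2).sub ((q 3).fun_pow 2))).add
      (((q 4).fun_pow 2).sub ((q 5).fun_pow 2))).div_const 4)
    refine this.congr_deriv ?_
    have e3 := R.dx_psi t ht x
    have e4 := R.dx_s t ht x
    rw [dx_apply Q ht] at e3 e4
    simp only [Function.comp]
    push_cast
    simp
    linear_combination logDerivSpeed K1 K3 (u t x 0) * ((u t x 1 ^ 2 * (u t x 2 ^ 2 - u t x 3 ^ 2)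
      + (u t x 4 ^ 2 - u t x 5 ^ 2)) / 4) * e3
      + u t x 1 * (u t x 2 ^ 2 - u t x 3 ^ 2) / 2 * e4
  · have := hWpos _ (Q.mem t ht x).1
    unfold stateEnergy
    positivity
  · have hW0 := hWpos _ (Q.mem t ht x).1
    have h1 := waveSpeed_pos hK1 hK3 (u t x 0)
    have h2 := waveSpeed_le hK1 hK3 (u t x 0)
    rw [abs_mul, abs_of_pos h1]
    refine mul_le_mul h2 ?_ (abs_nonneg _) (Real.sqrt_nonneg _)
    unfold stateEnergy
    have h3 : 0 ≤ u t x 1 ^ 2 * u t x 2 ^ 2 := by positivity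
    have h4 : 0 ≤ u t x 1 ^ 2 * u t x 3 ^ 2 := by positivity
    have h5 : 0 ≤ u t x 4 ^ 2 := by positivity
    have h6 : 0 ≤ u t x 5 ^ 2 := by positivity
    rw [abs_le]
    constructor <;> linarith

end Energy

/-! ### Initial data: gap to the endpoint, and regularity. -/

/-- A Lipschitz function along which a penalty with infinite barrier at `q` is integrable stays
away from `q`. -/
lemma exists_gap {f V g : ℝ → ℝ} {q L : ℝ} (hf : ∀ x y, |f x - f y| ≤ L * |x - y|)
    (hfq : ∀ x, f x < q) (hV : Tendsto V (𝓝[<] q) atTop) (hg : Integrable g)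
    (hg0 : ∀ x, 0 ≤ g x) (hVg : ∀ x, V (f x) ≤ g x) : ∃ η > 0, ∀ x, f x ≤ q - η := by
  obtain ⟨p, hp, hpV⟩ := (mem_nhdsLT_iff_exists_Ioo_subset).1 (hV.eventually_ge_atTop 1)
  have hpq : p < q := hp
  have hL : 0 ≤ L := by simpa using (abs_nonneg _).trans (hf 1 0)
  -- Over a distance `w` the function varies by at most `(q - p) / 2`; starting above the midpoint
  -- of `p` and `q`, it stays above `p`, where `V ≥ 1`.
  set w := (q - p) / (2 * (L + 1)) with hw
  have hw0 : 0 < w := div_pos (sub_pos.2 hpq) (by positivity)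
  have hLw : L * w ≤ (q - p) / 2 := by
    have : (L + 1) * w = (q - p) / 2 := by rw [hw]; field_simp
    linarith
  have hlim := intervalIntegral_tendsto_integral hg
    (tendsto_neg_atTop_atBot.comp (tendsto_natCast_atTop_atTop (R := ℝ)))
    (tendsto_natCast_atTop_atTop (R := ℝ))
  -- Outside `[-n, n]` less than `2 w` of the integral of `g` is left, while a close approach to `q`
  -- at a point beyond `n + w` would need `2 w` there.
  obtain ⟨n, hn⟩ := (hlim.eventually (lt_mem_nhds (sub_lt_self (∫ x, g x)
    (mul_pos two_pos hw0)))).exists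
  simp only [Function.comp] at hn
  have hn0 : (0 : ℝ) ≤ n := n.cast_nonneg
  rw [intervalIntegral.integral_of_le (by linarith)] at hn
  have hfar : ∀ x, n + w < |x| → f x ≤ (p + q) / 2 := by
    intro x hx
    by_contra! hlt
    have hg1 : ∀ y ∈ Icc (x - w) (x + w), 1 ≤ g y := by
      intro y hy
      refine le_trans ?_ (hVg y)
      refine hpV ⟨?_, hfq y⟩
      have h1 : |x - y| ≤ w := abs_le.2 ⟨by linarith [hy.2], by linarith [hy.1]⟩
      have h2 := (abs_le.1 ((hf x y).trans (mul_le_mul_of_nonneg_left h1 hL))).2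
      linarith
    have hB : 2 * w ≤ ∫ y in Icc (x - w) (x + w), g y := by
      have := setIntegral_mono_on (f := fun _ => (1 : ℝ)) (μ := volume)
        (s := Icc (x - w) (x + w)) (by simp) hg.integrableOn measurableSet_Icc hg1
      simp at this
      linarith [this.1]
    have hdisj : Disjoint (Ioc (-(n : ℝ)) n) (Icc (x - w) (x + w)) := by
      rw [Set.disjoint_left]
      intro y hy hy'
      rcases lt_abs.1 hx with h | h
      · linarith [hy.2, hy'.1]
      · linarith [hy.1, hy'.2]
    have hU := setIntegral_union (μ := volume) hdisj measurableSet_Icc hg.integrableOn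
      hg.integrableOn
    have := setIntegral_le_integral (s := Ioc (-(n : ℝ)) n ∪ Icc (x - w) (x + w)) hg
      (Eventually.of_forall hg0)
    linarith
  have hfc : Continuous f := by
    have : LipschitzWith L.toNNReal f := LipschitzWith.of_dist_le' fun x y => hf x y
    exact this.continuous
  -- On the remaining compact interval the maximum is attained and is below `q`.
  obtain ⟨x0, -, hx0⟩ := (isCompact_Icc (a := -((n : ℝ) + w)) (b := n + w)).exists_isMaxOn
    ⟨0, by constructor <;> linarith⟩ hfc.continuousOn
  refine ⟨min ((q - p) / 2) (q - f x0), lt_min (by linarith) (by linarith [hfq x0]), fun x => ?_⟩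
  rcases le_or_gt |x| (n + w) with h | h
  · have h1 : f x ≤ f x0 := hx0 (abs_le.1 h)
    have := min_le_right ((q - p) / 2) (q - f x0)
    linarith
  · have h1 := hfar x h
    have := min_le_left ((q - p) / 2) (q - f x0)
    linarith

/-- Bounded functions with bounded and Lipschitz derivative. -/
def BddC11 (f : ℝ → ℝ) : Prop := ∃ L, IsC11 L L f ∧ ∀ x, |f x| ≤ L

namespace BddC11

variable {f g : ℝ → ℝ}

lemma add (hf : BddC11 f) (hg : BddC11 g) : BddC11 fun x => f x + g x := by
  obtain ⟨L, h1, h2⟩ := hf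
  obtain ⟨L', h1', h2'⟩ := hg
  refine ⟨L + L', IsC11.of_hasDerivAt (fun x => (h1.diff x).hasDerivAt.add (h1'.diff x).hasDerivAt)
    (fun x => (norm_add_le _ _).trans (add_le_add (h1.deriv_le x) (h1'.deriv_le x)))
    fun x y => ?_, fun x => (abs_add_le _ _).trans (add_le_add (h2 x) (h2' x))⟩
  rw [add_sub_add_comm, add_mul]
  exact (norm_add_le _ _).trans (add_le_add (h1.deriv_lip x y) (h1'.deriv_lip x y))

lemma mul (hf : BddC11 f) (hg : BddC11 g) : BddC11 fun x => f x * g x := by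
  obtain ⟨L, h1, h2⟩ := hf
  obtain ⟨L', h1', h2'⟩ := hg
  have hL := h1.nonneg.1
  have hL' := h1'.nonneg.1
  have b1 := h1.deriv_le
  have b1' := h1'.deriv_le
  have b2 := h1.deriv_lip
  have b2' := h1'.deriv_lip
  have b3 := h1.norm_sub_le
  have b3' := h1'.norm_sub_le
  simp only [Real.norm_eq_abs] at b1 b1' b2 b2' b3 b3'
  have key : IsC11 (2 * (L * L')) (4 * (L * L')) fun x => f x * g x := by
    refine IsC11.of_hasDerivAt (fun x => (h1.diff x).hasDerivAt.mul (h1'.diff x).hasDerivAt)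
      (fun x => ?_) fun x y => ?_
    · refine (norm_add_le _ _).trans ?_
      rw [norm_mul, norm_mul]
      simp only [Real.norm_eq_abs]
      have e1 := mul_le_mul (b1 x) (h2' x) (abs_nonneg _) hL
      have e2 := mul_le_mul (h2 x) (b1' x) (abs_nonneg _) hL
      linarith
    · have e : deriv f x * g x + f x * deriv g x - (deriv f y * g y + f y * deriv g y)
          = ((deriv f x - deriv f y) * g x + deriv f y * (g x - g y))
            + ((f x - f y) * deriv g x + f y * (deriv g x - deriv g y)) := by ring
      rw [e, Real.norm_eq_abs]
      refine (abs_add_le _ _).trans ((add_le_add (abs_add_le _ _) (abs_add_le _ _)).trans ?_)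
      rw [abs_mul, abs_mul, abs_mul, abs_mul]
      have hd := abs_nonneg (x - y)
      have e1 := mul_le_mul (b2 x y) (h2' x) (abs_nonneg _) (by positivity)
      have e2 := mul_le_mul (b1 y) (b3' x y) (abs_nonneg _) hL
      have e3 := mul_le_mul (b3 x y) (b1' x) (abs_nonneg _) (by positivity)
      have e4 := mul_le_mul (h2 y) (b2' x y) (abs_nonneg _) hL
      linarith
  have hLL : 0 ≤ L * L' := by positivity
  refine ⟨4 * (L * L'), key.mono (by linarith) le_rfl, fun x => ?_⟩
  rw [abs_mul]
  have := mul_le_mul (h2 x) (h2' x) (abs_nonneg _) hL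
  linarith

lemma const (c : ℝ) : BddC11 fun _ => c :=
  ⟨|c|, IsC11.of_hasDerivAt (fun x => hasDerivAt_const x c) (fun x => by simp)
    (fun x y => by simp; positivity), fun _ => le_rfl⟩

end BddC11

lemma BoundedDerivs.bddC11 {f : ℝ → ℝ} (h : BoundedDerivs 0 1 f) : BddC11 f := by
  obtain ⟨h1, L, h2, h3⟩ := h
  refine ⟨L, ⟨h1.differentiable (by norm_num), fun x => ?_, fun x y => ?_⟩, fun x => ?_⟩
  · simpa using h2 1 (by norm_num) le_rfl x
  · simpa using h3 x y
  · simpa using h2 0 le_rfl (by norm_num) x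

lemma BoundedDerivs.bddC11_deriv {f : ℝ → ℝ} (h : BoundedDerivs 1 2 f) : BddC11 (deriv f) := by
  obtain ⟨h1, L, h2, h3⟩ := h
  have e : iteratedDeriv 2 f = deriv (deriv f) := by
    rw [iteratedDeriv_succ, iteratedDeriv_one]
  have hd : ContDiff ℝ 1 (deriv f) := by
    have h1' : ContDiff ℝ (1 + 1) f := by norm_num; exact_mod_cast h1
    exact (contDiff_succ_iff_deriv.1 h1').2.2
  refine ⟨L, ⟨hd.differentiable (by norm_num), fun x => ?_, fun x y => ?_⟩, fun x => ?_⟩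
  · simpa [e] using h2 2 (by norm_num) le_rfl x
  · simpa [e] using h3 x y
  · simpa using h2 1 le_rfl (by norm_num) x

lemma BoundedDerivs.isC11 {f : ℝ → ℝ} (h : BoundedDerivs 1 2 f) : ∃ L, IsC11 L L f := by
  obtain ⟨L, h1, h2⟩ := h.bddC11_deriv
  exact ⟨L, h.1.differentiable (by norm_num), h2, fun x y => h1.norm_sub_le x y⟩

lemma exists_isC11_pi {ι : Type*} [Fintype ι] {U : ℝ → ι → ℝ}
    (h : ∀ i, ∃ L, IsC11 L L fun x => U x i) : ∃ L, IsC11 L L U := by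
  choose L hL using h
  have h0 : ∀ i, 0 ≤ L i := fun i => (hL i).nonneg.1
  have hle : ∀ i, L i ≤ ∑ i, L i := fun i =>
    Finset.single_le_sum (fun i _ => h0 i) (Finset.mem_univ i)
  have hs : 0 ≤ ∑ i, L i := Finset.sum_nonneg fun i _ => h0 i
  refine ⟨∑ i, L i, IsC11.of_hasDerivAt (f' := fun x i => deriv (fun x => U x i) x)
    (fun x => hasDerivAt_pi.2 fun i => ((hL i).diff x).hasDerivAt)
    (fun x => (pi_norm_le_iff_of_nonneg hs).2 fun i => ((hL i).deriv_le x).trans (hle i))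
    fun x y => (pi_norm_le_iff_of_nonneg (by positivity)).2 fun i =>
      ((hL i).deriv_lip x y).trans (by gcongr; exact hle i)⟩

variable {K1 K3 : ℝ}

/-- `f` may be unbounded, as `ψ₀` is allowed to be; periodicity makes the bounds on the derivatives
of the wave speed uniform on the line. -/
lemma bddC11_waveSpeed_comp (hK1 : 0 < K1) (hK3 : 0 < K3) {f : ℝ → ℝ} (hf : ∃ L, IsC11 L L f) :
    BddC11 fun x => waveSpeed K1 K3 (f x) := by
  have hπ := Real.two_pi_pos
  obtain ⟨L, hL0, hL⟩ := isC11On_of_translations (Ω := univ) (K := Icc 0 (2 * Real.pi))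
    (F := waveSpeed K1 K3) convex_univ isCompact_Icc (subset_univ _)
    (fun p _ => (contDiff_waveSpeed hK1 hK3).contDiffAt) (fun p _ => by
      have h1 := Int.floor_le (p / (2 * Real.pi))
      have h2 := (Int.lt_floor_add_one (p / (2 * Real.pi))).le
      rw [le_div_iff₀ hπ] at h1
      rw [div_le_iff₀ hπ] at h2
      refine ⟨-(⌊p / (2 * Real.pi)⌋ * (2 * Real.pi)), fun v => ?_, ?_, ?_⟩
      · rw [← sub_eq_add_neg]; exact waveSpeed_periodic.sub_int_mul_eq _
      · linarith
      · linarith)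
  obtain ⟨A, hA⟩ := hf
  have h1 := hL.comp hA fun x => mem_univ _
  refine ⟨max L (max (L * A) (L * A * A + L * A)), h1.mono ?_ ?_, fun x => ?_⟩
  · exact (le_max_left _ _).trans (le_max_right _ _)
  · exact (le_max_right _ _).trans (le_max_right _ _)
  · exact (hL.le _ (mem_univ _)).trans (le_max_left _ _)

/-- The initial state of the first-order system. -/
noncomputable def initialState (K1 K3 : ℝ) (ψ0 ψt0 s0 st0 : ℝ → ℝ) (x : ℝ) : Fin 6 → ℝ :=
  ![ψ0 x, s0 x, ψt0 x + 1 * (waveSpeed K1 K3 (ψ0 x) * deriv ψ0 x),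
    ψt0 x + (-1) * (waveSpeed K1 K3 (ψ0 x) * deriv ψ0 x),
    st0 x + 1 * (waveSpeed K1 K3 (ψ0 x) * deriv s0 x),
    st0 x + (-1) * (waveSpeed K1 K3 (ψ0 x) * deriv s0 x)]

variable {ψ0 ψt0 s0 st0 : ℝ → ℝ}

/-- The bound on values excludes the first two components: `ψ₀` may be unbounded, and `s₀` is
confined separately to an interval. Two orders of regularity for `ψ₀`, `s₀` against one for the
velocities are what puts all Riemann variables in the same class. -/
lemma initialState_regular (hK1 : 0 < K1) (hK3 : 0 < K3)
    (hψ0 : BoundedDerivs 1 2 ψ0) (hψt0 : BoundedDerivs 0 1 ψt0)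
    (hs0 : BoundedDerivs 1 2 s0) (hst0 : BoundedDerivs 0 1 st0) :
    (∃ L, IsC11 L L (initialState K1 K3 ψ0 ψt0 s0 st0)) ∧
      ∃ N, ∀ x, ∀ j : Fin 6, 2 ≤ j → |initialState K1 K3 ψ0 ψt0 s0 st0 x j| ≤ N := by
  have hc := bddC11_waveSpeed_comp hK1 hK3 hψ0.isC11
  have h : ∀ j : Fin 6, 2 ≤ j → BddC11 fun x => initialState K1 K3 ψ0 ψt0 s0 st0 x j := by
    intro j hj
    fin_cases j
    · simp at hj
    · simp at hj
    · exact hψt0.bddC11.add ((BddC11.const 1).mul (hc.mul hψ0.bddC11_deriv))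
    · exact hψt0.bddC11.add ((BddC11.const (-1)).mul (hc.mul hψ0.bddC11_deriv))
    · exact hst0.bddC11.add ((BddC11.const 1).mul (hc.mul hs0.bddC11_deriv))
    · exact hst0.bddC11.add ((BddC11.const (-1)).mul (hc.mul hs0.bddC11_deriv))
  constructor
  · refine exists_isC11_pi fun i => ?_
    by_cases hi : 2 ≤ i
    · obtain ⟨L, h1, -⟩ := h i hi
      exact ⟨L, h1⟩
    · have : i = 0 ∨ i = 1 := by omega
      rcases this with rfl | rfl
      exacts [hψ0.isC11, hs0.isC11]
  · have h' : ∀ j : Fin 6, ∃ N, 0 ≤ N ∧ (2 ≤ j →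
        ∀ x, |initialState K1 K3 ψ0 ψt0 s0 st0 x j| ≤ N) := by
      intro j
      by_cases hj : 2 ≤ j
      · obtain ⟨L, h1, h2⟩ := h j hj
        exact ⟨L, h1.nonneg.1, fun _ => h2⟩
      · exact ⟨0, le_rfl, fun h => absurd h hj⟩
    choose N hN0 hN using h'
    exact ⟨∑ j, N j, fun x j hj => (hN j hj x).trans
      (Finset.single_le_sum (fun j _ => hN0 j) (Finset.mem_univ j))⟩

/-- The initial order parameter stays in a compact subinterval of `(-1/2, 1)` on which it does not
vanish and the potential is nonnegative. -/
lemma exists_range_interval {K1 K3 : ℝ} {W ψ0 ψt0 s0 st0 : ℝ → ℝ} (hs0 : BoundedDerivs 1 2 s0)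
    (hrange : ∀ x, s0 x ∈ Ioo (-1 / 2 : ℝ) 1) (haway : ∃ δ > 0, ∀ x, δ ≤ |s0 x|)
    (hWpos : (∀ x, 0 < s0 x) →
      (∀ σ ∈ Ioo (0 : ℝ) 1, 0 ≤ W σ) ∧ Tendsto W (𝓝[<] (1 : ℝ)) atTop)
    (hWneg : (∀ x, s0 x < 0) →
      (∀ σ ∈ Ioo (-1 / 2 : ℝ) 0, 0 ≤ W σ) ∧ Tendsto W (𝓝[>] (-1 / 2 : ℝ)) atTop)
    (henergy : Integrable (initialEnergyDensity K1 K3 W ψ0 ψt0 s0 st0) volume) :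
    ∃ a b η : ℝ, 0 < η ∧ Icc a b ⊆ Ioo (-1 / 2 : ℝ) 1 ∧ (0 < a ∨ b < 0) ∧
      (∀ σ ∈ Icc a b, 0 ≤ W σ) ∧ ∀ x, s0 x ∈ Icc (a + η) (b - η) := by
  obtain ⟨δ, hδ, hδs⟩ := haway
  obtain ⟨L, hL⟩ := hs0.isC11
  have hlip : ∀ x y, |s0 x - s0 y| ≤ L * |x - y| := hL.norm_sub_le
  have hge : ∀ x, W (s0 x) ≤ initialEnergyDensity K1 K3 W ψ0 ψt0 s0 st0 x := fun x => by
    unfold initialEnergyDensity energyDensity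
    have : 0 ≤ (s0 x ^ 2 * (ψt0 x ^ 2 + waveSpeed K1 K3 (ψ0 x) ^ 2 * deriv ψ0 x ^ 2)
      + (st0 x ^ 2 + waveSpeed K1 K3 (ψ0 x) ^ 2 * deriv s0 x ^ 2)) / 2 := by positivity
    linarith
  -- A change of sign would force a zero by the intermediate value theorem.
  have hsign : (∀ x, 0 < s0 x) ∨ ∀ x, s0 x < 0 := by
    by_contra! h
    obtain ⟨⟨x, hx⟩, ⟨y, hy⟩⟩ := h
    obtain ⟨z, hz⟩ := mem_range_of_exists_le_of_exists_ge hs0.1.continuous ⟨x, hx⟩ ⟨y, hy⟩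
    have := hδs z
    rw [hz, abs_zero] at this
    linarith
  rcases hsign with hp | hn
  · obtain ⟨hW0, hWl⟩ := hWpos hp
    obtain ⟨η, hη, hgap⟩ := exists_gap hlip (fun x => (hrange x).2) hWl henergy
      (fun x => (hW0 _ ⟨hp x, (hrange x).2⟩).trans (hge x)) hge
    have hm1 := min_le_left (δ / 2) (η / 2)
    have hm2 := min_le_right (δ / 2) (η / 2)
    -- Half of each gap goes into the interval and the other half remains as the margin in which the
    -- solution may move.
    refine ⟨δ / 2, 1 - η / 2, min (δ / 2) (η / 2), by positivity, fun σ hσ => ?_,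
      .inl (by positivity), fun σ hσ => hW0 σ ?_, fun x => ?_⟩
    · exact ⟨by linarith [hσ.1], by linarith [hσ.2]⟩
    · exact ⟨by linarith [hσ.1], by linarith [hσ.2]⟩
    · have h1 := hδs x
      rw [abs_of_pos (hp x)] at h1
      exact ⟨by linarith, by linarith [hgap x]⟩
  · obtain ⟨hW0, hWl⟩ := hWneg hn
    -- The reflection `σ ↦ -σ` reduces the left endpoint `-1/2` to `exists_gap`, which treats
    -- barriers from below.
    have hWl' : Tendsto (fun σ => W (-σ)) (𝓝[<] (1 / 2 : ℝ)) atTop := by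
      have h1 : Tendsto Neg.neg (𝓝[<] (1 / 2 : ℝ)) (𝓝[>] (-(1 / 2 : ℝ))) :=
        tendsto_neg_nhdsLT
      rw [← neg_div] at h1
      exact hWl.comp h1
    obtain ⟨η, hη, hgap⟩ := exists_gap (f := fun x => -s0 x) (V := fun σ => W (-σ)) (q := 1 / 2)
      (L := L) (fun x y => by
        rw [← neg_sub', abs_neg]; exact hlip x y)
      (fun x => by linarith [(hrange x).1]) hWl' henergy
      (fun x => (hW0 _ ⟨(hrange x).1, hn x⟩).trans (hge x)) (fun x => by
        rw [neg_neg]; exact hge x)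
    have hm1 := min_le_left (δ / 2) (η / 2)
    have hm2 := min_le_right (δ / 2) (η / 2)
    refine ⟨-1 / 2 + η / 2, -(δ / 2), min (δ / 2) (η / 2), by positivity, fun σ hσ => ?_,
      .inr (by linarith), fun σ hσ => hW0 σ ?_, fun x => ?_⟩
    · exact ⟨by linarith [hσ.1], by linarith [hσ.2]⟩
    · exact ⟨by linarith [hσ.1], by linarith [hσ.2]⟩
    · have h1 := hδs x
      rw [abs_of_neg (hn x)] at h1
      exact ⟨by linarith [hgap x], by linarith⟩

end NVW

/-! ### Proof of the theorem. -/

theorem mainTheorem2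
    (K1 K3 : ℝ) (hK1 : 0 < K1) (hK3 : 0 < K3)
    (W : ℝ → ℝ) (hW : ContDiffOn ℝ 4 W (Ioo (-1 / 2 : ℝ) 1))
    (ψ0 ψt0 s0 st0 : ℝ → ℝ)
    (hψ0 : NVW.BoundedDerivs 1 2 ψ0) (hψt0 : NVW.BoundedDerivs 0 1 ψt0)
    (hs0 : NVW.BoundedDerivs 1 2 s0) (hst0 : NVW.BoundedDerivs 0 1 st0)
    (hrange : ∀ x, s0 x ∈ Ioo (-1 / 2 : ℝ) 1)
    (haway : ∃ δ > 0, ∀ x, δ ≤ |s0 x|)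
    (hWpos : (∀ x, 0 < s0 x) →
      (∀ σ ∈ Ioo (0 : ℝ) 1, 0 ≤ W σ) ∧ Tendsto W (𝓝[<] (1 : ℝ)) atTop)
    (hWneg : (∀ x, s0 x < 0) →
      (∀ σ ∈ Ioo (-1 / 2 : ℝ) 0, 0 ≤ W σ) ∧ Tendsto W (𝓝[>] (-1 / 2 : ℝ)) atTop)
    (henergy : Integrable (NVW.initialEnergyDensity K1 K3 W ψ0 ψt0 s0 st0) volume) :
    ∃ T > 0, ∃ ψ s : ℝ → ℝ → ℝ,
      -- existence, in the space used for the first-order formulation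
      NVW.IsClassicalSolution K1 K3 W T ψ s ∧
      NVW.HasInitialData T ψ0 ψt0 s0 st0 ψ s ∧
      (∃ δ > 0, ∀ t ∈ Icc 0 T, ∀ x, δ ≤ |s t x|) ∧
      NVW.InSolutionSpace T (fun t x => ψ t x - ψ0 x) ∧
      NVW.InSolutionSpace T s ∧
      NVW.InSolutionSpace T (NVW.dt T ψ) ∧
      NVW.InSolutionSpace T (NVW.dt T s) ∧
      NVW.InSolutionSpace T (fun t x => NVW.waveSpeed K1 K3 (ψ t x) * NVW.dx ψ t x) ∧
      NVW.InSolutionSpace T (fun t x => NVW.waveSpeed K1 K3 (ψ t x) * NVW.dx s t x) ∧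
      -- conservation of energy
      (∀ t ∈ Icc 0 T,
        Integrable (NVW.solutionEnergyDensity K1 K3 W T ψ s t) volume ∧
        ∫ x, NVW.solutionEnergyDensity K1 K3 W T ψ s t x
          = ∫ x, NVW.initialEnergyDensity K1 K3 W ψ0 ψt0 s0 st0 x) ∧
      -- uniqueness
      (∀ T' > 0, ∀ ψ' s' : ℝ → ℝ → ℝ,
        NVW.IsClassicalSolution K1 K3 W T' ψ' s' →
        NVW.HasInitialData T' ψ0 ψt0 s0 st0 ψ' s' →
        ∀ t ∈ Icc 0 (min T T'), ∀ x, ψ' t x = ψ t x ∧ s' t x = s t x) := by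
  open NVW in
  obtain ⟨a, b, η, hη, hab, hsgn, hW0, hs0ab⟩ :=
    exists_range_interval hs0 hrange haway hWpos hWneg henergy
  have h0 : (0 : ℝ) ∉ Icc a b := fun h => by
    rcases hsgn with h1 | h1
    · exact h1.not_ge h.1
    · exact h1.not_ge h.2
  obtain ⟨⟨L0, hU0⟩, N, hN⟩ := initialState_regular hK1 hK3 hψ0 hψt0 hs0 hst0
  set U0 := initialState K1 K3 ψ0 ψt0 s0 st0 with hU0def
  obtain ⟨L, hL0, hlam, hF⟩ := exists_isC11On (N := N + η) hK1 hK3 hW hab h0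
  have hΩ := convex_stateBox a b (N + η)
  -- The box bounds exceed those of the data by `η`: the order parameter has this margin in `[a,
  -- b]`, the Riemann variables have it through `N + η`, and `ψ` is unconstrained.
  have hball : ∀ x u, ‖u - U0 x‖ ≤ η → u ∈ stateBox a b (N + η) := by
    intro x u hu
    have hj : ∀ j, |u j - U0 x j| ≤ η := fun j => (norm_le_pi_norm (u - U0 x) j).trans hu
    refine ⟨?_, fun j hj2 => ?_⟩
    · have h1 := abs_le.1 (hj 1)
      have h2 := hs0ab x
      have h3 : U0 x 1 = s0 x := rfl
      rw [h3] at h1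
      exact ⟨by linarith [h1.1, h2.1], by linarith [h1.2, h2.2]⟩
    · have e : u j = U0 x j + (u j - U0 x j) := by ring
      rw [e]
      exact (abs_add_le _ _).trans (add_le_add (hN x j hj2) (hj j))
  obtain ⟨T, u, A, B, M, hT, hu0, hC11, hnear, hlip, hder⟩ :=
    exists_quasilinear_solution hΩ hlam hF hL0 hU0 hη hball
  have Q : QuasilinearSolution (charSpeed K1 K3) (source K1 K3 W) (stateBox a b (N + η)) T A B M u :=
    ⟨hT, hC11, fun t ht x => hball x _ (hnear t ht x), hlip, hder⟩
  have h0T : (0 : ℝ) ∈ Icc 0 T := ⟨le_rfl, hT.le⟩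
  have hψd : ∀ x, deriv (u 0) x 0 = deriv ψ0 x := fun x => by
    rw [← (Q.hasDerivAt_apply h0T x 0).deriv, hu0]; rfl
  have hsd : ∀ x, deriv (u 0) x 1 = deriv s0 x := fun x => by
    rw [← (Q.hasDerivAt_apply h0T x 1).deriv, hu0]; rfl
  have R : RiemannRelations K1 K3 T u := by
    refine riemannRelations hK1 hK3 Q h0 (fun x => ?_) fun x => ?_
    · rw [hψd, hu0]; simp [hU0def, initialState]; ring
    · rw [hsd, hu0]; simp [hU0def, initialState]; ring
  have hcl := isClassicalSolution_of_riemann hK1 hK3 Q hab h0 (Q.contDiffOn hlam hF) R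
  have hini : HasInitialData T ψ0 ψt0 s0 st0 (fun t x => u t x 0) fun t x => u t x 1 := by
    refine ⟨fun x => ?_, fun x => ?_, fun x => ?_, fun x => ?_⟩
    · simp [hu0, hU0def, initialState]
    · rw [R.dt_psi 0 h0T, hu0]; simp [hU0def, initialState]; ring
    · simp [hu0, hU0def, initialState]
    · rw [R.dt_s 0 h0T, hu0]; simp [hU0def, initialState]; ring
  -- The solution never leaves the box, so the endpoint of `[a, b]` nearer to `0` bounds `|s|` from
  -- below.
  have hδ : ∃ δ > 0, ∀ t ∈ Icc 0 T, ∀ x, δ ≤ |u t x 1| := by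
    rcases hsgn with h1 | h1
    · exact ⟨a, h1, fun t ht x => (Q.mem t ht x).1.1.trans (le_abs_self _)⟩
    · exact ⟨-b, by linarith, fun t ht x =>
        (neg_le_neg (Q.mem t ht x).1.2).trans (neg_le_abs _)⟩
  have hzero : IsC11 0 0 fun _ : ℝ => (0 : ℝ) :=
    IsC11.of_hasDerivAt (fun x => hasDerivAt_const x 0) (fun x => by simp) fun x y => by simp
  have hsp : ∀ p q : ℝ, ∀ i j : Fin 6, 2 ≤ i → 2 ≤ j →
      InSolutionSpace T fun t x => p * u t x i + q * u t x j := by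
    intro p q i j hi hj
    refine (Q.inSolutionSpace hΩ hlam hF (coordForm p q i j) (h := fun _ => 0)
      (N := |p| * N + |q| * N) hzero fun x => ?_).congr fun t _ x => ?_
    · rw [coordForm_apply, hu0, sub_zero]
      refine (abs_add_le _ _).trans ?_
      rw [abs_mul, abs_mul]
      have := hN x i hi
      have := hN x j hj
      gcongr
    · rw [coordForm_apply, sub_zero]
  refine ⟨T, hT, fun t x => u t x 0, fun t x => u t x 1, hcl, hini, hδ, ?_, ?_, ?_, ?_, ?_, ?_,
    fun t ht => ?_, fun T' hT' ψ' s' h' hi' => ?_⟩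
  · obtain ⟨L', hL'⟩ := hψ0.isC11
    refine (Q.inSolutionSpace hΩ hlam hF (coordForm 1 0 0 0) (h := ψ0) (N := 0) hL'
      fun x => ?_).congr fun t _ x => ?_
    · rw [coordForm_apply, hu0]; simp [hU0def, initialState]
    · rw [coordForm_apply]; ring
  · refine (Q.inSolutionSpace hΩ hlam hF (coordForm 1 0 1 1) (h := fun _ => 0) (N := 1) hzero
      fun x => ?_).congr fun t _ x => ?_
    · rw [coordForm_apply, hu0]
      have : U0 x 1 = s0 x := rfl
      rw [this, abs_le]
      constructor <;> linarith [(hrange x).1, (hrange x).2]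
    · rw [coordForm_apply]; ring
  · exact (hsp (1 / 2) (1 / 2) 2 3 (by decide) (by decide)).congr fun t ht x => by
      rw [R.dt_psi t ht x]; ring
  · exact (hsp (1 / 2) (1 / 2) 4 5 (by decide) (by decide)).congr fun t ht x => by
      rw [R.dt_s t ht x]; ring
  · exact (hsp (1 / 2) (-1 / 2) 2 3 (by decide) (by decide)).congr fun t ht x => by
      rw [R.dx_psi t ht x]; ring
  · exact (hsp (1 / 2) (-1 / 2) 4 5 (by decide) (by decide)).congr fun t ht x => by
      rw [R.dx_s t ht x]; ring
  · have e0 : initialEnergyDensity K1 K3 W ψ0 ψt0 s0 st0 = fun x => stateEnergy W (u 0 x) := by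
      funext x
      rw [hu0]
      simp [initialEnergyDensity, energyDensity, stateEnergy, hU0def, initialState]
      ring
    have et : solutionEnergyDensity K1 K3 W T (fun t x => u t x 0) (fun t x => u t x 1) t
        = fun x => stateEnergy W (u t x) := funext fun x => solutionEnergyDensity_eq R ht x
    rw [e0] at henergy ⊢
    rw [et]
    exact energy_conserved hK1 hK3 hW Q hab h0 hW0 R henergy ht
  · exact hcl.unique hK1 hK3 hW hT hT' hini
      (fun t ht x h => h0 (h ▸ (Q.mem t ht x).1)) h' hi'
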